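/- **Setting.** A streaming graph is an infinite sequence of undirected edges $e_j=(u_j,v_j,t_j)$ with integer timestamps, $t_0\le t_1\le\cdots$, unbounded, so that every window is finite. For a window size $\alpha$ and a slide interval $\beta$ with $0<\beta<\alpha$, the $i$-th window snapshot $w_i$ ($i=0,1,\dots$) consists of the edges with $t_b+i\beta\le t\le t_b+i\beta+\alpha-1$; $G(w_i)$ is the graph formed by these edges and $n_i$ is the number of its vertices (end points of edges of $w_i$). When $w_i$ is formed, the edges of $w_{i-1}$ that are not in $w_i$ are deleted (in any order), then the new edges are inserted in order of arrival, and then any finite number of connectivity queries $Q_c(u,v)$ ("is there a path between $u$ and $v$ in $G(w_i)$?") are answered. For $i=0$ nothing is deleted and all the edges of $w_0$ are inserted. **Data structure (OMST LC-Tree).** A spanning forest, with the timestamps as edge weights, is stored in link-cut trees. Only its vertices and tree edges have records; each tree edge is a record that lies between its two end points in the represented tree; vertices without tree edges are not stored. The preferred paths are held in splay trees keyed by depth, with lazy reversal and with the minimum-weight edge as aggregate. $\mathrm{access}(v)$ makes the path from $v$ to its root preferred, ending at $v$, and returns the parent of the last edge (from $v$ towards the root) that was not on a preferred path before, or $v$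 if there is none; reRoot, link and cut are built on access. * $\mathrm{query}(u,v)$: True if $u=v$; False if $u\ne v$ and one of them is not stored; otherwise do $\mathrm{access}(u)$, $\mathrm{access}(v)$ and answer True iff the preferred path of $u$ has changed, which is read off the parent pointer of $u$. * $\mathrm{insert}(e)$, $e=(u,v,t)$: a loop is ignored. If $\mathrm{query}(u,v)$ is False, $e$ is linked in as a tree edge. Otherwise a minimum tree edge $e_{\min}$ of the cycle closed by $e$ is found from aggregates after $\mathrm{access}(u)$, $\mathrm{lca}=\mathrm{access}(v)$ and then, for each $x\in\{u,v\}$ with $x\ne\mathrm{lca}$, $\mathrm{access}(x)$, $\mathrm{access}(\mathrm{lca})$ and splaying $x$. If $e_{\min}.t<t$ then $e_{\min}$ is cut and $e$ is linked in; otherwise $e$ is discarded. * $\mathrm{delete}(e)$: if $e$ is a stored tree edge, it is cut, with no search for a replacement edge; otherwise nothing is done. Time is counted on a random access machine: each look-up, read, write, allocation or release of a constant-size record costs one unit. **Theorem.** There is an absolute constant $C$ such that for every streaming graph and sliding window as above, every choice of queries and every initial segment of the resulting sequence of operations, executed from the empty data structure: 1. every operation terminates, and every query posed to $w_i$ is answered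 correctly for $G(w_i)$; 2. query, insert and delete each take $O(\log n)$ amortized time, where $n$ is the number of vertices in the window: the total time of all the operations is at most $C\sum_o\max(1,\log_2 n(o))$, where $n(o)=n_i$ if $o$ is an insertion or a query of snapshot $w_i$, and $n(o)=n_{i-1}$ if $o$ is a deletion made when passing from $w_{i-1}$ to $w_i$ (and $\max(1,\log_2 n)$ is read as $1$ for $n=0$); 3. the space is $O(n)$: after the last operation $o$ of a non-empty segment, at most $C\,n(o)$ constant-size records are stored. -/

import Mathlib

/-! # Sliding window connectivity with maximum spanning forests kept in link-cut trees -/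

namespace OMST

/-! ## The problem -/

/-- A streaming edge `(u, v, t)`: undirected, with end points `u`, `v` and timestamp `t`. -/
structure StreamEdge (V : Type) where
  u : V
  v : V
  t : ℤ
deriving DecidableEq

/-- A streaming graph together with a time-based sliding window: an infinite sequence of streaming
edges, the beginning timestamp `start` of the first window snapshot, the window size and the slide
interval, both in time units. -/
structure Input (V : Type) where
  stream : ℕ → StreamEdge V
  start : ℤ
  size : ℤ
  slide : ℤ

namespace Input

variable {V : Type} (I : Input V)

/-- The beginning timestamp of the `i`-th window snapshot (snapshots are numbered from `0`). -/
def tb (i : ℕ) : ℤ := I.start + i * I.slide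

/-- The ending timestamp of the `i`-th snapshot, which spans `size` time units. -/
def te (i : ℕ) : ℤ := I.tb i + I.size - 1

/-- The positions in the stream of the edges contained in the `i`-th snapshot. -/
def window (i : ℕ) : Set ℕ := {j | I.tb i ≤ (I.stream j).t ∧ (I.stream j).t ≤ I.te i}

/-- The graph of the `i`-th snapshot. -/
def graph (i : ℕ) : SimpleGraph V :=
  SimpleGraph.fromRel fun x y => ∃ j ∈ I.window i, (I.stream j).u = x ∧ (I.stream j).v = y

/-- The number of vertices in the `i`-th snapshot, i.e. of end points of its edges. -/
noncomputable def numVertices (i : ℕ) : ℕ :=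
  {x : V | ∃ j ∈ I.window i, x = (I.stream j).u ∨ x = (I.stream j).v}.ncard

/-- The positions of the edges that enter the window with the `i`-th snapshot. -/
def fresh : ℕ → Set ℕ
  | 0 => I.window 0
  | i + 1 => I.window (i + 1) \ I.window i

/-- The positions of the edges that expire when the `i`-th snapshot is formed. -/
def expired : ℕ → Set ℕ
  | 0 => ∅
  | i + 1 => I.window i \ I.window (i + 1)

end Input

open Classical in
/-- The members of a finite set of stream positions, in order of arrival. -/
noncomputable def arrivalList (s : Set ℕ) : List ℕ :=
  if h : s.Finite then h.toFinset.sort (· ≤ ·) else []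

/-- The operations of an index for sliding window connectivity. -/
inductive Op (V : Type) where
  | insert (e : StreamEdge V)
  | delete (e : StreamEdge V)
  | query (u v : V)

/-! ## The machine

A random access memory that holds records with a constant number of fields, one at each allocated
address. Looking up, reading, writing, allocating or freeing a record takes one unit of time. -/

/-- Addresses: there is one record for each vertex and one for each tree edge that is stored.
A tree edge has a record of its own, which lies on tree paths between those of its end points, since
a weight that is kept in the child vertex would move when a path is reversed. -/
inductive Key (V : Type) where
  | vertex (v : V)
  | edge (e : StreamEdge V)
deriving DecidableEq

/-- A record of a link-cut tree. The preferred paths are stored in splay trees, keyed by depth.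
`left`, `right` are the children in the splay tree. `parent` is the parent in the splay tree; at the
root of a splay tree it is the parent, in the represented tree, of the topmost record of the path.
`reversed` is a pending reversal of the splay subtree, `oldest` is an edge of minimum timestamp in
the splay subtree, `degree` is, at a vertex, the number of its tree edges. -/
structure Record (V : Type) where
  left : Option (Key V) := none
  right : Option (Key V) := none
  parent : Option (Key V) := none
  reversed : Bool := false
  oldest : Option (StreamEdge V) := none
  degree : ℕ := 0

structure Memory (V : Type) where
  record : Key V → Option (Record V)
  time : ℕ

namespace Memory

variable {V : Type}

def empty : Memory V := ⟨fun _ => none, 0⟩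

/-- The number of records stored; a record takes a constant number of words. -/
noncomputable def space (m : Memory V) : ℕ∞ := {k | (m.record k).isSome}.encard

end Memory

/-- Programs; `none` is an access to an address that is not allocated, or an infinite loop. -/
abbrev Prog (V : Type) := StateT (Memory V) Option

section Machine

variable {V : Type} [DecidableEq V]

def tick : Prog V Unit := fun m => some ((), { m with time := m.time + 1 })

/-- Look up whether an address is allocated. -/
def isStored (k : Key V) : Prog V Bool := do
  tick
  fun m => some ((m.record k).isSome, m)

/-- Read an allocated record. -/
def readAt (k : Key V) : Prog V (Record V) := do
  tick
  fun m => (m.record k).map fun r => (r, m)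

/-- Write a record at an address, allocating it if necessary. -/
def writeAt (k : Key V) (r : Record V) : Prog V Unit := do
  tick
  fun m => some ((), { m with record := Function.update m.record k (some r) })

/-- Free an address. -/
def freeAt (k : Key V) : Prog V Unit := do
  tick
  fun m => some ((), { m with record := Function.update m.record k none })

def modifyAt (k : Key V) (f : Record V → Record V) : Prog V Unit := do
  let r ← readAt k
  writeAt k (f r)

/-- `modifyAt`, doing nothing at a null pointer. -/
def modifyAt? (k : Option (Key V)) (f : Record V → Record V) : Prog V Unit :=
  match k with
  | none => pure ()
  | some k => modifyAt k f

/-- Run the body of a loop, for at most `k` rounds, until it returns a result `.inr b` rather than a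
new state `.inl a`. -/
def loopFor {α β : Type} (body : α → Prog V (α ⊕ β)) : ℕ → α → Prog V β
  | 0, _ => fun _ => none
  | k + 1, a => do
    match ← body a with
    | .inl a' => loopFor body k a'
    | .inr b => return b

open Classical in
/-- The unbounded loop: it has the outcome of its finitely many rounds if it halts. -/
noncomputable def loop {α β : Type} (body : α → Prog V (α ⊕ β)) (a : α) : Prog V β := fun m =>
  if h : ∃ k, (loopFor body k a m).isSome then loopFor body (Nat.find h) a m else none

end Machine

/-! ## Splay trees -/

section Splay

variable {V : Type} [DecidableEq V]

/-- One of two edges with minimum timestamp. -/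
def older : Option (StreamEdge V) → Option (StreamEdge V) → Option (StreamEdge V)
  | none, b => b
  | some a, none => some a
  | some a, some b => if a.t ≤ b.t then some a else some b

def oldestAt? : Option (Key V) → Prog V (Option (StreamEdge V))
  | none => pure none
  | some k => do return (← readAt k).oldest

def Key.ownEdge : Key V → Option (StreamEdge V)
  | .vertex _ => none
  | .edge e => some e

/-- Recompute the aggregate of `x` from its children. -/
def pull (x : Key V) : Prog V Unit := do
  let r ← readAt x
  let a ← oldestAt? r.left
  let b ← oldestAt? r.right
  writeAt x { r with oldest := older x.ownEdge (older a b) }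

def flip (r : Record V) : Record V := { r with reversed := !r.reversed }

/-- Carry out a pending reversal at `x` and hand it on to the children. -/
def push (x : Key V) : Prog V Unit := do
  let r ← readAt x
  if r.reversed then
    modifyAt? r.left flip
    modifyAt? r.right flip
    writeAt x { r with left := r.right, right := r.left, reversed := false }

/-- The parent of `x` in its splay tree, if `x` is not its root. -/
def splayParent (x : Key V) : Prog V (Option (Key V)) := do
  match (← readAt x).parent with
  | none => return none
  | some p =>
    let q ← readAt p
    return if q.left = some x ∨ q.right = some x then some p else none

/-- Rotate `x` above its parent `p` in the splay tree. -/
def rotate (x p : Key V) : Prog V Unit := do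
  let r ← readAt x
  let q ← readAt p
  modifyAt? q.parent fun g =>
    if g.left = some p then { g with left := some x }
    else if g.right = some p then { g with right := some x }
    else g
  if q.left = some x then
    modifyAt? r.right fun c => { c with parent := some p }
    writeAt p { q with left := r.right, parent := some x }
    writeAt x { r with right := some p, parent := q.parent }
  else
    modifyAt? r.left fun c => { c with parent := some p }
    writeAt p { q with right := r.left, parent := some x }
    writeAt x { r with left := some p, parent := q.parent }
  pull p
  pull x

/-- Bottom-up splaying: make `x` the root of its splay tree by zig, zig-zig and zig-zag steps. -/
noncomputable def splay (x : Key V) : Prog V Unit :=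
  loop (fun _ : Unit => do
    match ← splayParent x with
    | none =>
      push x
      return .inr ()
    | some p =>
      match ← splayParent p with
      | none =>
        push p
        push x
        rotate x p
        return .inl ()
      | some g =>
        push g
        push p
        push x
        let a ← readAt g
        let b ← readAt p
        if a.left = some p ↔ b.left = some x then
          rotate p g
          rotate x p
        else
          rotate x p
          rotate x g
        return .inl ()) ()

end Splay

/-! ## Link-cut trees -/

section LinkCut

variable {V : Type} [DecidableEq V]

/-- Climb from `v` to the root of the represented tree. The state of the loop is the current record
`w` and the path `last` that becomes the continuation of the preferred path below `w`; returns the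
last record at which such a change was made. -/
noncomputable def climb (v : Key V) : Prog V (Key V) :=
  loop (fun s : Key V × Option (Key V) => do
    let w := s.1
    let last := s.2
    splay w
    modifyAt w fun r => { r with right := last }
    pull w
    match (← readAt w).parent with
    | none => return .inr w
    | some w' => return .inl (w', some w)) (v, none)

/-- `access v` makes the path from `v` to its root a preferred path that ends in `v`, and `v` the
root of the splay tree of that path. It returns the parent of the last edge, counted from `v` to
the root, that was not on a preferred path before, and `v` itself if there is no such edge. -/
noncomputable def access (v : Key V) : Prog V (Key V) := do
  let last ← climb v
  splay v
  return last

/-- Make `v` the root of its tree. -/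
noncomputable def reRoot (v : Key V) : Prog V Unit := do
  let _ ← access v
  modifyAt v flip
  push v

/-- Make `x` the root of its tree and link it as a child of `y`, in another tree. -/
noncomputable def link (x y : Key V) : Prog V Unit := do
  reRoot x
  let _ ← access y
  modifyAt x fun r => { r with parent := some y }

/-- Separate `x` from its parent. -/
noncomputable def cut (x : Key V) : Prog V Unit := do
  let _ ← access x
  let r ← readAt x
  modifyAt? r.left fun c => { c with parent := none }
  modifyAt x fun r => { r with left := none }
  pull x

end LinkCut

/-! ## The optimized maximum spanning tree framework over link-cut trees -/

section Framework

variable {V : Type} [DecidableEq V]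

/-- Count one more tree edge at a vertex, storing the vertex if it is new. -/
def acquire (x : V) : Prog V Unit := do
  if ← isStored (.vertex x) then
    modifyAt (.vertex x) fun r => { r with degree := r.degree + 1 }
  else
    writeAt (.vertex x) { degree := 1 }

/-- Count one tree edge less at a vertex; a vertex without tree edges is no longer stored. -/
def release (x : V) : Prog V Unit := do
  let r ← readAt (.vertex x)
  if r.degree ≤ 1 then
    freeAt (.vertex x)
  else
    writeAt (.vertex x) { r with degree := r.degree - 1 }

noncomputable def insertTreeEdge (e : StreamEdge V) : Prog V Unit := do
  acquire e.u
  acquire e.v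
  writeAt (.edge e) { oldest := some e }
  link (.vertex e.u) (.edge e)
  link (.edge e) (.vertex e.v)

noncomputable def deleteTreeEdge (e : StreamEdge V) : Prog V Unit := do
  reRoot (.edge e)
  cut (.vertex e.u)
  cut (.vertex e.v)
  freeAt (.edge e)
  release e.u
  release e.v

/-- The connectivity query: after `access u` and `access v`, the preferred path of `u` has changed
iff `u` is no longer the root of a splay tree that contains the root of its tree. -/
noncomputable def query (u v : V) : Prog V Bool := do
  tick
  if u = v then
    return true
  else if (← isStored (.vertex u)) && (← isStored (.vertex v)) then
    let _ ← access (.vertex u)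
    let _ ← access (.vertex v)
    return (← readAt (.vertex u)).parent.isSome
  else
    return false

/-- A minimum edge of the tree path from `x` to its proper ancestor `a`. -/
noncomputable def minToAncestor (x a : Key V) : Prog V (Option (StreamEdge V)) := do
  if x = a then
    return none
  else
    let _ ← access x
    let _ ← access a
    splay x
    return (← readAt x).oldest

/-- A minimum tree edge in the cycle that the edge `e` closes. -/
noncomputable def findMinInCycle (e : StreamEdge V) : Prog V (Option (StreamEdge V)) := do
  let _ ← access (.vertex e.u)
  let lca ← access (.vertex e.v)
  let a ← minToAncestor (.vertex e.u) lca
  let b ← minToAncestor (.vertex e.v) lca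
  return older a b

/-- Insertion. Non-tree edges are not stored; in particular, loops are not. -/
noncomputable def insert (e : StreamEdge V) : Prog V Unit := do
  tick
  if e.u = e.v then
    return ()
  else if ← query e.u e.v then
    match ← findMinInCycle e with
    | none => return ()
    | some m =>
      if m.t < e.t then
        deleteTreeEdge m
        insertTreeEdge e
  else
    insertTreeEdge e

/-- Deletion of an expired edge, without a search for replacement edges. -/
noncomputable def delete (e : StreamEdge V) : Prog V Unit := do
  tick
  if ← isStored (.edge e) then
    deleteTreeEdge e

/-- Execute a sequence of operations; the output is the list of the answers to the queries. -/
noncomputable def run : List (Op V) → Prog V (List Bool)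
  | [] => return []
  | .insert e :: l => do insert e; run l
  | .delete e :: l => do delete e; run l
  | .query u v :: l => do
    let b ← query u v
    let bs ← run l
    return b :: bs

end Framework

/-! ## The operations that a sliding window gives rise to -/

section Schedule

variable {V : Type}

/-- The operations up to the `N`-th snapshot, each with the number of the snapshot it works on. When
snapshot `i` is formed, the edges that expire are deleted from the graph of snapshot `i - 1`, in the
order given by `expiry i`; then the new edges are inserted in order of arrival; then the queries
posed to snapshot `i` are answered. -/
noncomputable def schedule (I : Input V) (expiry : ℕ → List ℕ) (queries : ℕ → List (V × V))
    (N : ℕ) : List (Op V × ℕ) :=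
  (List.range (N + 1)).flatMap fun i =>
    (expiry i).map (fun j => (Op.delete (I.stream j), i - 1)) ++
    (arrivalList (I.fresh i)).map (fun j => (Op.insert (I.stream j), i)) ++
    (queries i).map (fun q => (Op.query q.1 q.2, i))

open Classical in
/-- The correct answers to the queries among the operations. -/
noncomputable def correctAnswers (I : Input V) (l : List (Op V × ℕ)) : List Bool :=
  l.filterMap fun
    | (.query u v, i) => some (decide ((I.graph i).Reachable u v))
    | _ => none

/-- The bound `log₂ n` for `n ≥ 2`, and `1` for `n ≤ 1`. -/
noncomputable def logBound (n : ℕ) : ℝ := max 1 (Real.logb 2 n)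

end Schedule

end OMST

/-!
# Sliding window connectivity by maximum spanning forests

*Correctness.* The stored forest `S` covers the edges `A` of the window: the end points of each
`a ∈ A` are connected by edges of `S` that are not older than `a` (`Covers`). This is the property
of a maximum spanning forest that survives both kinds of updates. If `e` closes a cycle, the oldest
edge `m` of its tree path may be exchanged for `e`, since the rest of the cycle bypasses `m` by edges
that are not older than `m` (`Stored.linked_exchange`). If the oldest edges are removed, the paths
that witness the younger edges are untouched (`Covers.erase`); since the edges that expire are older
than those that remain (`Input.edges_subset`), no replacement edge is ever needed. Hence the forest
always connects the same vertices as the snapshot (`Covers.linked_iff`).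

*Link-cut trees.* `Inv` says by conditions on single records that the memory represents a rooted
forest, given by a parent function `par`, on the vertices and on the edges, the record of an edge
lying between its end points (`Stored`). The conditions involve, for each record, the list `seq` of
its splay subtree in order of depth, and the number `sz` of its descendants in the virtual tree.
Rotations and pushes keep the lists of the splay roots, and `climb` splices them along the path to
the root; so `access`, `reRoot`, `link` and `cut` act on `par` as they should. As `access` leaves the
records of other trees alone, `query` reads connectedness off a parent pointer, and the record at
which the paths to the end points of an edge part is the one that `access` returns (`Fork`).

*Time.* The potential is the sum of `logb 2 (sz k)` over all records. A double rotation lowers it by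
two, up to three times the gain in rank of the splayed record, so that splaying from depth `n` is
paid for but for `O(1)` (`Inv.exec_splay`). Over the rounds of `climb` the gains in rank telescope,
because a splay root is no larger than its parent in the virtual tree. What remains is `O(1)` per
round. That is paid for by the final splaying of `access`: each round pushes `v` one level deeper, so
that this splaying starts at a depth equal to the number of further rounds, and it releases as much
potential (`Inv.exec_climb`, `Inv.exec_access`). `link` raises the potential by a logarithm, and
records that are added or removed are isolated and have rank zero. Thus each operation takes
logarithmic amortized time in the number of records.

*Space.* Every edge that is stored has a child, which is one of its end points, because no edge is a
root. So there are at most twice as many records as vertices in the window (`Stored.card_le`).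
-/

namespace OMST

set_option linter.unusedSectionVars false

variable {V : Type} [DecidableEq V]

/-! ### Execution of programs -/

/-- The memory in which exactly the addresses in `K` are allocated, with the records given by `f`. -/
def toMem (K : Finset (Key V)) (f : Key V → Record V) (t : ℕ) : Memory V :=
  ⟨fun k => if k ∈ K then some (f k) else none, t⟩

/-- From the records `f` at the addresses `K` the program `c` halts with result `a` and records `f'`
at the addresses `K'`, after at most `N` units of time. -/
def Exec {α : Type} (c : Prog V α) (K : Finset (Key V)) (f : Key V → Record V) (a : α)
    (K' : Finset (Key V)) (f' : Key V → Record V) (N : ℕ) : Prop :=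
  ∀ t, ∃ n ≤ N, c (toMem K f t) = some (a, toMem K' f' (t + n))

section Exec

variable {α β : Type} {K K' K'' : Finset (Key V)} {f f' f'' : Key V → Record V} {N M : ℕ}

theorem Exec.mono {c : Prog V α} {a : α} (h : Exec c K f a K' f' N) (hN : N ≤ M) :
    Exec c K f a K' f' M := fun t => by
  obtain ⟨n, hn, e⟩ := h t
  exact ⟨n, hn.trans hN, e⟩

theorem Exec.bind {c : Prog V α} {a : α} {d : α → Prog V β} {b : β}
    (h : Exec c K f a K' f' N) (h' : Exec (d a) K' f' b K'' f'' M) :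
    Exec (c >>= d) K f b K'' f'' (N + M) := fun t => by
  obtain ⟨n, hn, e⟩ := h t
  obtain ⟨m, hm, e'⟩ := h' (t + n)
  refine ⟨n + m, by omega, ?_⟩
  change (c (toMem K f t) >>= fun p => d p.1 p.2) = _
  rw [e, ← add_assoc]
  exact e'

theorem Exec.bind_le {c : Prog V α} {a : α} {d : α → Prog V β} {b : β} {L : ℕ}
    (h : Exec c K f a K' f' N) (h' : Exec (d a) K' f' b K'' f'' M) (hL : N + M ≤ L) :
    Exec (c >>= d) K f b K'' f'' L := (h.bind h').mono hL

theorem Exec.pure (a : α) : Exec (Pure.pure a : Prog V α) K f a K f 0 := fun _ => ⟨0, le_rfl, rfl⟩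

theorem exec_tick : Exec (tick : Prog V Unit) K f () K f 1 := fun _ => ⟨1, le_rfl, rfl⟩

theorem exec_isStored (k : Key V) : Exec (isStored k) K f (decide (k ∈ K)) K f 1 := fun t => by
  refine ⟨1, le_rfl, ?_⟩
  change some ((if k ∈ K then some (f k) else none : Option (Record V)).isSome, toMem K f (t + 1)) = _
  split_ifs with h <;> simp [h]

theorem exec_readAt {k : Key V} (hk : k ∈ K) : Exec (readAt k) K f (f k) K f 1 := fun t => by
  refine ⟨1, le_rfl, ?_⟩
  change (if k ∈ K then some (f k) else none : Option (Record V)).map _ = _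
  rw [if_pos hk]
  rfl

theorem exec_writeAt (k : Key V) (r : Record V) :
    Exec (writeAt k r) K f () (Insert.insert k K) (Function.update f k r) 1 := fun t => by
  refine ⟨1, le_rfl, ?_⟩
  change some ((), (⟨_, _⟩ : Memory V)) = _
  simp only [toMem]
  congr 3
  funext x
  by_cases hx : x = k
  · subst hx; simp
  · simp [hx, Function.update_of_ne]

theorem exec_writeAt_of_mem {k : Key V} (hk : k ∈ K) (r : Record V) :
    Exec (writeAt k r) K f () K (Function.update f k r) 1 := by
  have := exec_writeAt (K := K) (f := f) k r
  rwa [Finset.insert_eq_self.2 hk] at this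

theorem exec_freeAt (k : Key V) : Exec (freeAt k) K f () (K.erase k) f 1 := fun t => by
  refine ⟨1, le_rfl, ?_⟩
  change some ((), (⟨_, _⟩ : Memory V)) = _
  simp only [toMem]
  congr 3
  funext x
  by_cases hx : x = k
  · subst hx; simp
  · simp [hx, Function.update_of_ne]

theorem exec_modifyAt {k : Key V} (hk : k ∈ K) (g : Record V → Record V) :
    Exec (modifyAt k g) K f () K (Function.update f k (g (f k))) 2 :=
  Exec.bind_le (d := fun r => writeAt k (g r)) (exec_readAt hk) (exec_writeAt_of_mem hk _) le_rfl

/-- Apply `g` to the record at `k`, if `k` is not the null pointer. -/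
def updateAt? (f : Key V → Record V) (k : Option (Key V)) (g : Record V → Record V) :
    Key V → Record V :=
  match k with
  | none => f
  | some k => Function.update f k (g (f k))

theorem updateAt?_apply (f : Key V → Record V) (k : Option (Key V)) (g : Record V → Record V)
    (x : Key V) : updateAt? f k g x = if k = some x then g (f x) else f x := by
  rcases k with _ | k
  · simp [updateAt?]
  · by_cases h : x = k
    · subst h; simp [updateAt?]
    · simp [updateAt?, h, Function.update_of_ne, Ne.symm h]

theorem exec_modifyAt? {k : Option (Key V)} (hk : ∀ x, k = some x → x ∈ K)
    (g : Record V → Record V) : Exec (modifyAt? k g) K f () K (updateAt? f k g) 2 := by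
  rcases k with _ | k
  · exact (Exec.pure ()).mono (by omega)
  · exact exec_modifyAt (hk k rfl) g

/-- The aggregate at `k`, or none at the null pointer. -/
def oldestOf (f : Key V → Record V) (k : Option (Key V)) : Option (StreamEdge V) :=
  k.bind fun k => (f k).oldest

theorem exec_oldestAt? {k : Option (Key V)} (hk : ∀ x, k = some x → x ∈ K) :
    Exec (oldestAt? k) K f (oldestOf f k) K f 1 := by
  rcases k with _ | k
  · exact (Exec.pure none).mono (by omega)
  · exact Exec.bind_le (d := fun r => Pure.pure r.oldest) (exec_readAt (hk k rfl)) (Exec.pure _)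
      le_rfl

/-- The record `r` with the aggregate that `pull` computes for it at the address `x`. -/
def pulled (f : Key V → Record V) (x : Key V) : Record V :=
  { f x with oldest := older x.ownEdge (older (oldestOf f (f x).left) (oldestOf f (f x).right)) }

theorem exec_pull {x : Key V} (hx : x ∈ K) (hl : ∀ y, (f x).left = some y → y ∈ K)
    (hr : ∀ y, (f x).right = some y → y ∈ K) :
    Exec (pull x) K f () K (Function.update f x (pulled f x)) 4 := by
  unfold pull
  refine Exec.bind_le (exec_readAt hx) (M := 3) ?_ le_rfl
  refine Exec.bind_le (exec_oldestAt? hl) (M := 2) ?_ le_rfl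
  exact Exec.bind_le (exec_oldestAt? hr) (exec_writeAt_of_mem hx _) le_rfl

/-! ### Loops -/

theorem loopFor_succ {body : α → Prog V (α ⊕ β)} {k : ℕ} {a : α} {m : Memory V}
    {r : β × Memory V} (h : loopFor body k a m = some r) : loopFor body (k + 1) a m = some r := by
  induction k generalizing a m with
  | zero => exact absurd h (by simp [loopFor])
  | succ k ih =>
    change (body a m >>= fun p => _) = _ at h
    change (body a m >>= fun p => _) = _
    rcases hb : body a m with _ | ⟨s, m'⟩
    · rw [hb] at h; exact absurd h (by simp)
    · rw [hb] at h
      rcases s with a' | b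
      · exact ih h
      · exact h

theorem loopFor_mono {body : α → Prog V (α ⊕ β)} {k l : ℕ} (hkl : k ≤ l) {a : α} {m : Memory V}
    {r : β × Memory V} (h : loopFor body k a m = some r) : loopFor body l a m = some r := by
  induction hkl with
  | refl => exact h
  | step _ ih => exact loopFor_succ ih

theorem loop_eq_some_iff {body : α → Prog V (α ⊕ β)} {a : α} {m : Memory V}
    {r : β × Memory V} : loop body a m = some r ↔ ∃ k, loopFor body k a m = some r := by
  classical
  constructor
  · intro h
    unfold loop at h
    split_ifs at h with hk
    exact ⟨_, h⟩
  · rintro ⟨k, hk⟩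
    have hex : ∃ k, (loopFor body k a m).isSome = true := ⟨k, by rw [hk]; rfl⟩
    unfold loop
    rw [dif_pos hex]
    obtain ⟨r', hr'⟩ := Option.isSome_iff_exists.1 (Nat.find_spec hex)
    rw [hr', ← loopFor_mono (Nat.find_min' hex (by rw [hk]; rfl)) hr', hk]

theorem Exec.loop_done {body : α → Prog V (α ⊕ β)} {a : α} {b : β}
    (h : Exec (body a) K f (.inr b) K' f' N) : Exec (loop body a) K f b K' f' N := fun t => by
  obtain ⟨n, hn, e⟩ := h t
  refine ⟨n, hn, loop_eq_some_iff.2 ⟨1, ?_⟩⟩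
  change (body a (toMem K f t) >>= fun p => _) = _
  rw [e]
  rfl

theorem Exec.loop_step {body : α → Prog V (α ⊕ β)} {a a' : α} {b : β}
    (h : Exec (body a) K f (.inl a') K' f' N) (h' : Exec (loop body a') K' f' b K'' f'' M) :
    Exec (loop body a) K f b K'' f'' (N + M) := fun t => by
  obtain ⟨n, hn, e⟩ := h t
  obtain ⟨m, hm, e'⟩ := h' (t + n)
  obtain ⟨k, hk⟩ := loop_eq_some_iff.1 e'
  refine ⟨n + m, by omega, loop_eq_some_iff.2 ⟨k + 1, ?_⟩⟩
  change (body a (toMem K f t) >>= fun p => _) = _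
  rw [e, ← add_assoc]
  exact hk

end Exec

/-! ### Pushing and rotating -/

/-- The children of a record, the left one for `false` and the right one for `true`. -/
def Record.child (r : Record V) : Bool → Option (Key V)
  | false => r.left
  | true => r.right

/-- The effect on the records of carrying out the pending reversal at `x`. -/
structure Pushed (f f' : Key V → Record V) (x : Key V) : Prop where
  parent : ∀ k, (f' k).parent = (f k).parent
  child_self : ∀ d, (f' x).child d = (f x).child (d ^^ (f x).reversed)
  child_of_ne : ∀ k ≠ x, ∀ d, (f' k).child d = (f k).child d
  reversed_self : (f' x).reversed = false
  reversed_child : ∀ k d, (f x).child d = some k →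
    (f' k).reversed = ((f k).reversed ^^ (f x).reversed)
  oldest : ∀ k, (f' k).oldest = (f k).oldest
  degree : ∀ k, (f' k).degree = (f k).degree
  frame : ∀ k ≠ x, (∀ d, (f x).child d ≠ some k) → f' k = f k

theorem exec_push {K : Finset (Key V)} {f : Key V → Record V} {x : Key V} (hx : x ∈ K)
    (hc : ∀ d c, (f x).child d = some c → c ∈ K ∧ c ≠ x)
    (hne : ∀ c, (f x).child false = some c → (f x).child true ≠ some c) :
    ∃ f', Exec (push x) K f () K f' 6 ∧ Pushed f f' x := by
  by_cases hr : (f x).reversed = true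
  · refine ⟨Function.update (updateAt? (updateAt? f (f x).left flip) (f x).right flip) x
      { f x with left := (f x).right, right := (f x).left, reversed := false }, ?_, ?_⟩
    · unfold push
      refine Exec.bind_le (exec_readAt hx) (M := 5) ?_ le_rfl
      rw [if_pos hr]
      refine Exec.bind_le (exec_modifyAt? (fun y hy => (hc false y hy).1) _) (M := 3) ?_ le_rfl
      exact Exec.bind_le (exec_modifyAt? (fun y hy => (hc true y hy).1) _)
        (exec_writeAt_of_mem hx _) le_rfl
    · have hself : ∀ d, (f x).child d ≠ some x := fun d h => (hc d x h).2 rfl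
      have hl : (f x).left ≠ some x := hself false
      have hr' : (f x).right ≠ some x := hself true
      have key : ∀ k ≠ x, Function.update (updateAt? (updateAt? f (f x).left flip) (f x).right flip)
          x { f x with left := (f x).right, right := (f x).left, reversed := false } k =
          if (f x).left = some k ∨ (f x).right = some k then flip (f k) else f k := by
        intro k hk
        rw [Function.update_of_ne hk, updateAt?_apply, updateAt?_apply]
        by_cases h1 : (f x).left = some k
        · have h2 : (f x).right ≠ some k := hne k h1
          simp [h1, h2]
        · simp [h1]
      refine ⟨?_, ?_, ?_, ?_, ?_, ?_, ?_, ?_⟩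
      · intro k
        by_cases hk : k = x
        · subst hk; simp
        · rw [key k hk]; split_ifs <;> rfl
      · intro d
        cases d <;> simp [Record.child, hr]
      · intro k hk d
        rw [key k hk]; split_ifs <;> cases d <;> rfl
      · simp
      · intro k d hd
        have hk : k ≠ x := (hc d k hd).2
        rw [key k hk, if_pos]
        · simp [flip, hr]
        · cases d
          · exact Or.inl hd
          · exact Or.inr hd
      · intro k
        by_cases hk : k = x
        · subst hk; simp
        · rw [key k hk]; split_ifs <;> rfl
      · intro k
        by_cases hk : k = x
        · subst hk; simp
        · rw [key k hk]; split_ifs <;> rfl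
      · intro k hk hd
        rw [key k hk, if_neg]
        rintro (h | h)
        · exact hd false h
        · exact hd true h
  · refine ⟨f, ?_, ?_⟩
    · unfold push
      refine Exec.bind_le (exec_readAt hx) (M := 0) ?_ (by omega)
      rw [if_neg hr]
      exact Exec.pure ()
    · simp only [Bool.not_eq_true] at hr
      constructor <;> simp [hr]

/-- The effect on the records of rotating `x`, the child of `p` on the side `d`, above `p`. -/
structure Rotated (K : Finset (Key V)) (f f' : Key V → Record V) (x p : Key V) (d : Bool) : Prop where
  parent_x : (f' x).parent = (f p).parent
  parent_p : (f' p).parent = some x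
  parent_mid : ∀ c, (f x).child (!d) = some c → (f' c).parent = some p
  parent : ∀ k, k ≠ x → k ≠ p → (f x).child (!d) ≠ some k → (f' k).parent = (f k).parent
  child_x : (f' x).child (!d) = some p
  child_x' : (f' x).child d = (f x).child d
  child_p : (f' p).child d = (f x).child (!d)
  child_p' : (f' p).child (!d) = (f p).child (!d)
  child : ∀ k ∈ K, k ≠ x → k ≠ p → ∀ e,
    (f' k).child e = if (f k).child e = some p then some x else (f k).child e
  reversed : ∀ k, (f' k).reversed = (f k).reversed
  degree : ∀ k, (f' k).degree = (f k).degree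
  oldest : ∀ k, k ≠ x → k ≠ p → (f' k).oldest = (f k).oldest
  oldest_p : (f' p).oldest =
    older p.ownEdge (older (oldestOf f' (f' p).left) (oldestOf f' (f' p).right))
  oldest_x : (f' x).oldest =
    older x.ownEdge (older (oldestOf f' (f' x).left) (oldestOf f' (f' x).right))
  frame : ∀ k, k ≠ x → k ≠ p → (f x).child (!d) ≠ some k → (∀ e, (f k).child e ≠ some p) →
    f' k = f k

theorem oldestOf_update_pulled (f : Key V → Record V) (x : Key V) {k : Option (Key V)}
    (h : k ≠ some x) (r : Record V) : oldestOf (Function.update f x r) k = oldestOf f k := by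
  rcases k with _ | k
  · rfl
  · have : k ≠ x := fun h' => h (by rw [h'])
    simp [oldestOf, Function.update_of_ne this]

/-- The records that `rotate` leaves, step by step: `f₁` has the pointer from the grandparent changed,
and `f₂` all the pointers; the aggregates are recomputed last. -/
theorem exec_rotate_aux {K : Finset (Key V)} {f : Key V → Record V} {x p : Key V} {d : Bool}
    (hx : x ∈ K) (hp : p ∈ K) (hd : (f p).child d = some x)
    (hd' : (f p).child (!d) ≠ some x)
    (hc : ∀ c, (f x).child (!d) = some c → c ∈ K) (hg : ∀ g, (f p).parent = some g → g ∈ K) :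
    ∀ f₁ f₂, f₁ = updateAt? f (f p).parent (fun g =>
        if g.left = some p then { g with left := some x }
        else if g.right = some p then { g with right := some x }
        else g) →
      f₂ = (if d = false then
        Function.update (Function.update
          (updateAt? f₁ (f x).right fun c => { c with parent := some p })
          p { f p with left := (f x).right, parent := some x })
          x { f x with right := some p, parent := (f p).parent }
      else
        Function.update (Function.update
          (updateAt? f₁ (f x).left fun c => { c with parent := some p })
          p { f p with right := (f x).left, parent := some x })
          x { f x with left := some p, parent := (f p).parent }) →
      (∀ y, (f₂ x).left = some y → y ∈ K) → (∀ y, (f₂ x).right = some y → y ∈ K) →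
      (∀ y, (f₂ p).left = some y → y ∈ K) → (∀ y, (f₂ p).right = some y → y ∈ K) → p ≠ x →
      Exec (rotate x p) K f () K
        (Function.update (Function.update f₂ p (pulled f₂ p)) x
          (pulled (Function.update f₂ p (pulled f₂ p)) x)) 16 := by
  intro f₁ f₂ h₁ h₂ hxl hxr hpl hpr hpx
  unfold rotate
  refine Exec.bind_le (exec_readAt hx) (M := 15) ?_ le_rfl
  refine Exec.bind_le (exec_readAt hp) (M := 14) ?_ le_rfl
  refine Exec.bind_le (exec_modifyAt? hg _) (M := 12) ?_ le_rfl
  rw [← h₁]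
  have hpulls : Exec (do pull p; pull x) K f₂ () K
      (Function.update (Function.update f₂ p (pulled f₂ p)) x
          (pulled (Function.update f₂ p (pulled f₂ p)) x)) 8 := by
    refine Exec.bind_le (exec_pull hp hpl hpr) (M := 4) ?_ le_rfl
    refine exec_pull hx ?_ ?_
    · rwa [Function.update_of_ne hpx.symm]
    · rwa [Function.update_of_ne hpx.symm]
  cases d
  · rw [if_pos (by exact hd)]
    rw [if_pos rfl] at h₂
    refine Exec.bind_le (exec_modifyAt? (fun c h => hc c h) _) (M := 10) ?_ le_rfl
    refine Exec.bind_le (exec_writeAt_of_mem hp _) (M := 9) ?_ le_rfl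
    refine Exec.bind_le (exec_writeAt_of_mem hx _) (M := 8) ?_ le_rfl
    subst h₂
    exact hpulls
  · rw [if_neg (by exact hd')]
    rw [if_neg (by simp)] at h₂
    refine Exec.bind_le (exec_modifyAt? (fun c h => hc c h) _) (M := 10) ?_ le_rfl
    refine Exec.bind_le (exec_writeAt_of_mem hp _) (M := 9) ?_ le_rfl
    refine Exec.bind_le (exec_writeAt_of_mem hx _) (M := 8) ?_ le_rfl
    subst h₂
    exact hpulls

theorem exec_rotate {K : Finset (Key V)} {f : Key V → Record V} {x p : Key V} {d : Bool}
    (hx : x ∈ K) (hp : p ∈ K) (hd : (f p).child d = some x) (hpx : p ≠ x)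
    (hcx : ∀ e c, (f x).child e = some c → c ∈ K ∧ c ≠ x ∧ c ≠ p ∧ (f p).parent ≠ some c)
    (hcp : ∀ e c, (f p).child e = some c → c ∈ K ∧ c ≠ p)
    (hd' : (f p).child (!d) ≠ some x)
    (hg : ∀ g, (f p).parent = some g → g ∈ K ∧ g ≠ x ∧ g ≠ p ∧
      ((f g).child false = some p → (f g).child true ≠ some p))
    (hpar : ∀ k ∈ K, ∀ e, (f k).child e = some p → (f p).parent = some k) :
    ∃ f', Exec (rotate x p) K f () K f' 16 ∧ Rotated K f f' x p d := by
  obtain ⟨f₁, h₁⟩ : ∃ f₁, f₁ = updateAt? f (f p).parent (fun g =>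
        if g.left = some p then { g with left := some x }
        else if g.right = some p then { g with right := some x }
        else g) := ⟨_, rfl⟩
  obtain ⟨f₂, h₂⟩ : ∃ f₂, f₂ = (if d = false then
        Function.update (Function.update
          (updateAt? f₁ (f x).right fun c => { c with parent := some p })
          p { f p with left := (f x).right, parent := some x })
          x { f x with right := some p, parent := (f p).parent }
      else
        Function.update (Function.update
          (updateAt? f₁ (f x).left fun c => { c with parent := some p })
          p { f p with right := (f x).left, parent := some x })
          x { f x with left := some p, parent := (f p).parent }) := ⟨_, rfl⟩
  -- the records before the aggregates are recomputed
  have key₁ : ∀ k, f₁ k = if (f p).parent = some k then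
      (if (f k).left = some p then { f k with left := some x }
        else if (f k).right = some p then { f k with right := some x } else f k) else f k := by
    intro k; rw [h₁, updateAt?_apply]
  have hkx : f₂ x = if d = false then { f x with right := some p, parent := (f p).parent }
      else { f x with left := some p, parent := (f p).parent } := by
    rw [h₂]; cases d <;> simp
  have hkp : f₂ p = if d = false then { f p with left := (f x).right, parent := some x }
      else { f p with right := (f x).left, parent := some x } := by
    rw [h₂]; cases d <;> simp [Function.update_of_ne hpx]
  have key₂ : ∀ k, k ≠ x → k ≠ p → f₂ k =
      if (f x).child (!d) = some k then { f₁ k with parent := some p } else f₁ k := by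
    intro k h1 h2
    rw [h₂]; cases d <;> simp [Function.update_of_ne h1, Function.update_of_ne h2,
      updateAt?_apply, Record.child]
  have hexec := exec_rotate_aux hx hp hd hd' (fun c h => (hcx _ c h).1) (fun g h => (hg g h).1)
    f₁ f₂ h₁ h₂ (by
      intro y; rw [hkx]; cases d
      · simpa [Record.child] using fun h => (hcx false y h).1
      · simpa using fun h => h ▸ hp)
    (by
      intro y; rw [hkx]; cases d
      · simpa using fun h => h ▸ hp
      · simpa [Record.child] using fun h => (hcx true y h).1)
    (by
      intro y; rw [hkp]; cases d
      · simpa [Record.child] using fun h => (hcx true y h).1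
      · simpa [Record.child] using fun h => (hcp false y h).1)
    (by
      intro y; rw [hkp]; cases d
      · simpa [Record.child] using fun h => (hcp true y h).1
      · simpa [Record.child] using fun h => (hcx false y h).1) hpx
  refine ⟨_, hexec, ?_⟩
  obtain ⟨f', hf'⟩ : ∃ f', f' = Function.update (Function.update f₂ p (pulled f₂ p)) x
          (pulled (Function.update f₂ p (pulled f₂ p)) x) := ⟨_, rfl⟩
  rw [← hf']
  have hcxx : ∀ e, (f x).child e ≠ some x := fun e h => (hcx e x h).2.1 rfl
  have hcxp : ∀ e, (f x).child e ≠ some p := fun e h => (hcx e p h).2.2.1 rfl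
  have hcpp : ∀ e, (f p).child e ≠ some p := fun e h => (hcp e p h).2 rfl
  have ho : ∀ k, k ≠ x → k ≠ p → f' k = f₂ k := by
    intro k h h'; rw [hf', Function.update_of_ne h, Function.update_of_ne h']
  have hp' : f' p = pulled f₂ p := by rw [hf', Function.update_of_ne hpx, Function.update_self]
  have hx' : f' x = pulled (Function.update f₂ p (pulled f₂ p)) x := by
    rw [hf', Function.update_self]
  have hfx : ∀ e, (f₂ x).child e = if e = d then (f x).child d else some p := by
    intro e; rw [hkx]; cases d <;> cases e <;> rfl
  have hfp : ∀ e, (f₂ p).child e = if e = d then (f x).child (!d) else (f p).child (!d) := by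
    intro e; rw [hkp]; cases d <;> cases e <;> rfl
  have hcx' : ∀ e, (f' x).child e = (f₂ x).child e := by
    intro e; rw [hx']; cases e <;> simp [pulled, Record.child, Function.update_of_ne hpx.symm]
  have hcp' : ∀ e, (f' p).child e = (f₂ p).child e := by
    intro e; rw [hp']; cases e <;> simp [pulled, Record.child]
  have hfp_ne : ∀ e, (f' p).child e ≠ some x ∧ (f' p).child e ≠ some p := by
    intro e; rw [hcp', hfp]; split_ifs
    · exact ⟨hcxx _, hcxp _⟩
    · exact ⟨hd', hcpp _⟩
  have hfx_ne : ∀ e, (f' x).child e ≠ some x := by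
    intro e; rw [hcx', hfx]; split_ifs
    · exact hcxx _
    · simpa using hpx
  have hgen : ∀ k ≠ some x, oldestOf f' k = oldestOf (Function.update f₂ p (pulled f₂ p)) k := by
    intro k hk; rw [hf', oldestOf_update_pulled _ _ hk]
  refine ⟨?_, ?_, ?_, ?_, ?_, ?_, ?_, ?_, ?_, ?_, ?_, ?_, ?_, ?_, ?_⟩
  · rw [hx']; simp only [pulled, Function.update_of_ne hpx.symm, hkx]; split_ifs <;> rfl
  · rw [hp']; simp only [pulled, hkp]; split_ifs <;> rfl
  · intro c hc
    obtain ⟨-, h1, h2, -⟩ := hcx _ c hc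
    rw [ho c h1 h2, key₂ c h1 h2, if_pos hc]
  · intro k h1 h2 h3
    rw [ho k h1 h2, key₂ k h1 h2, if_neg h3, key₁]
    split_ifs <;> rfl
  · rw [hcx', hfx]; simp
  · rw [hcx', hfx]; simp
  · rw [hcp', hfp]; simp
  · rw [hcp', hfp]; simp
  · intro k hk' h1 h2 e
    rw [ho k h1 h2, key₂ k h1 h2]
    have : ∀ r : Record V, (if (f x).child (!d) = some k then { r with parent := some p } else r
      : Record V).child e = r.child e := by
      intro r; split_ifs <;> cases e <;> rfl
    rw [this, key₁]
    by_cases hk : (f p).parent = some k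
    · obtain ⟨-, -, -, hne⟩ := hg k hk
      rw [if_pos hk]
      by_cases hl : (f k).left = some p
      · have hr : (f k).right ≠ some p := hne hl
        cases e <;> simp [Record.child, hl, hr]
      · by_cases hr : (f k).right = some p
        · cases e <;> simp [Record.child, hl, hr]
        · cases e <;> simp [Record.child, hl, hr]
    · rw [if_neg hk, if_neg fun h => hk (hpar k hk' e h)]
  · intro k
    by_cases h1 : k = x
    · subst h1; rw [hx']; simp only [pulled, Function.update_of_ne hpx.symm, hkx]
      split_ifs <;> rfl
    · by_cases h2 : k = p
      · subst h2; rw [hp']; simp only [pulled, hkp]; split_ifs <;> rfl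
      · rw [ho k h1 h2, key₂ k h1 h2, key₁]; split_ifs <;> rfl
  · intro k
    by_cases h1 : k = x
    · subst h1; rw [hx']; simp only [pulled, Function.update_of_ne hpx.symm, hkx]
      split_ifs <;> rfl
    · by_cases h2 : k = p
      · subst h2; rw [hp']; simp only [pulled, hkp]; split_ifs <;> rfl
      · rw [ho k h1 h2, key₂ k h1 h2, key₁]; split_ifs <;> rfl
  · intro k h1 h2
    rw [ho k h1 h2, key₂ k h1 h2, key₁]; split_ifs <;> rfl
  · have e : ∀ e, oldestOf f₂ ((f₂ p).child e) = oldestOf f' ((f' p).child e) := by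
      intro e
      obtain ⟨e1, e2⟩ := hfp_ne e
      rw [← hcp', hgen _ e1, oldestOf_update_pulled _ _ e2]
    have e1 := e false
    have e2 := e true
    simp only [Record.child] at e1 e2
    rw [← e1, ← e2, hp']
    rfl
  · have e : ∀ e, oldestOf (Function.update f₂ p (pulled f₂ p)) ((f₂ x).child e) =
        oldestOf f' ((f' x).child e) := by
      intro e
      rw [← hcx', hgen _ (hfx_ne e)]
    have e1 := e false
    have e2 := e true
    simp only [Record.child] at e1 e2
    rw [← e1, ← e2, hx']
    simp only [pulled, Function.update_of_ne hpx.symm]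
  · intro k h1 h2 h3 h4
    have h5 : (f k).left ≠ some p := h4 false
    have h6 : (f k).right ≠ some p := h4 true
    rw [ho k h1 h2, key₂ k h1 h2, key₁]
    simp [h3, h5, h6]

/-! ### The represented forest -/

/-- The list `l` is a descending path of the forest with parent function `par`, and `q` is the parent
of its first member. -/
def PathFrom (par : Key V → Option (Key V)) : Option (Key V) → List (Key V) → Prop
  | _, [] => True
  | q, a :: l => par a = q ∧ PathFrom par (some a) l

/-- Adjacency in the forest with parent function `par`. -/
def ParAdj (par : Key V → Option (Key V)) (x y : Key V) : Prop := par x = some y ∨ par y = some x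

/-- Connectedness in the forest with parent function `par`. -/
def Conn (par : Key V → Option (Key V)) : Key V → Key V → Prop := Relation.ReflTransGen (ParAdj par)

theorem ParAdj.symm {par : Key V → Option (Key V)} {x y : Key V} (h : ParAdj par x y) :
    ParAdj par y x := Or.symm h

theorem Conn.symm {par : Key V → Option (Key V)} {x y : Key V} (h : Conn par x y) :
    Conn par y x := by
  induction h with
  | refl => exact .refl
  | tail _ h' ih => exact .head h'.symm ih

theorem PathFrom.append {par : Key V → Option (Key V)} {l l' : List (Key V)}
    {q : Option (Key V)} {a : Key V} :
    PathFrom par q (l ++ a :: l') ↔ PathFrom par q (l ++ [a]) ∧ PathFrom par (some a) l' := by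
  induction l generalizing q with
  | nil => simp [PathFrom]
  | cons b l ih => simp only [List.cons_append, PathFrom, ih, and_assoc]

theorem PathFrom.conn_some {par : Key V → Option (Key V)} {l : List (Key V)} {p y : Key V}
    (h : PathFrom par (some p) l) (hy : y ∈ l) : Conn par y p := by
  induction l generalizing p with
  | nil => simp at hy
  | cons a l ih =>
    rcases List.mem_cons.1 hy with rfl | hy
    · exact .single (Or.inl h.1)
    · exact (ih h.2 hy).tail (Or.inl h.1)

theorem PathFrom.conn {par : Key V → Option (Key V)} {l : List (Key V)} {q : Option (Key V)}
    {x y : Key V} (h : PathFrom par q l) (hx : x ∈ l) (hy : y ∈ l) : Conn par x y := by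
  cases l with
  | nil => simp at hx
  | cons a l =>
    have key : ∀ z ∈ a :: l, Conn par z a := by
      intro z hz
      rcases List.mem_cons.1 hz with rfl | hz
      · exact .refl
      · exact h.2.conn_some hz
    exact (key x hx).trans (key y hy).symm

/-- The path from a root to `a` is determined by `a`. -/
theorem PathFrom.unique {par : Key V → Option (Key V)} {a : Key V} {l l' : List (Key V)}
    (h : PathFrom par none (l ++ [a])) (h' : PathFrom par none (l' ++ [a])) : l = l' := by
  induction l using List.reverseRecOn generalizing a l' with
  | nil =>
    rcases List.eq_nil_or_concat l' with rfl | ⟨l', b, rfl⟩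
    · rfl
    · rw [List.concat_eq_append, List.append_assoc, List.singleton_append, PathFrom.append] at h'
      have h1 := h.1
      rw [h'.2.1] at h1
      cases h1
  | append_singleton l b ih =>
    rw [List.append_assoc, List.singleton_append, PathFrom.append] at h
    rcases List.eq_nil_or_concat l' with rfl | ⟨l', c, rfl⟩
    · have h1 := h'.1
      rw [h.2.1] at h1
      cases h1
    · rw [List.concat_eq_append, List.append_assoc, List.singleton_append, PathFrom.append] at h'
      have hbc := h.2.1.symm.trans h'.2.1
      cases hbc
      rw [ih h.1 h'.1, List.concat_eq_append]

theorem PathFrom.nodup {par : Key V → Option (Key V)} {l : List (Key V)}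
    (h : PathFrom par none l) : l.Nodup := by
  rw [List.nodup_iff_count_le_one]
  by_contra! hc
  obtain ⟨a, ha⟩ := hc
  obtain ⟨s, t, rfl⟩ := List.append_of_mem (List.count_pos_iff.1 (by omega : 0 < l.count a))
  rw [PathFrom.append] at h
  by_cases hs : a ∈ s
  · obtain ⟨s1, s2, rfl⟩ := List.append_of_mem hs
    have h1 := h.1
    rw [List.append_assoc, List.cons_append, PathFrom.append] at h1
    have := PathFrom.unique h1.1 h.1
    simpa using congrArg List.length this
  · have ht : a ∈ t := by
      rw [List.count_append, List.count_cons_self, List.count_eq_zero.2 hs] at ha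
      exact List.count_pos_iff.1 (by omega)
    obtain ⟨t1, t2, rfl⟩ := List.append_of_mem ht
    have h1 := PathFrom.append.1 h.2
    have h2 : PathFrom par none ((s ++ a :: t1) ++ [a]) := by
      rw [List.append_assoc, List.cons_append, PathFrom.append]
      exact ⟨h.1, h1.1⟩
    have := PathFrom.unique h.1 h2
    simpa using congrArg List.length this

/-- Connected members have the same root. -/
theorem Conn.root_eq {par : Key V → Option (Key V)} {a b x y : Key V} {l l' : List (Key V)}
    (h : Conn par x y) (hx : PathFrom par none (a :: l)) (hx' : x ∈ a :: l)
    (hy : PathFrom par none (b :: l')) (hy' : y ∈ b :: l') : a = b := by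
  -- the root of `x` is the root of every member that is connected to `x`
  have up : ∀ {q : Option (Key V)} {l : List (Key V)} {z : Key V}, PathFrom par q l → z ∈ l →
      ∀ {c}, q = some c → Relation.ReflTransGen (fun s t => par s = some t) z c := by
    intro q l
    induction l generalizing q with
    | nil => intro z _ hz; simp at hz
    | cons d l ih =>
      intro z h hz c hq
      rcases List.mem_cons.1 hz with rfl | hz
      · exact .single (h.1.trans hq)
      · exact (ih h.2 hz rfl).tail (h.1.trans hq)
  have up' : ∀ {c : Key V} {l : List (Key V)} {z : Key V}, PathFrom par none (c :: l) →
      z ∈ c :: l → Relation.ReflTransGen (fun s t => par s = some t) z c := by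
    intro c l z h hz
    rcases List.mem_cons.1 hz with rfl | hz
    · exact .refl
    · exact up h.2 hz rfl
  have hroot : ∀ {z c : Key V}, par c = none →
      Relation.ReflTransGen (fun s t => par s = some t) c z → z = c := by
    intro z c hc h
    rcases Relation.ReflTransGen.cases_head h with rfl | ⟨d, hd, -⟩
    · rfl
    · rw [hc] at hd; cases hd
  have hxa := up' hx hx'
  have key : Relation.ReflTransGen (fun s t => par s = some t) y a := by
    clear hy' hy hx'
    induction h with
    | refl => exact hxa
    | tail _ h' ih =>
      rename_i u w
      rcases h' with h' | h'
      · rcases Relation.ReflTransGen.cases_head ih with rfl | ⟨d, hd, hda⟩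
        · rw [hx.1] at h'; cases h'
        · rw [h'] at hd; cases hd; exact hda
      · exact .head h' ih
  have hyb := up' hy hy'
  have hru : Relator.RightUnique (fun s t : Key V => par s = some t) := by
    intro s t t' h h'
    exact Option.some_injective _ (h.symm.trans h')
  rcases Relation.ReflTransGen.total_of_right_unique hru key hyb with h' | h'
  · exact (hroot hx.1 h').symm
  · exact hroot hy.1 h'

/-! ### Virtual trees -/

/-- The list `l`, reversed if `b` holds. -/
def orient (b : Bool) (l : List (Key V)) : List (Key V) := if b then l.reverse else l

/-- The list of the child `k`, which is empty if there is no child. -/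
def seqOf (seq : Key V → List (Key V)) : Option (Key V) → List (Key V)
  | none => []
  | some k => seq k

/-- `o` is an edge of minimum timestamp among the edges in `l`, and none if there is no edge. -/
def IsOldest (o : Option (StreamEdge V)) (l : List (Key V)) : Prop :=
  (∀ e, o = some e → Key.edge e ∈ l) ∧ ∀ e, Key.edge e ∈ l → ∃ m, o = some m ∧ m.t ≤ e.t

/-- `a` is a child of `b` in a splay tree. -/
def IsChild (f : Key V → Record V) (a b : Key V) : Prop := ∃ d, (f b).child d = some a

/-- `x` is the root of its splay tree. -/
def SRoot (f : Key V → Record V) (x : Key V) : Prop :=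
  ∀ p, (f x).parent = some p → ¬IsChild f x p

/-- `a` is a descendant of `r` in a splay tree, `n` levels below it. -/
inductive Below (f : Key V → Record V) : Key V → ℕ → Key V → Prop
  | refl (r : Key V) : Below f r 0 r
  | step {a b r : Key V} {n : ℕ} : IsChild f a b → Below f b n r → Below f a (n + 1) r

/-- The records `f` at the addresses `K` form virtual trees which represent the forest with parent
function `par`. The conditions are local, so that they can be checked address by address:
`sz x` is the number of descendants of `x` in the virtual tree, by way of all parent pointers, and
`seq x` the list of the records in the splay subtree of `x`, in order of depth, with the pending
reversal at `x` and below, but not those above `x`, carried out. -/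
structure Inv (K : Finset (Key V)) (par : Key V → Option (Key V)) (deg : Key V → ℕ)
    (sz : Key V → ℕ) (seq : Key V → List (Key V)) (f : Key V → Record V) : Prop where
  child_mem : ∀ x ∈ K, ∀ d c, (f x).child d = some c → c ∈ K
  child_parent : ∀ x ∈ K, ∀ d c, (f x).child d = some c → (f c).parent = some x
  child_ne : ∀ x ∈ K, ∀ d c, (f x).child d = some c → (f x).child (!d) ≠ some c
  parent_mem : ∀ x ∈ K, ∀ p, (f x).parent = some p → p ∈ K
  size : ∀ x ∈ K, sz x = 1 + ∑ y ∈ K, if (f y).parent = some x then sz y else 0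
  seq_eq : ∀ x ∈ K, seq x = orient (f x).reversed
    (seqOf seq ((f x).child false) ++ x :: seqOf seq ((f x).child true))
  agg : ∀ x ∈ K, IsOldest (f x).oldest (seq x)
  path : ∀ x ∈ K, SRoot f x → PathFrom par (f x).parent (seq x)
  degree : ∀ x ∈ K, (f x).degree = deg x

theorem Below.trans_child {f : Key V → Record V} {a b r : Key V} {n : ℕ} (h : Below f a n b)
    (h' : IsChild f b r) : Below f a (n + 1) r := by
  induction h with
  | refl => exact .step h' (.refl _)
  | step hc _ ih => exact .step hc (ih h')

theorem mem_orient {b : Bool} {l : List (Key V)} {x : Key V} : x ∈ orient b l ↔ x ∈ l := by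
  unfold orient; split_ifs <;> simp

namespace Inv

variable {K : Finset (Key V)} {par : Key V → Option (Key V)} {deg sz : Key V → ℕ}
  {seq : Key V → List (Key V)} {f : Key V → Record V} {x y p r : Key V}

theorem isChild_mem (h : Inv K par deg sz seq f) (hp : p ∈ K) (hc : IsChild f x p) : x ∈ K := by
  obtain ⟨d, hd⟩ := hc
  exact h.child_mem p hp d x hd

theorem isChild_parent (h : Inv K par deg sz seq f) (hp : p ∈ K) (hc : IsChild f x p) :
    (f x).parent = some p := by
  obtain ⟨d, hd⟩ := hc
  exact h.child_parent p hp d x hd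

theorem sroot_iff (h : Inv K par deg sz seq f) (hx : x ∈ K) : SRoot f x ↔ ∀ p ∈ K, ¬IsChild f x p := by
  constructor
  · intro hr p hp hc
    exact hr p (h.isChild_parent hp hc) hc
  · intro hr p hp hc
    exact hr p (h.parent_mem x hx p hp) hc

theorem size_pos (h : Inv K par deg sz seq f) (hx : x ∈ K) : 0 < sz x := by
  rw [h.size x hx]; omega

theorem size_lt (h : Inv K par deg sz seq f) (hx : x ∈ K) (hp : (f x).parent = some p) :
    sz x < sz p := by
  rw [h.size p (h.parent_mem x hx p hp)]
  have := Finset.single_le_sum (f := fun y => if (f y).parent = some p then sz y else 0)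
    (fun _ _ => Nat.zero_le _) hx
  simp only [hp, if_true] at this
  omega

theorem size_add_lt (h : Inv K par deg sz seq f) (hx : x ∈ K) (hy : y ∈ K) (hxy : x ≠ y)
    (hp : (f x).parent = some p) (hp' : (f y).parent = some p) : sz x + sz y < sz p := by
  rw [h.size p (h.parent_mem x hx p hp)]
  have := Finset.sum_le_sum_of_subset (f := fun y => if (f y).parent = some p then sz y else 0)
    (show {x, y} ⊆ K by intro z; simp; rintro (rfl | rfl) <;> assumption)
  rw [Finset.sum_pair hxy] at this
  simp only [hp, hp', if_true] at this
  omega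

theorem size_le_card (h : Inv K par deg sz seq f) (hx : x ∈ K) : sz x ≤ K.card := by
  obtain ⟨r, hr, hmax⟩ := Finset.exists_max_image K sz ⟨x, hx⟩
  refine (hmax x hx).trans ?_
  have hroot : (f r).parent = none := by
    rcases hp : (f r).parent with _ | p
    · rfl
    · have := h.size_lt hr hp
      have := hmax p (h.parent_mem r hr p hp)
      omega
  have h1 : ∑ x ∈ K, sz x = ∑ x ∈ K, (1 + ∑ y ∈ K, if (f y).parent = some x then sz y else 0) :=
    Finset.sum_congr rfl h.size
  rw [Finset.sum_add_distrib, Finset.sum_comm] at h1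
  have h2 : ∑ y ∈ K, (if y = r then 0 else sz y) ≥
      ∑ y ∈ K, ∑ x ∈ K, if (f y).parent = some x then sz y else 0 := by
    refine Finset.sum_le_sum fun y hy => ?_
    rcases hp : (f y).parent with _ | p
    · simp
    · have : y ≠ r := by rintro rfl; rw [hroot] at hp; cases hp
      rw [if_neg this]
      simp only [Option.some.injEq]
      rw [Finset.sum_ite_eq]
      split_ifs <;> omega
  have h3 : ∑ y ∈ K, (if y = r then 0 else sz y) + sz r = ∑ y ∈ K, sz y := by
    rw [← Finset.sum_erase_add K _ hr, ← Finset.sum_erase_add K sz hr]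
    simp only [if_true, add_zero]
    congr 1
    refine Finset.sum_congr rfl fun y hy => ?_
    rw [if_neg (Finset.ne_of_mem_erase hy)]
  simp only [Finset.sum_const, smul_eq_mul, mul_one] at h1
  omega

theorem ne_parent (h : Inv K par deg sz seq f) (hx : x ∈ K) (hp : (f x).parent = some p) :
    x ≠ p := by
  rintro rfl
  exact lt_irrefl _ (h.size_lt hx hp)

theorem mem_seq_iff (h : Inv K par deg sz seq f) (hx : x ∈ K) :
    y ∈ seq x ↔ y = x ∨ ∃ c, IsChild f c x ∧ y ∈ seq c := by
  have e : ∀ o : Option (Key V), y ∈ seqOf seq o ↔ ∃ c, o = some c ∧ y ∈ seq c := by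
    intro o; rcases o with _ | c <;> simp [seqOf]
  rw [h.seq_eq x hx, mem_orient, List.mem_append, List.mem_cons, e, e]
  constructor
  · rintro (⟨c, hc, hy⟩ | rfl | ⟨c, hc, hy⟩)
    · exact Or.inr ⟨c, ⟨_, hc⟩, hy⟩
    · exact Or.inl rfl
    · exact Or.inr ⟨c, ⟨_, hc⟩, hy⟩
  · rintro (rfl | ⟨c, ⟨d, hc⟩, hy⟩)
    · exact Or.inr (Or.inl rfl)
    · cases d
      · exact Or.inl ⟨c, hc, hy⟩
      · exact Or.inr (Or.inr ⟨c, hc, hy⟩)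

theorem self_mem_seq (h : Inv K par deg sz seq f) (hx : x ∈ K) : x ∈ seq x :=
  (h.mem_seq_iff hx).2 (Or.inl rfl)

theorem below_of_mem_seq (h : Inv K par deg sz seq f) (hx : x ∈ K) (hy : y ∈ seq x) :
    ∃ n, Below f y n x := by
  induction hn : sz x using Nat.strong_induction_on generalizing x with
  | _ n ih =>
    rcases (h.mem_seq_iff hx).1 hy with rfl | ⟨c, hc, hyc⟩
    · exact ⟨0, .refl _⟩
    · have hcK := h.isChild_mem hx hc
      obtain ⟨m, hm⟩ := ih (sz c) (hn ▸ h.size_lt hcK (h.isChild_parent hx hc)) hcK hyc rfl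
      exact ⟨m + 1, hm.trans_child hc⟩

theorem below_mem (h : Inv K par deg sz seq f) {n : ℕ} (hr : r ∈ K) (hb : Below f y n r) :
    y ∈ K := by
  induction hb with
  | refl => exact hr
  | step hc _ ih => exact h.isChild_mem (ih hr) hc

theorem mem_of_mem_seq (h : Inv K par deg sz seq f) (hx : x ∈ K) (hy : y ∈ seq x) : y ∈ K := by
  obtain ⟨n, hn⟩ := h.below_of_mem_seq hx hy
  exact h.below_mem hx hn

theorem seq_subset (h : Inv K par deg sz seq f) (hr : r ∈ K) (hx : x ∈ seq r) :
    seq x ⊆ seq r := by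
  induction hn : sz r using Nat.strong_induction_on generalizing r with
  | _ n ih =>
    rcases (h.mem_seq_iff hr).1 hx with rfl | ⟨c, hc, hxc⟩
    · exact List.Subset.refl _
    · have hcK := h.isChild_mem hr hc
      intro z hz
      exact (h.mem_seq_iff hr).2 (Or.inr ⟨c, hc,
        ih (sz c) (hn ▸ h.size_lt hcK (h.isChild_parent hr hc)) hcK hxc rfl hz⟩)

theorem mem_seq_of_below (h : Inv K par deg sz seq f) {n : ℕ} (hr : r ∈ K) (hb : Below f y n r) :
    y ∈ seq r := by
  induction hb with
  | refl => exact h.self_mem_seq hr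
  | @step a b r n hc hb ih =>
    have hbK := h.below_mem hr hb
    exact h.seq_subset hr (ih hr) ((h.mem_seq_iff hbK).2
      (Or.inr ⟨a, hc, h.self_mem_seq (h.isChild_mem hbK hc)⟩))

theorem below_size_le (h : Inv K par deg sz seq f) {n : ℕ} (hr : r ∈ K) (hb : Below f y n r) :
    sz y + n ≤ sz r := by
  induction hb with
  | refl => omega
  | step hc hb ih =>
    have hbK := h.below_mem hr hb
    have := h.size_lt (h.isChild_mem hbK hc) (h.isChild_parent hbK hc)
    have := ih hr
    omega

theorem root_unique (h : Inv K par deg sz seq f) {r' : Key V} (hr : r ∈ K) (hr' : r' ∈ K)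
    (hs : SRoot f r) (hs' : SRoot f r') (hy : y ∈ seq r) (hy' : y ∈ seq r') : r = r' := by
  obtain ⟨n, hn⟩ := h.below_of_mem_seq hr hy
  obtain ⟨m, hm⟩ := h.below_of_mem_seq hr' hy'
  clear hy hy'
  induction hn generalizing m with
  | refl =>
    cases hm with
    | refl => rfl
    | step hc hb =>
      exact absurd hc (hs _ (h.isChild_parent (h.below_mem hr' hb) hc))
  | step hc hb ih =>
    cases hm with
    | refl => exact absurd hc (hs' _ (h.isChild_parent (h.below_mem hr hb) hc))
    | step hc' hb' =>
      have e := (h.isChild_parent (h.below_mem hr hb) hc).symm.trans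
        (h.isChild_parent (h.below_mem hr' hb') hc')
      cases e
      exact ih hr hs _ hb'

theorem exists_root (h : Inv K par deg sz seq f) (hx : x ∈ K) :
    ∃ r ∈ K, SRoot f r ∧ ∃ n, Below f x n r := by
  induction hn : K.card - sz x using Nat.strong_induction_on generalizing x with
  | _ n ih =>
    by_cases hr : SRoot f x
    · exact ⟨x, hx, hr, 0, .refl _⟩
    · unfold SRoot at hr
      push Not at hr
      obtain ⟨p, hp, hc⟩ := hr
      have hpK := h.parent_mem x hx p hp
      have h1 := h.size_lt hx hp
      have h2 := h.size_le_card hpK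
      obtain ⟨r, hrK, hrs, n, hb⟩ := ih (K.card - sz p) (by omega) hpK rfl
      exact ⟨r, hrK, hrs, n + 1, .step hc hb⟩

theorem conn_root (h : Inv K par deg sz seq f) (hr : r ∈ K) (hs : SRoot f r) (hx : x ∈ seq r)
    (hy : y ∈ seq r) : Conn par x y := (h.path r hr hs).conn hx hy

theorem conn_parent (h : Inv K par deg sz seq f) (hr : r ∈ K) (hs : SRoot f r) (hx : x ∈ seq r)
    (hp : (f r).parent = some p) : Conn par x p := by
  have := h.path r hr hs
  rw [hp] at this
  exact this.conn_some hx

theorem sroot_of_parent_none (hp : (f x).parent = none) : SRoot f x := by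
  intro p h
  rw [hp] at h
  cases h

end Inv

/-- The potential of the virtual trees: the sum of the logarithms of the sizes. -/
noncomputable def potential (K : Finset (Key V)) (sz : Key V → ℕ) : ℝ :=
  ∑ k ∈ K, Real.logb 2 (sz k)

/-! ### Pushing and rotating in virtual trees -/

theorem sum_sub_sum_of_eq_off {ι M : Type*} [DecidableEq ι] [AddCommGroup M] {K D : Finset ι}
    (hD : D ⊆ K) {F F' : ι → M} (h : ∀ y ∈ K, y ∉ D → F' y = F y) :
    ∑ y ∈ K, F' y - ∑ y ∈ K, F y = ∑ y ∈ D, (F' y - F y) := by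
  rw [← Finset.sum_sub_distrib]
  refine (Finset.sum_subset hD fun y hy hyD => ?_).symm
  rw [h y hy hyD, sub_self]

/-- The size of the child `k`, which is zero if there is no child. -/
def sizeOf? (sz : Key V → ℕ) : Option (Key V) → ℕ
  | none => 0
  | some k => sz k

theorem isOldest_none : IsOldest (V := V) none [] := by
  constructor <;> simp

theorem IsOldest.older {a b : Option (StreamEdge V)} {l l' : List (Key V)} (h : IsOldest a l)
    (h' : IsOldest b l') : IsOldest (older a b) (l ++ l') := by
  rcases a with _ | a
  · have hl : ∀ e, Key.edge e ∉ l := fun e he => by obtain ⟨m, hm, -⟩ := h.2 e he; cases hm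
    refine ⟨fun e he => List.mem_append_right _ (h'.1 e he), fun e he => ?_⟩
    rcases List.mem_append.1 he with he | he
    · exact absurd he (hl e)
    · exact h'.2 e he
  · rcases b with _ | b
    · have hl : ∀ e, Key.edge e ∉ l' := fun e he => by obtain ⟨m, hm, -⟩ := h'.2 e he; cases hm
      refine ⟨fun e he => List.mem_append_left _ (h.1 e he), fun e he => ?_⟩
      rcases List.mem_append.1 he with he | he
      · exact h.2 e he
      · exact absurd he (hl e)
    · have ha : ∀ e, Key.edge e ∈ l → a.t ≤ e.t := fun e he => by
        obtain ⟨m, hm, hle⟩ := h.2 e he; cases hm; exact hle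
      have hb : ∀ e, Key.edge e ∈ l' → b.t ≤ e.t := fun e he => by
        obtain ⟨m, hm, hle⟩ := h'.2 e he; cases hm; exact hle
      simp only [OMST.older]
      split_ifs with hab
      · refine ⟨fun e he => ?_, fun e he => ⟨a, rfl, ?_⟩⟩
        · cases he; exact List.mem_append_left _ (h.1 a rfl)
        · rcases List.mem_append.1 he with he | he
          · exact ha e he
          · exact hab.trans (hb e he)
      · refine ⟨fun e he => ?_, fun e he => ⟨b, rfl, ?_⟩⟩
        · cases he; exact List.mem_append_right _ (h'.1 b rfl)
        · rcases List.mem_append.1 he with he | he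
          · exact (not_le.1 hab).le.trans (ha e he)
          · exact hb e he

theorem IsOldest.of_mem_iff {a : Option (StreamEdge V)} {l l' : List (Key V)} (h : IsOldest a l)
    (hl : ∀ k, k ∈ l' ↔ k ∈ l) : IsOldest a l' :=
  ⟨fun e he => (hl _).2 (h.1 e he), fun e he => h.2 e ((hl _).1 he)⟩

/-- The aggregate that `pull` computes at `x` is right if those of the children are. -/
theorem isOldest_pull {x : Key V} {a b : Option (StreamEdge V)} {l l' : List (Key V)}
    (h : IsOldest a l) (h' : IsOldest b l') :
    IsOldest (older x.ownEdge (older a b)) (l ++ x :: l') := by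
  have hx : IsOldest x.ownEdge [x] := by
    cases x with
    | vertex v => constructor <;> simp [Key.ownEdge]
    | edge e => constructor <;> simp [Key.ownEdge]
  refine (hx.older (h.older h')).of_mem_iff fun k => ?_
  simp only [List.mem_append, List.mem_cons, List.not_mem_nil, or_false]
  tauto

namespace Inv

variable {K : Finset (Key V)} {par : Key V → Option (Key V)} {deg sz : Key V → ℕ}
  {seq : Key V → List (Key V)} {f f' : Key V → Record V} {x y p r : Key V} {d : Bool}

theorem isOldest_child (h : Inv K par deg sz seq f) (hx : x ∈ K) (d : Bool) :
    IsOldest (oldestOf f ((f x).child d)) (seqOf seq ((f x).child d)) := by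
  rcases hc : (f x).child d with _ | c
  · exact isOldest_none
  · exact h.agg c (h.child_mem x hx d c hc)

end Inv

theorem Pushed.isChild_iff {f f' : Key V → Record V} {x a b : Key V} (P : Pushed f f' x) :
    IsChild f' a b ↔ IsChild f a b := by
  unfold IsChild
  by_cases hb : b = x
  · subst hb
    simp only [P.child_self]
    exact ⟨fun ⟨d, hd⟩ => ⟨_, hd⟩, fun ⟨d, hd⟩ => ⟨d ^^ (f b).reversed, by simpa using hd⟩⟩
  · simp only [P.child_of_ne b hb]

theorem Pushed.sroot_iff {f f' : Key V → Record V} {x a : Key V} (P : Pushed f f' x) :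
    SRoot f' a ↔ SRoot f a := by
  simp only [SRoot, P.isChild_iff, P.parent]

theorem Below.congr {f f' : Key V → Record V} (hc : ∀ a b, IsChild f a b → IsChild f' a b)
    {a b : Key V} {n : ℕ} (h : Below f a n b) : Below f' a n b := by
  induction h with
  | refl => exact .refl _
  | step h' _ ih => exact .step (hc _ _ h') ih

namespace Inv

variable {K : Finset (Key V)} {par : Key V → Option (Key V)} {deg sz : Key V → ℕ}
  {seq : Key V → List (Key V)} {f f' : Key V → Record V} {x y p r : Key V} {d : Bool}

open Classical in
theorem pushed (h : Inv K par deg sz seq f) (hx : x ∈ K) (P : Pushed f f' x) :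
    Inv K par deg sz (fun k => if IsChild f k x then orient (f x).reversed (seq k) else seq k)
      f' where
  child_mem k hk d c hc := h.isChild_mem hk (P.isChild_iff.1 ⟨d, hc⟩)
  child_parent k hk d c hc := by
    rw [P.parent]; exact h.isChild_parent hk (P.isChild_iff.1 ⟨d, hc⟩)
  child_ne k hk d c hc := by
    by_cases hkx : k = x
    · subst hkx
      rw [P.child_self] at hc ⊢
      have := h.child_ne k hk _ c hc
      rwa [Bool.not_xor]
    · rw [P.child_of_ne k hkx] at hc ⊢
      exact h.child_ne k hk d c hc
  parent_mem k hk p hp := by rw [P.parent] at hp; exact h.parent_mem k hk p hp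
  size k hk := by simp only [P.parent]; exact h.size k hk
  seq_eq k hk := by
    have hself : ¬IsChild f x x := fun hc => h.ne_parent hx (h.isChild_parent hx hc) rfl
    have hother : ∀ d, k ≠ x → seqOf (fun k => if IsChild f k x then orient (f x).reversed (seq k)
        else seq k) ((f k).child d) = seqOf seq ((f k).child d) := by
      intro d hkx
      rcases hc : (f k).child d with _ | c
      · rfl
      · simp only [seqOf]
        rw [if_neg]
        intro hcx
        exact hkx (Option.some_injective _ ((h.child_parent k hk d c hc).symm.trans
          (h.isChild_parent hx hcx)))
    by_cases hkx : k = x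
    · subst hkx
      have hch : ∀ d, seqOf (fun k' => if IsChild f k' k then orient (f k).reversed (seq k')
          else seq k') ((f k).child d) = orient (f k).reversed (seqOf seq ((f k).child d)) := by
        intro d
        rcases hc : (f k).child d with _ | c
        · simp [seqOf, orient]
        · simp only [seqOf]; rw [if_pos ⟨d, hc⟩]
      rw [if_neg hself, P.reversed_self, P.child_self, P.child_self, hch, hch, h.seq_eq k hk]
      cases (f k).reversed <;> simp [orient]
    · rw [P.child_of_ne k hkx, P.child_of_ne k hkx, hother _ hkx, hother _ hkx]
      by_cases hc : IsChild f k x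
      · obtain ⟨d, hd⟩ := hc
        rw [if_pos ⟨d, hd⟩, P.reversed_child k d hd, h.seq_eq k hk]
        cases (f k).reversed <;> cases (f x).reversed <;> simp [orient]
      · rw [if_neg hc, P.frame k hkx fun d hd => hc ⟨d, hd⟩]
        exact h.seq_eq k hk
  agg k hk := by
    rw [P.oldest]
    refine (h.agg k hk).of_mem_iff fun z => ?_
    split_ifs
    · exact mem_orient
    · rfl
  path k hk hs := by
    rw [P.sroot_iff] at hs
    rw [P.parent, if_neg fun hc => hs x (h.isChild_parent hx hc) hc]
    exact h.path k hk hs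
  degree k hk := by rw [P.degree]; exact h.degree k hk

theorem exec_push (h : Inv K par deg sz seq f) (hx : x ∈ K) :
    ∃ f' seq', Exec (push x) K f () K f' 6 ∧ Inv K par deg sz seq' f' ∧ Pushed f f' x ∧
      ∀ k, ¬IsChild f k x → seq' k = seq k := by
  classical
  obtain ⟨f', hE, P⟩ := OMST.exec_push hx
    (fun d c hc => ⟨h.child_mem x hx d c hc, h.ne_parent (h.child_mem x hx d c hc)
      (h.child_parent x hx d c hc)⟩) (fun c hc => h.child_ne x hx _ c hc)
  exact ⟨f', _, hE, h.pushed hx P, P, fun k hk => if_neg hk⟩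

/-- The sizes after the rotation of `x` above `p`. -/
def rotSize (f : Key V → Record V) (sz : Key V → ℕ) (x p : Key V) (d : Bool) (k : Key V) : ℕ :=
  if k = x then sz p else if k = p then sz p - sz x + sizeOf? sz ((f x).child (!d)) else sz k

/-- The lists after the rotation of `x` above `p`. -/
def rotSeq (f' : Key V → Record V) (seq : Key V → List (Key V)) (x p : Key V) (k : Key V) :
    List (Key V) :=
  if k = x then seq p else
    if k = p then seqOf seq ((f' p).child false) ++ p :: seqOf seq ((f' p).child true) else seq k

theorem rotated (h : Inv K par deg sz seq f) (hx : x ∈ K) (hp : p ∈ K)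
    (hd : (f p).child d = some x) (hrx : (f x).reversed = false) (hrp : (f p).reversed = false)
    (R : Rotated K f f' x p d) : Inv K par deg (rotSize f sz x p d) (rotSeq f' seq x p) f' := by
  have hxp : (f x).parent = some p := h.child_parent p hp d x hd
  have hne : x ≠ p := h.ne_parent hx hxp
  have hcx : ∀ e c, (f x).child e = some c → c ∈ K ∧ (f c).parent = some x ∧ c ≠ x ∧ c ≠ p := by
    intro e c hc
    have h1 := h.child_mem x hx e c hc
    have h2 := h.child_parent x hx e c hc
    have h3 := h.size_lt h1 h2
    have h4 := h.size_lt hx hxp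
    exact ⟨h1, h2, by rintro rfl; omega, by rintro rfl; omega⟩
  have hcp : ∀ e c, (f p).child e = some c → c ∈ K ∧ (f c).parent = some p ∧ c ≠ p := by
    intro e c hc
    have h1 := h.child_mem p hp e c hc
    have h2 := h.child_parent p hp e c hc
    exact ⟨h1, h2, h.ne_parent h1 h2⟩
  have hpp : (f p).parent ≠ some x := fun hc => by
    have := h.size_lt hp hc
    have := h.size_lt hx hxp
    omega
  have hpp' : (f p).parent ≠ some p := fun hc => h.ne_parent hp hc rfl
  -- membership and parents of children
  have hch : ∀ k ∈ K, ∀ e c, (f' k).child e = some c → c ∈ K ∧ (f' c).parent = some k := by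
    intro k hk e c hc
    by_cases hkx : k = x
    · subst hkx
      rcases Bool.eq_or_eq_not e d with rfl | rfl
      · rw [R.child_x'] at hc
        obtain ⟨h1, h2, h3, h4⟩ := hcx _ c hc
        refine ⟨h1, ?_⟩
        rw [R.parent c h3 h4 fun hm => h.child_ne k hk _ c hc hm, h2]
      · rw [R.child_x] at hc
        cases hc
        exact ⟨hp, R.parent_p⟩
    · by_cases hkp : k = p
      · subst hkp
        rcases Bool.eq_or_eq_not e d with rfl | rfl
        · rw [R.child_p] at hc
          exact ⟨(hcx _ c hc).1, R.parent_mid c hc⟩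
        · rw [R.child_p'] at hc
          obtain ⟨h1, h2, h3⟩ := hcp _ c hc
          have h4 : c ≠ x := by rintro rfl; exact h.child_ne k hk _ c hd hc
          refine ⟨h1, ?_⟩
          rw [R.parent c h4 h3 fun hm => ?_, h2]
          have := (hcx _ c hm).2.1
          rw [h2] at this
          exact hne (Option.some_injective _ this.symm)
      · rw [R.child k hk hkx hkp] at hc
        split_ifs at hc with hck
        · cases hc
          exact ⟨hx, by rw [R.parent_x]; exact h.child_parent k hk e p hck⟩
        · have h1 := h.child_mem k hk e c hc
          have h2 := h.child_parent k hk e c hc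
          refine ⟨h1, ?_⟩
          rw [R.parent c ?_ ?_ ?_, h2]
          · rintro rfl; rw [h2] at hxp; exact hkp (Option.some_injective _ hxp)
          · rintro rfl; exact hck hc
          · intro hm
            have := (hcx _ c hm).2.1
            rw [h2] at this
            exact hkx (Option.some_injective _ this)
  -- the sequences of children that are neither `x` nor `p`
  have hsq : ∀ o : Option (Key V), o ≠ some x → o ≠ some p →
      seqOf (rotSeq f' seq x p) o = seqOf seq o := by
    intro o h1 h2
    rcases o with _ | c
    · rfl
    · have h1' : c ≠ x := fun e => h1 (e ▸ rfl)
      have h2' : c ≠ p := fun e => h2 (e ▸ rfl)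
      simp [seqOf, rotSeq, h1', h2']
  have hpc : ∀ e, (f' p).child e ≠ some x ∧ (f' p).child e ≠ some p := by
    intro e
    rcases Bool.eq_or_eq_not e d with rfl | rfl
    · rw [R.child_p]
      exact ⟨fun hc => (hcx _ _ hc).2.2.1 rfl, fun hc => (hcx _ _ hc).2.2.2 rfl⟩
    · rw [R.child_p']
      exact ⟨h.child_ne p hp _ x hd, fun hc => (hcp _ _ hc).2.2 rfl⟩
  have hsp : rotSeq f' seq x p p = seqOf (rotSeq f' seq x p) ((f' p).child false) ++
      p :: seqOf (rotSeq f' seq x p) ((f' p).child true) := by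
    rw [hsq _ (hpc _).1 (hpc _).2, hsq _ (hpc _).1 (hpc _).2]
    simp [rotSeq, hne.symm]
  have hsx : rotSeq f' seq x p x = seqOf (rotSeq f' seq x p) ((f' x).child false) ++
      x :: seqOf (rotSeq f' seq x p) ((f' x).child true) := by
    have e1 : seqOf (rotSeq f' seq x p) ((f' x).child d) = seqOf seq ((f x).child d) := by
      rw [R.child_x']
      exact hsq _ (fun hc => (hcx _ _ hc).2.2.1 rfl) (fun hc => (hcx _ _ hc).2.2.2 rfl)
    have e2 : seqOf (rotSeq f' seq x p) ((f' x).child (!d)) = rotSeq f' seq x p p := by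
      rw [R.child_x]; rfl
    have e3 : rotSeq f' seq x p x = seq p := by simp [rotSeq]
    have e4 := h.seq_eq p hp
    have e5 := h.seq_eq x hx
    rw [hsq _ (hpc _).1 (hpc _).2, hsq _ (hpc _).1 (hpc _).2] at hsp
    have c1 := R.child_p
    have c2 := R.child_p'
    rw [hrp] at e4
    rw [hrx] at e5
    have e6 : seqOf seq ((f p).child d) = seq x := by rw [hd]; rfl
    simp only [orient, Bool.false_eq_true, if_false] at e4 e5
    cases d
    · simp only [Bool.not_false] at e2 c1 c2
      rw [e1, e2, hsp, e3, e4, e6, e5, c1, c2]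
      simp
    · simp only [Bool.not_true] at e2 c1 c2
      rw [e1, e2, hsp, e3, e4, e6, e5, c1, c2]
      simp
  have hagg : ∀ k, k ∈ K → k ≠ x → k ≠ p → IsOldest (f' k).oldest (rotSeq f' seq x p k) := by
    intro k hk h1 h2
    rw [R.oldest k h1 h2]
    simp only [rotSeq, h1, h2, if_false]
    exact h.agg k hk
  have haggp : IsOldest (f' p).oldest (rotSeq f' seq x p p) := by
    have key : ∀ e, IsOldest (oldestOf f' ((f' p).child e))
        (seqOf (rotSeq f' seq x p) ((f' p).child e)) := by
      intro e
      have h1 := hpc e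
      rcases hc : (f' p).child e with _ | c
      · exact isOldest_none
      · rw [hc] at h1
        exact hagg c (hch p hp e c hc).1 (fun e => h1.1 (e ▸ rfl)) (fun e => h1.2 (e ▸ rfl))
    rw [R.oldest_p, hsp]
    exact isOldest_pull (key false) (key true)
  have haggx : IsOldest (f' x).oldest (rotSeq f' seq x p x) := by
    have key : ∀ e, IsOldest (oldestOf f' ((f' x).child e))
        (seqOf (rotSeq f' seq x p) ((f' x).child e)) := by
      intro e
      rcases Bool.eq_or_eq_not e d with rfl | rfl
      · rcases hc : (f' x).child e with _ | c
        · exact isOldest_none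
        · have hc' := hc
          rw [R.child_x'] at hc'
          obtain ⟨h1, -, h3, h4⟩ := hcx _ c hc'
          exact hagg c h1 h3 h4
      · rw [R.child_x]
        exact haggp
    rw [R.oldest_x, hsx]
    exact isOldest_pull (key false) (key true)
  have hmid : sizeOf? sz ((f x).child (!d)) < sz x := by
    rcases hc : (f x).child (!d) with _ | c
    · exact h.size_pos hx
    · exact h.size_lt (hcx _ c hc).1 (hcx _ c hc).2.1
  have hxltp := h.size_lt hx hxp
  -- the new sizes
  have hsize : ∀ k ∈ K, ((rotSize f sz x p d k : ℕ) : ℤ) = 1 + ∑ y ∈ K,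
      if (f' y).parent = some k then ((rotSize f sz x p d y : ℕ) : ℤ) else 0 := by
    intro k hk
    have h0 : (sz k : ℤ) = 1 + ∑ y ∈ K, if (f y).parent = some k then (sz y : ℤ) else 0 := by
      have := h.size k hk
      exact_mod_cast this
    have hsum : ∑ y ∈ K, (if (f' y).parent = some k then ((rotSize f sz x p d y : ℕ) : ℤ) else 0) -
        ∑ y ∈ K, (if (f y).parent = some k then (sz y : ℤ) else 0) =
        (if (f p).parent = some k then (sz p : ℤ) else 0) - (if p = k then (sz x : ℤ) else 0) +
        ((if x = k then (sz p : ℤ) - sz x + sizeOf? sz ((f x).child (!d)) else 0) -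
          (if (f p).parent = some k then (sz p : ℤ) else 0)) +
        ((if p = k then (sizeOf? sz ((f x).child (!d)) : ℤ) else 0) -
          (if x = k then (sizeOf? sz ((f x).child (!d)) : ℤ) else 0)) := by
      have ex : rotSize f sz x p d x = sz p := by simp [rotSize]
      have ep : ((rotSize f sz x p d p : ℕ) : ℤ) =
          (sz p : ℤ) - sz x + sizeOf? sz ((f x).child (!d)) := by
        simp only [rotSize, hne.symm, if_false, if_true]
        push_cast [hxltp.le]
        ring
      rcases hc : (f x).child (!d) with _ | c
      · rw [sum_sub_sum_of_eq_off (D := {x, p})]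
        · rw [Finset.sum_pair hne, R.parent_x, R.parent_p, ex, ep, hxp, hc]
          simp [sizeOf?]
        · intro z; simp only [Finset.mem_insert, Finset.mem_singleton]
          rintro (rfl | rfl) <;> assumption
        · intro y hy hyD
          simp only [Finset.mem_insert, Finset.mem_singleton, not_or] at hyD
          rw [R.parent y hyD.1 hyD.2 (by rw [hc]; simp)]
          simp [rotSize, hyD]
      · obtain ⟨h1, h2, h3, h4⟩ := hcx _ c hc
        rw [sum_sub_sum_of_eq_off (D := {x, p, c})]
        · rw [Finset.sum_insert (by simp [hne, h3.symm]), Finset.sum_pair h4.symm, R.parent_x,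
            R.parent_p, R.parent_mid c hc, ex, ep, hxp, h2, hc]
          simp only [sizeOf?, Option.some.injEq, rotSize, h3, h4, if_false]
          ring
        · intro z; simp only [Finset.mem_insert, Finset.mem_singleton]
          rintro (rfl | rfl | rfl) <;> assumption
        · intro y hy hyD
          simp only [Finset.mem_insert, Finset.mem_singleton, not_or] at hyD
          rw [R.parent y hyD.1 hyD.2.1 (by rw [hc]; simpa using Ne.symm hyD.2.2)]
          simp [rotSize, hyD]
    by_cases hkx : k = x
    · subst hkx
      simp only [hpp, hne.symm, if_false, if_true] at hsum
      have : rotSize f sz k p d k = sz p := by simp [rotSize]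
      rw [this]
      linarith
    · by_cases hkp : k = p
      · subst hkp
        simp only [hpp', hne, if_false, if_true] at hsum
        have : ((rotSize f sz x k d k : ℕ) : ℤ) =
            (sz k : ℤ) - sz x + sizeOf? sz ((f x).child (!d)) := by
          simp only [rotSize, hne.symm, if_false, if_true]
          push_cast [hxltp.le]
          ring
        rw [this]
        linarith
      · simp only [Ne.symm hkx, Ne.symm hkp, if_false] at hsum
        have : rotSize f sz x p d k = sz k := by simp [rotSize, hkx, hkp]
        rw [this]
        linarith
  refine ⟨fun k hk e c hc => (hch k hk e c hc).1, fun k hk e c hc => (hch k hk e c hc).2,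
    ?_, ?_, ?_, ?_, ?_, ?_, ?_⟩
  · intro k hk
    have key : ∀ c, (f' k).child d = some c → (f' k).child (!d) ≠ some c := by
      intro c hc hc'
      by_cases hkx : k = x
      · subst hkx
        rw [R.child_x'] at hc
        rw [R.child_x] at hc'
        exact (hcx _ c hc).2.2.2 (Option.some_injective _ hc').symm
      · by_cases hkp : k = p
        · subst hkp
          rw [R.child_p] at hc
          rw [R.child_p'] at hc'
          have := (hcx _ c hc).2.1.symm.trans (hcp _ c hc').2.1
          exact hne (Option.some_injective _ this)
        · rw [R.child k hk hkx hkp] at hc hc'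
          split_ifs at hc hc' with h1 h2 h2
          · exact h.child_ne k hk _ _ h1 h2
          · cases hc
            have := h.child_parent k hk _ _ hc'
            rw [hxp] at this
            exact hkp (Option.some_injective _ this.symm)
          · cases hc'
            have := h.child_parent k hk _ _ hc
            rw [hxp] at this
            exact hkp (Option.some_injective _ this.symm)
          · exact h.child_ne k hk _ _ hc hc'
    intro e c hc
    rcases Bool.eq_or_eq_not e d with rfl | rfl
    · exact key c hc
    · intro hc'
      rw [Bool.not_not] at hc'
      exact key c hc' hc
  · intro k hk q hq
    by_cases hkx : k = x
    · subst hkx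
      rw [R.parent_x] at hq
      exact h.parent_mem p hp q hq
    · by_cases hkp : k = p
      · subst hkp
        rw [R.parent_p] at hq
        cases hq
        exact hx
      · by_cases hm : (f x).child (!d) = some k
        · rw [R.parent_mid k hm] at hq
          cases hq
          exact hp
        · rw [R.parent k hkx hkp hm] at hq
          exact h.parent_mem k hk q hq
  · intro k hk
    exact_mod_cast hsize k hk
  · intro k hk
    rw [R.reversed]
    by_cases hkx : k = x
    · subst hkx; rw [hrx]; exact hsx
    · by_cases hkp : k = p
      · subst hkp; rw [hrp]; exact hsp
      · have hco : ∀ e, seqOf (rotSeq f' seq x p) ((f' k).child e) = seqOf seq ((f k).child e) := by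
          intro e
          rw [R.child k hk hkx hkp]
          split_ifs with hc
          · rw [hc]; simp [seqOf, rotSeq]
          · refine hsq _ (fun hc' => ?_) hc
            have := h.child_parent k hk _ _ hc'
            rw [hxp] at this
            exact hkp (Option.some_injective _ this.symm)
        rw [hco, hco]
        simp only [rotSeq, hkx, hkp, if_false]
        exact h.seq_eq k hk
  · intro k hk
    by_cases hkx : k = x
    · subst hkx; exact haggx
    · by_cases hkp : k = p
      · subst hkp; exact haggp
      · exact hagg k hk hkx hkp
  · intro k hk hs
    have hno : ∀ q ∈ K, ∀ e, (f' q).child e ≠ some k := fun q hq e hc =>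
      hs q (hch q hq e k hc).2 ⟨e, hc⟩
    by_cases hkx : k = x
    · subst hkx
      rw [R.parent_x]
      simp only [rotSeq, if_true]
      refine h.path p hp fun q hq hc => ?_
      obtain ⟨e, he⟩ := hc
      have hqK := h.parent_mem p hp q hq
      refine hno q hqK e ?_
      rw [R.child q hqK (fun e => hpp (e ▸ hq)) (fun e => hpp' (e ▸ hq)), if_pos he]
    · have hkp : k ≠ p := by
        rintro rfl
        exact hno x hx (!d) R.child_x
      have hm : (f x).child (!d) ≠ some k := fun hm => hno p hp d (by rw [R.child_p, hm])
      rw [R.parent k hkx hkp hm]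
      simp only [rotSeq, hkx, hkp, if_false]
      refine h.path k hk fun q hq hc => ?_
      obtain ⟨e, he⟩ := hc
      have hqK := h.parent_mem k hk q hq
      by_cases hqx : q = x
      · subst hqx
        rcases Bool.eq_or_eq_not e d with rfl | rfl
        · exact hno q hqK e (by rw [R.child_x', he])
        · exact hm he
      · by_cases hqp : q = p
        · subst hqp
          rcases Bool.eq_or_eq_not e d with rfl | rfl
          · rw [hd] at he; exact hkx (Option.some_injective _ he).symm
          · exact hno q hqK (!d) (by rw [R.child_p', he])
        · refine hno q hqK e ?_
          rw [R.child q hqK hqx hqp, if_neg, he]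
          rw [he]
          simpa using hkp
  · intro k hk
    rw [R.degree]
    exact h.degree k hk

end Inv

/-! ### Splaying -/

/-- A restructuring of the splay tree with root `r` that makes `r'` its root: the represented path
stays the same, and so does everything outside of the splay tree. -/
structure Restructured (K : Finset (Key V)) (par : Key V → Option (Key V)) (deg : Key V → ℕ)
    (sz : Key V → ℕ) (seq : Key V → List (Key V)) (f : Key V → Record V) (r : Key V)
    (sz' : Key V → ℕ) (seq' : Key V → List (Key V)) (f' : Key V → Record V) (r' : Key V) :
    Prop where
  inv : Inv K par deg sz' seq' f'
  mem : r' ∈ K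
  sroot : SRoot f' r'
  seq_eq : seq' r' = seq r
  size_eq : sz' r' = sz r
  parent_eq : (f' r').parent = (f r).parent
  frame : ∀ k ∈ K, k ∉ seq r → f' k = f k ∧ sz' k = sz k ∧ seq' k = seq k

namespace Restructured

variable {K : Finset (Key V)} {par : Key V → Option (Key V)} {deg sz sz' sz'' : Key V → ℕ}
  {seq seq' seq'' : Key V → List (Key V)} {f f' f'' : Key V → Record V} {r r' r'' : Key V}

theorem trans (h : Restructured K par deg sz seq f r sz' seq' f' r')
    (h' : Restructured K par deg sz' seq' f' r' sz'' seq'' f'' r'') :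
    Restructured K par deg sz seq f r sz'' seq'' f'' r'' where
  inv := h'.inv
  mem := h'.mem
  sroot := h'.sroot
  seq_eq := h'.seq_eq.trans h.seq_eq
  size_eq := h'.size_eq.trans h.size_eq
  parent_eq := h'.parent_eq.trans h.parent_eq
  frame k hk hkr := by
    obtain ⟨h1, h2, h3⟩ := h.frame k hk hkr
    obtain ⟨h4, h5, h6⟩ := h'.frame k hk (by rwa [h.seq_eq])
    exact ⟨h4.trans h1, h5.trans h2, h6.trans h3⟩

end Restructured

namespace Inv

variable {K : Finset (Key V)} {par : Key V → Option (Key V)} {deg sz : Key V → ℕ}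
  {seq : Key V → List (Key V)} {f f' : Key V → Record V} {x y p g r : Key V} {d : Bool}

theorem child_mem_seq (h : Inv K par deg sz seq f) (hr : r ∈ K) (hp : p ∈ seq r)
    (hc : IsChild f x p) : x ∈ seq r := by
  have hpK := h.mem_of_mem_seq hr hp
  exact h.seq_subset hr hp ((h.mem_seq_iff hpK).2
    (Or.inr ⟨x, hc, h.self_mem_seq (h.isChild_mem hpK hc)⟩))

theorem parent_mem_seq (h : Inv K par deg sz seq f) (hr : r ∈ K) (hs : SRoot f r)
    (hx : x ∈ seq r) (hp : p ∈ K) (hc : IsChild f x p) : p ∈ seq r := by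
  obtain ⟨n, hn⟩ := h.below_of_mem_seq hr hx
  cases hn with
  | refl => exact absurd hc (hs p (h.isChild_parent hp hc))
  | @step _ b _ _ hc' hb =>
    have := (h.isChild_parent hp hc).symm.trans (h.isChild_parent (h.below_mem hr hb) hc')
    cases this
    exact h.mem_seq_of_below hr hb

/-- Pushing inside the splay tree with root `r`. -/
theorem exec_push' (h : Inv K par deg sz seq f) (hr : r ∈ K) (hs : SRoot f r) (hx : x ∈ seq r) :
    ∃ f' seq', Exec (push x) K f () K f' 6 ∧ Pushed f f' x ∧
      Restructured K par deg sz seq f r sz seq' f' r := by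
  have hxK := h.mem_of_mem_seq hr hx
  obtain ⟨f', seq', hE, h', P, hseq⟩ := h.exec_push hxK
  refine ⟨f', seq', hE, P, h', hr, P.sroot_iff.2 hs, hseq r ?_, rfl, P.parent r, ?_⟩
  · exact (h.sroot_iff hr).1 hs x hxK
  · intro k hk hkr
    have hkc : ¬IsChild f k x := fun hc => hkr (h.child_mem_seq hr hx hc)
    refine ⟨P.frame k (fun e => hkr (e ▸ hx)) fun d hd => hkc ⟨d, hd⟩, rfl, hseq k hkc⟩

theorem exec_rotate (h : Inv K par deg sz seq f) {n : ℕ} (hr : r ∈ K) (hs : SRoot f r)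
    (hb : Below f p n r) (hd : (f p).child d = some x) (hrx : (f x).reversed = false)
    (hrp : (f p).reversed = false) :
    ∃ f' sz' seq' r', Exec (rotate x p) K f () K f' 16 ∧
      Restructured K par deg sz seq f r sz' seq' f' r' ∧ Rotated K f f' x p d ∧
      Below f' x n r' ∧ sz' x = sz p ∧ (∀ k, k ≠ x → k ≠ p → sz' k = sz k) ∧
      potential K sz' + Real.logb 2 (sz x) = potential K sz + Real.logb 2 (sz' p) := by
  have hp := h.below_mem hr hb
  have hx := h.child_mem p hp d x hd
  have hxp := h.child_parent p hp d x hd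
  have hne := h.ne_parent hx hxp
  have hlt := h.size_lt hx hxp
  have hcx : ∀ e c, (f x).child e = some c → c ∈ K ∧ sz c < sz x := fun e c hc =>
    ⟨h.child_mem x hx e c hc, h.size_lt (h.child_mem x hx e c hc) (h.child_parent x hx e c hc)⟩
  have hcp : ∀ e c, (f p).child e = some c → c ∈ K ∧ sz c < sz p := fun e c hc =>
    ⟨h.child_mem p hp e c hc, h.size_lt (h.child_mem p hp e c hc) (h.child_parent p hp e c hc)⟩
  have hgp : ∀ g, (f p).parent = some g → g ∈ K ∧ sz p < sz g := fun g hg =>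
    ⟨h.parent_mem p hp g hg, h.size_lt hp hg⟩
  obtain ⟨f', hE, R⟩ := OMST.exec_rotate (K := K) hx hp hd hne.symm
    (fun e c hc => ⟨(hcx e c hc).1, by rintro rfl; exact lt_irrefl _ (hcx e c hc).2,
      by rintro rfl; exact lt_asymm hlt (hcx e c hc).2,
      fun hg => by have := (hgp c hg).2; have := (hcx e c hc).2; omega⟩)
    (fun e c hc => ⟨(hcp e c hc).1, by rintro rfl; exact lt_irrefl _ (hcp e c hc).2⟩)
    (h.child_ne p hp d x hd)
    (fun g hg => ⟨(hgp g hg).1, by rintro rfl; exact lt_asymm hlt (hgp g hg).2,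
      by rintro rfl; exact lt_irrefl _ (hgp g hg).2, fun hc => h.child_ne g (hgp g hg).1 false p hc⟩)
    (fun k hk e hc => h.child_parent k hk e p hc)
  have h' := h.rotated hx hp hd hrx hrp R
  have hmid : ∀ k, sz x ≤ sz k → (f x).child (!d) ≠ some k := fun k hk hm => by
    have := (hcx _ k hm).2
    omega
  -- the ancestors of `p` stay where they are
  have hup : ∀ {a m}, Below f a m r → sz p < sz a → Below f' a m r := by
    intro a m hbm
    induction hbm with
    | refl => exact fun _ => .refl _
    | @step a b r m hc hbm ih =>
      intro ha
      have hbK := h.below_mem hr hbm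
      have hab := h.size_lt (h.isChild_mem hbK hc) (h.isChild_parent hbK hc)
      refine .step ?_ (ih hr hs (by assumption) (by omega))
      obtain ⟨e, he⟩ := hc
      refine ⟨e, ?_⟩
      rw [R.child b hbK (by rintro rfl; omega) (by rintro rfl; omega), he, if_neg]
      intro e
      cases e
      omega
  have hroot : ∃ r' ∈ K, SRoot f' r' ∧ Below f' x n r' ∧ rotSeq f' seq x p r' = seq r ∧
      rotSize f sz x p d r' = sz r ∧ (f' r').parent = (f r).parent := by
    cases hb with
    | refl =>
      refine ⟨x, hx, ?_, .refl _, by simp [rotSeq], by simp [rotSize], R.parent_x⟩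
      intro q hq hc
      rw [R.parent_x] at hq
      obtain ⟨hqK, hqs⟩ := hgp q hq
      obtain ⟨e, he⟩ := hc
      rw [R.child q hqK (by rintro rfl; omega) (by rintro rfl; omega)] at he
      split_ifs at he with h1
      · exact hs q hq ⟨e, h1⟩
      · have := h.child_parent q hqK e x he
        rw [hxp] at this
        cases this
        omega
    | @step _ b _ m hc hbm =>
      have hbK := h.below_mem hr hbm
      have hbp := h.size_lt hp (h.isChild_parent hbK hc)
      have hbr := h.below_size_le hr hbm
      have hrx : r ≠ x := by rintro rfl; omega
      have hrp : r ≠ p := by rintro rfl; omega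
      have hpr : (f' r).parent = (f r).parent := R.parent r hrx hrp (hmid r (by omega))
      refine ⟨r, hr, ?_, .step ?_ (hup hbm hbp), by simp [rotSeq, hrx, hrp],
        by simp [rotSize, hrx, hrp], hpr⟩
      · intro q hq hc
        rw [hpr] at hq
        have hqK := h.parent_mem r hr q hq
        have := h.size_lt hr hq
        obtain ⟨e, he⟩ := hc
        rw [R.child q hqK (by rintro rfl; omega) (by rintro rfl; omega)] at he
        split_ifs at he with h1
        · exact hrx (Option.some_injective _ he).symm
        · exact hs q hq ⟨e, he⟩
      · obtain ⟨e, he⟩ := hc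
        exact ⟨e, by rw [R.child b hbK (by rintro rfl; omega) (by rintro rfl; omega), if_pos he]⟩
  obtain ⟨r', hr', hs', hb', hseq, hsz, hpar⟩ := hroot
  have hpr : p ∈ seq r := h.mem_seq_of_below hr hb
  have hxr : x ∈ seq r := h.child_mem_seq hr hpr ⟨d, hd⟩
  refine ⟨f', _, _, r', hE, ⟨h', hr', hs', hseq, hsz, hpar, ?_⟩, R, hb', by simp [rotSize], ?_, ?_⟩
  · intro k hk hkr
    have h1 : k ≠ x := fun e => hkr (e ▸ hxr)
    have h2 : k ≠ p := fun e => hkr (e ▸ hpr)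
    refine ⟨R.frame k h1 h2 (fun hm => hkr (h.child_mem_seq hr hxr ⟨_, hm⟩))
      fun e he => hkr (h.parent_mem_seq hr hs hpr hk ⟨e, he⟩), by simp [rotSize, h1, h2],
      by simp [rotSeq, h1, h2]⟩
  · intro k h1 h2
    simp [rotSize, h1, h2]
  · have hsub : ({x, p} : Finset (Key V)) ⊆ K := by
      intro z; simp only [Finset.mem_insert, Finset.mem_singleton]
      rintro (rfl | rfl) <;> assumption
    have := sum_sub_sum_of_eq_off hsub (F := fun k => Real.logb 2 (sz k))
      (F' := fun k => Real.logb 2 (rotSize f sz x p d k)) (by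
        intro k _ hkD
        simp only [Finset.mem_insert, Finset.mem_singleton, not_or] at hkD
        simp [rotSize, hkD])
    rw [Finset.sum_pair hne] at this
    have hx' : rotSize f sz x p d x = sz p := by simp [rotSize]
    rw [hx'] at this
    unfold potential
    linarith

end Inv

/-- The inequality that lets a double rotation pay for itself. -/
theorem logb_add_logb_le {a b c : ℕ} (ha : 0 < a) (hb : 0 < b) (h : a + b ≤ c) :
    Real.logb 2 a + Real.logb 2 b ≤ 2 * Real.logb 2 c - 2 := by
  have ha' : (0 : ℝ) < a := by exact_mod_cast ha
  have hb' : (0 : ℝ) < b := by exact_mod_cast hb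
  have hc' : (0 : ℝ) < c := by
    have : 0 < c := by omega
    exact_mod_cast this
  have h' : (a : ℝ) + b ≤ c := by exact_mod_cast h
  have h4 : Real.logb 2 4 = 2 := by
    rw [show (4 : ℝ) = 2 ^ (2 : ℝ) by norm_num]
    exact Real.logb_rpow (by norm_num) (by norm_num)
  have key : Real.logb 2 (4 * (a * b)) ≤ Real.logb 2 (c * c) := by
    apply Real.logb_le_logb_of_le (by norm_num) (by positivity)
    nlinarith [sq_nonneg ((a : ℝ) - b)]
  rw [Real.logb_mul (by norm_num) (by positivity), Real.logb_mul ha'.ne' hb'.ne',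
    Real.logb_mul hc'.ne' hc'.ne', h4] at key
  linarith

theorem logb_mono {a b : ℕ} (ha : 0 < a) (h : a ≤ b) : Real.logb 2 a ≤ Real.logb 2 b :=
  Real.logb_le_logb_of_le (by norm_num) (by exact_mod_cast ha) (by exact_mod_cast h)

theorem logb_nonneg (a : ℕ) : 0 ≤ Real.logb 2 a := by
  rcases Nat.eq_zero_or_pos a with rfl | ha
  · simp
  · exact Real.logb_nonneg (by norm_num) (by exact_mod_cast ha)

namespace Inv

variable {K : Finset (Key V)} {par : Key V → Option (Key V)} {deg sz : Key V → ℕ}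
  {seq : Key V → List (Key V)} {f f' : Key V → Record V} {x y p g r : Key V} {d : Bool}

theorem exec_splayParent_root (h : Inv K par deg sz seq f) (hx : x ∈ K) (hs : SRoot f x) :
    Exec (splayParent x) K f none K f 2 := by
  unfold splayParent
  refine Exec.bind_le (exec_readAt hx) (M := 1) ?_ le_rfl
  rcases hp : (f x).parent with _ | p
  · exact (Exec.pure _).mono (by omega)
  · refine Exec.bind_le (exec_readAt (h.parent_mem x hx p hp)) (M := 0) ?_ le_rfl
    have : ¬((f p).left = some x ∨ (f p).right = some x) := by
      rintro (hc | hc)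
      · exact hs p hp ⟨false, hc⟩
      · exact hs p hp ⟨true, hc⟩
    rw [if_neg this]
    exact Exec.pure _

theorem exec_splayParent_child (h : Inv K par deg sz seq f) (hp : p ∈ K) (hc : IsChild f x p) :
    Exec (splayParent x) K f (some p) K f 2 := by
  unfold splayParent
  refine Exec.bind_le (exec_readAt (h.isChild_mem hp hc)) (M := 1) ?_ le_rfl
  rw [h.isChild_parent hp hc]
  refine Exec.bind_le (exec_readAt hp) (M := 0) ?_ le_rfl
  have : (f p).left = some x ∨ (f p).right = some x := by
    obtain ⟨d, hd⟩ := hc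
    cases d
    · exact Or.inl hd
    · exact Or.inr hd
  rw [if_pos this]
  exact Exec.pure _

/-- The round of the loop of `splay`. -/
def splayBody (x : Key V) : Unit → Prog V (Unit ⊕ Unit) := fun _ => do
  match ← splayParent x with
  | none =>
    push x
    return .inr ()
  | some p =>
    match ← splayParent p with
    | none =>
      push p
      push x
      rotate x p
      return .inl ()
    | some g =>
      push g
      push p
      push x
      let a ← readAt g
      let b ← readAt p
      if a.left = some p ↔ b.left = some x then
        rotate p g
        rotate x p
      else
        rotate x p
        rotate x g
      return .inl ()

theorem splay_eq (x : Key V) : splay x = loop (splayBody x) () := rfl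

theorem exec_splayBody_root (h : Inv K par deg sz seq f) (hr : r ∈ K) (hs : SRoot f r) :
    ∃ f' seq', Exec (splayBody r ()) K f (.inr ()) K f' 8 ∧ (f' r).reversed = false ∧
      Restructured K par deg sz seq f r sz seq' f' r := by
  obtain ⟨f', seq', hE, P, hM⟩ := h.exec_push' hr hs (h.self_mem_seq hr)
  refine ⟨f', seq', ?_, P.reversed_self, hM⟩
  refine Exec.bind_le (h.exec_splayParent_root hr hs) (M := 6) ?_ (by omega)
  exact Exec.bind_le hE (Exec.pure _) le_rfl

theorem exec_splayBody_zig (h : Inv K par deg sz seq f) (hr : r ∈ K) (hs : SRoot f r)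
    (hxr : IsChild f x r) :
    ∃ f' sz' seq', Exec (splayBody x ()) K f (.inl ()) K f' 60 ∧
      Restructured K par deg sz seq f r sz' seq' f' x ∧
      potential K sz' ≤ potential K sz + 3 * (Real.logb 2 (sz' x) - Real.logb 2 (sz x)) := by
  have hxs : x ∈ seq r := h.child_mem_seq hr (h.self_mem_seq hr) hxr
  obtain ⟨f₁, seq₁, hE₁, P₁, M₁⟩ := h.exec_push' hr hs (h.self_mem_seq hr)
  have hxr₁ : x ∈ seq₁ r := by rw [M₁.seq_eq]; exact hxs
  obtain ⟨f₂, seq₂, hE₂, P₂, M₂⟩ := M₁.inv.exec_push' hr M₁.sroot hxr₁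
  have hxp₂ : IsChild f₂ x r := P₂.isChild_iff.2 (P₁.isChild_iff.2 hxr)
  have hrc : ¬IsChild f₁ r x := (M₁.inv.sroot_iff hr).1 M₁.sroot x
    (M₁.inv.mem_of_mem_seq hr hxr₁)
  have hxK := h.isChild_mem hr hxr
  have hrx : r ≠ x := (h.ne_parent hxK (h.isChild_parent hr hxr)).symm
  obtain ⟨d, hd⟩ := hxp₂
  have hrev : (f₂ r).reversed = false := by
    rw [P₂.frame r hrx fun d hd => hrc ⟨d, hd⟩, P₁.reversed_self]
  obtain ⟨f₃, sz₃, seq₃, r', hE₃, M₃, R, hb₃, hx₃, hk₃, hpot⟩ :=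
    M₂.inv.exec_rotate hr M₂.sroot (.refl _) hd P₂.reversed_self hrev
  obtain rfl : x = r' := by cases hb₃; rfl
  refine ⟨f₃, sz₃, seq₃, ?_, (M₁.trans M₂).trans M₃, ?_⟩
  · refine Exec.bind_le (h.exec_splayParent_child hr hxr) (M := 58) ?_ le_rfl
    refine Exec.bind_le (h.exec_splayParent_root hr hs) (M := 56) ?_ le_rfl
    refine Exec.bind_le hE₁ (M := 50) ?_ le_rfl
    refine Exec.bind_le hE₂ (M := 44) ?_ le_rfl
    exact Exec.bind_le hE₃ (Exec.pure _) (by omega)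
  · have h1 : sz₃ r ≤ sz₃ x := (M₃.inv.size_lt hr R.parent_p).le
    have h2 := logb_mono (M₃.inv.size_pos hr) h1
    have h3 := logb_mono (h.size_pos hxK) (h.size_lt hxK (h.isChild_parent hr hxr)).le
    rw [hx₃] at h2 ⊢
    linarith

theorem exec_splayBody_double (h : Inv K par deg sz seq f) {n : ℕ} (hr : r ∈ K)
    (hs : SRoot f r) (hxp : IsChild f x p) (hpg : IsChild f p g) (hgb : Below f g n r) :
    ∃ f' sz' seq' r', Exec (splayBody x ()) K f (.inl ()) K f' 60 ∧
      Restructured K par deg sz seq f r sz' seq' f' r' ∧ Below f' x n r' ∧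
      potential K sz' + 2 ≤ potential K sz + 3 * (Real.logb 2 (sz' x) - Real.logb 2 (sz x)) := by
  have hgK := h.below_mem hr hgb
  have hpK := h.isChild_mem hgK hpg
  have hxK := h.isChild_mem hpK hxp
  have hgs := h.mem_seq_of_below hr hgb
  have hps := h.child_mem_seq hr hgs hpg
  have hxs := h.child_mem_seq hr hps hxp
  have hlt₁ := h.size_lt hxK (h.isChild_parent hpK hxp)
  have hlt₂ := h.size_lt hpK (h.isChild_parent hgK hpg)
  have hxp_ne : x ≠ p := by rintro rfl; omega
  have hpg_ne : p ≠ g := by rintro rfl; omega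
  have hxg_ne : x ≠ g := by rintro rfl; omega
  -- the pending reversals at `g`, `p` and `x`
  obtain ⟨f₁, seq₁, hE₁, P₁, M₁⟩ := h.exec_push' hr hs hgs
  obtain ⟨f₂, seq₂, hE₂, P₂, M₂⟩ := M₁.inv.exec_push' hr M₁.sroot (x := p)
    (by rw [M₁.seq_eq]; exact hps)
  obtain ⟨f₃, seq₃, hE₃, P₃, M₃⟩ := M₂.inv.exec_push' hr M₂.sroot (x := x)
    (by rw [M₂.seq_eq, M₁.seq_eq]; exact hxs)
  have hnc : ∀ {a b : Key V}, b ∈ K → sz b < sz a → ¬IsChild f a b := fun hb hab hc =>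
    lt_asymm hab (h.size_lt (h.isChild_mem hb hc) (h.isChild_parent hb hc))
  have hic : ∀ {a b : Key V}, IsChild f₃ a b ↔ IsChild f a b := fun {a b} => by
    rw [P₃.isChild_iff, P₂.isChild_iff, P₁.isChild_iff]
  have hrevx : (f₃ x).reversed = false := P₃.reversed_self
  have hrevp : (f₃ p).reversed = false := by
    rw [P₃.frame p hxp_ne.symm, P₂.reversed_self]
    intro d hd
    exact hnc hxK hlt₁ (P₁.isChild_iff.1 (P₂.isChild_iff.1 ⟨d, hd⟩))
  have hrevg : (f₃ g).reversed = false := by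
    rw [P₃.frame g hxg_ne.symm, P₂.frame g hpg_ne.symm, P₁.reversed_self]
    · intro d hd
      exact hnc hpK hlt₂ (P₁.isChild_iff.1 ⟨d, hd⟩)
    · intro d hd
      exact hnc hxK (hlt₁.trans hlt₂) (P₁.isChild_iff.1 (P₂.isChild_iff.1 ⟨d, hd⟩))
  have M := (M₁.trans M₂).trans M₃
  have hgb₃ : Below f₃ g n r := hgb.congr fun a b hc => hic.2 hc
  have hpg₃ : IsChild f₃ p g := hic.2 hpg
  obtain ⟨d₁, hd₁⟩ := hic.2 hxp
  obtain ⟨d₂, hd₂⟩ := hpg₃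
  have htest : ((f₃ g).left = some p ↔ (f₃ p).left = some x) ↔ d₁ = d₂ := by
    have e1 : (f₃ g).left = some p ↔ d₂ = false := by
      cases d₂
      · exact ⟨fun _ => rfl, fun _ => hd₂⟩
      · exact ⟨fun hc => absurd hc (M.inv.child_ne g hgK _ p hd₂), fun hc => by cases hc⟩
    have e2 : (f₃ p).left = some x ↔ d₁ = false := by
      cases d₁
      · exact ⟨fun _ => rfl, fun _ => hd₁⟩
      · exact ⟨fun hc => absurd hc (M.inv.child_ne p hpK _ x hd₁), fun hc => by cases hc⟩
    rw [e1, e2]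
    cases d₁ <;> cases d₂ <;> simp
  have hexec : ∀ {f₅ : Key V → Record V}, Exec (if (f₃ g).left = some p ↔ (f₃ p).left = some x
      then do rotate p g; rotate x p else do rotate x p; rotate x g) K f₃ () K f₅ 32 →
      Exec (splayBody x ()) K f (.inl ()) K f₅ 60 := by
    intro f₅ hE
    refine Exec.bind_le (h.exec_splayParent_child hpK hxp) (M := 58) ?_ le_rfl
    refine Exec.bind_le (h.exec_splayParent_child hgK hpg) (M := 56) ?_ le_rfl
    refine Exec.bind_le hE₁ (M := 50) ?_ le_rfl
    refine Exec.bind_le hE₂ (M := 44) ?_ le_rfl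
    refine Exec.bind_le hE₃ (M := 38) ?_ le_rfl
    refine Exec.bind_le (exec_readAt hgK) (M := 37) ?_ le_rfl
    refine Exec.bind_le (exec_readAt hpK) (M := 36) ?_ le_rfl
    by_cases ht : (f₃ g).left = some p ↔ (f₃ p).left = some x
    · rw [if_pos ht] at hE ⊢
      have := Exec.bind_le (d := fun _ => Pure.pure (Sum.inl () : Unit ⊕ Unit)) (L := 36) hE
        (Exec.pure _) (by norm_num)
      simpa only [bind_assoc] using this
    · rw [if_neg ht] at hE ⊢
      have := Exec.bind_le (d := fun _ => Pure.pure (Sum.inl () : Unit ⊕ Unit)) (L := 36) hE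
        (Exec.pure _) (by norm_num)
      simpa only [bind_assoc] using this
  have hposx := h.size_pos hxK
  have hlogxp := logb_mono hposx hlt₁.le
  by_cases hd : d₁ = d₂
  · -- zig-zig
    obtain ⟨f₄, sz₄, seq₄, r₄, hE₄, M₄, R₄, hb₄, hx₄, hk₄, hpot₄⟩ :=
      M.inv.exec_rotate hr M.sroot hgb₃ hd₂ hrevp hrevg
    have hcx : (f₄ p).child d₂ = some x := by rw [R₄.child_x', ← hd, hd₁]
    obtain ⟨f₅, sz₅, seq₅, r₅, hE₅, M₅, R₅, hb₅, hx₅, hk₅, hpot₅⟩ :=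
      M₄.inv.exec_rotate M₄.mem M₄.sroot hb₄ hcx (by rw [R₄.reversed, hrevx])
        (by rw [R₄.reversed, hrevp])
    refine ⟨f₅, sz₅, seq₅, r₅, hexec ?_, (M.trans M₄).trans M₅, hb₅, ?_⟩
    · rw [if_pos (htest.2 hd)]
      exact Exec.bind_le (d := fun _ => rotate x p) hE₄ hE₅ le_rfl
    · have e1 : sz₄ x = sz x := hk₄ x hxp_ne hxg_ne
      have h1 := M₄.inv.size_add_lt hxK hgK hxg_ne
        (M₄.inv.child_parent p hpK _ _ hcx) (M₄.inv.child_parent p hpK _ _ R₄.child_x)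
      have h2 := logb_add_logb_le (M₄.inv.size_pos hxK) (M₄.inv.size_pos hgK) h1.le
      have h3 : sz₅ p ≤ sz₅ x := (M₅.inv.size_lt hpK R₅.parent_p).le
      have h4 := logb_mono (M₅.inv.size_pos hpK) h3
      rw [hx₅] at h4 ⊢
      rw [e1] at h2 hpot₅
      linarith
  · -- zig-zag
    obtain rfl : d₁ = !d₂ := by cases d₁ <;> cases d₂ <;> simp_all
    obtain ⟨f₄, sz₄, seq₄, r₄, hE₄, M₄, R₄, hb₄, hx₄, hk₄, hpot₄⟩ :=
      M.inv.exec_rotate hr M.sroot (.step ⟨d₂, hd₂⟩ hgb₃) hd₁ hrevx hrevp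
    have hcx : (f₄ g).child d₂ = some x := by
      rw [R₄.child g hgK hxg_ne.symm hpg_ne.symm, if_pos hd₂]
    have hb₄' : Below f₄ g n r₄ := by
      cases hb₄ with
      | step hc hb =>
        have := (M₄.inv.isChild_parent (M₄.inv.below_mem M₄.mem hb) hc).symm.trans
          (M₄.inv.child_parent g hgK _ _ hcx)
        cases this
        exact hb
    obtain ⟨f₅, sz₅, seq₅, r₅, hE₅, M₅, R₅, hb₅, hx₅, hk₅, hpot₅⟩ :=
      M₄.inv.exec_rotate M₄.mem M₄.sroot hb₄' hcx (by rw [R₄.reversed, hrevx])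
        (by rw [R₄.reversed, hrevg])
    refine ⟨f₅, sz₅, seq₅, r₅, hexec ?_, (M.trans M₄).trans M₅, hb₅, ?_⟩
    · rw [if_neg fun e => hd (htest.1 e)]
      exact Exec.bind_le (d := fun _ => rotate x g) hE₄ hE₅ le_rfl
    · have e1 : sz₅ p = sz₄ p := hk₅ p hxp_ne.symm hpg_ne
      have e2 : (f₅ x).child d₂ = some p := by
        rw [R₅.child_x', ← Bool.not_not d₂, R₄.child_x]
      have h1 := M₅.inv.size_add_lt hpK hgK hpg_ne
        (M₅.inv.child_parent x hxK _ _ e2) (M₅.inv.child_parent x hxK _ _ R₅.child_x)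
      have h2 := logb_add_logb_le (M₅.inv.size_pos hpK) (M₅.inv.size_pos hgK) h1.le
      have h3 := M₅.inv.size_lt hpK (M₅.inv.child_parent x hxK _ _ e2)
      have h4 : sz p ≤ sz₅ x := by
        rw [hx₅, hk₄ g hxg_ne.symm hpg_ne.symm]; exact hlt₂.le
      have h5 := logb_mono (h.size_pos hpK) h4
      rw [hx₄] at hpot₅
      rw [e1] at h2
      linarith

/-- The access lemma: splaying `x` from depth `n` takes `O(n)` time, and all but `O(1)` of it is paid
for by the potential, up to three times the gain in rank. -/
theorem exec_splay (n : ℕ) : ∀ {sz : Key V → ℕ} {seq : Key V → List (Key V)}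
    {f : Key V → Record V} {r : Key V}, Inv K par deg sz seq f → r ∈ K → SRoot f r →
    Below f x n r → ∃ f' sz' seq', Exec (splay x) K f () K f' (60 * (n / 2 + 2)) ∧
      Restructured K par deg sz seq f r sz' seq' f' x ∧ (f' x).reversed = false ∧
      potential K sz' + 2 * (n / 2 : ℕ) ≤
        potential K sz + 3 * (Real.logb 2 (sz r) - Real.logb 2 (sz x)) := by
  simp only [splay_eq]
  induction n using Nat.strong_induction_on with
  | _ n ih =>
    intro sz seq f r h hr hs hb
    rcases hb with _ | @⟨_, p, _, n, hxp, hpb⟩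
    · obtain ⟨f', seq', hE, hrev, hM⟩ := h.exec_splayBody_root hr hs
      exact ⟨f', sz, seq', (Exec.loop_done hE).mono (by omega), hM, hrev, by simp⟩
    · rcases hpb with _ | @⟨_, g, _, n, hpg, hgb⟩
      · obtain ⟨f₁, sz₁, seq₁, hE₁, M₁, hpot₁⟩ := h.exec_splayBody_zig hr hs hxp
        obtain ⟨f₂, seq₂, hE₂, hrev, M₂⟩ := M₁.inv.exec_splayBody_root M₁.mem M₁.sroot
        refine ⟨f₂, sz₁, seq₂, (Exec.loop_step hE₁ (Exec.loop_done hE₂)).mono (by omega),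
          M₁.trans M₂, hrev, ?_⟩
        rw [← M₁.size_eq]
        simpa using hpot₁
      · obtain ⟨f₁, sz₁, seq₁, r₁, hE₁, M₁, hb₁, hpot₁⟩ :=
          h.exec_splayBody_double hr hs hxp hpg hgb
        obtain ⟨f₂, sz₂, seq₂, hE₂, M₂, hrev, hpot₂⟩ := ih n (by omega) M₁.inv M₁.mem M₁.sroot hb₁
        refine ⟨f₂, sz₂, seq₂, (Exec.loop_step hE₁ hE₂).mono (by omega), M₁.trans M₂, hrev, ?_⟩
        rw [M₁.size_eq] at hpot₂
        rw [show (n + 1 + 1) / 2 = n / 2 + 1 by omega]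
        push_cast at hpot₂ ⊢
        linarith

end Inv

/-! ### Access -/

namespace Restructured

variable {K : Finset (Key V)} {par : Key V → Option (Key V)} {deg sz sz' : Key V → ℕ}
  {seq seq' : Key V → List (Key V)} {f f' : Key V → Record V} {r r' k : Key V}

/-- The roots of the other splay trees remain. -/
theorem sroot_of_notMem (M : Restructured K par deg sz seq f r sz' seq' f' r') (hk : k ∈ K)
    (hs : SRoot f k) (hkr : k ∉ seq r) : SRoot f' k := by
  intro p hp hc
  have hpK := M.inv.parent_mem k hk p hp
  by_cases hpr : p ∈ seq r
  · rw [← M.seq_eq] at hpr hkr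
    exact hkr (M.inv.child_mem_seq M.mem hpr hc)
  · rw [(M.frame k hk hkr).1] at hp
    refine hs p hp ?_
    obtain ⟨d, hd⟩ := hc
    exact ⟨d, by rw [← (M.frame p hpK hpr).1, hd]⟩

end Restructured

namespace Inv

variable {K : Finset (Key V)} {par : Key V → Option (Key V)} {deg sz : Key V → ℕ}
  {seq : Key V → List (Key V)} {f f' : Key V → Record V} {v w x r : Key V}
  {last : Option (Key V)}

theorem below_frame (h : Inv K par deg sz seq f) {l : Key V} {n : ℕ} (hl : l ∈ K)
    (hb : Below f v n l) (hf : ∀ k ∈ seq l, f' k = f k) : Below f' v n l := by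
  induction hb with
  | refl => exact .refl _
  | step hc hb ih =>
    obtain ⟨d, hd⟩ := hc
    exact .step ⟨d, by rw [hf _ (h.mem_seq_of_below hl hb), hd]⟩ (ih hl hf)

/-- Exchanging the continuation of the path below `w` for the path `last`. -/
theorem setRight (h : Inv K par deg sz seq f) (hw : w ∈ K) (hs : SRoot f w)
    (hrev : (f w).reversed = false)
    (hlast : ∀ l, last = some l → l ∈ K ∧ SRoot f l ∧ (f l).parent = some w)
    (hf : ∀ k ≠ w, f' k = f k)
    (hfw : f' w = { f w with
      right := last
      oldest := older w.ownEdge (older (oldestOf f (f w).left) (oldestOf f last)) }) :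
    Inv K par deg sz
      (Function.update seq w (seqOf seq ((f w).child false) ++ w :: seqOf seq last)) f' ∧
    SRoot f' w ∧ ∀ b, (f w).child true = some b → SRoot f' b := by
  have hpar : ∀ k, (f' k).parent = (f k).parent := by
    intro k
    by_cases hk : k = w
    · subst hk; rw [hfw]
    · rw [hf k hk]
  have hcl : (f' w).child false = (f w).child false := by rw [hfw]; rfl
  have hcr : (f' w).child true = last := by rw [hfw]; rfl
  have hnw : ∀ k ∈ K, ∀ d, (f k).child d ≠ some w := fun k hk d hc =>
    (h.sroot_iff hw).1 hs k hk ⟨d, hc⟩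
  have hlw : last ≠ some w := fun hl => h.ne_parent hw (hlast w hl).2.2 rfl
  have hsq : ∀ o : Option (Key V), o ≠ some w → ∀ t,
      seqOf (Function.update seq w t) o = seqOf seq o := by
    intro o ho t
    rcases o with _ | c
    · rfl
    · exact Function.update_of_ne (fun e => ho (congrArg some e)) _ _
  -- the children after the change
  have hch : ∀ k ∈ K, ∀ d c, (f' k).child d = some c →
      (f k).child d = some c ∨ k = w ∧ last = some c := by
    intro k hk d c hc
    by_cases hkw : k = w
    · subst hkw
      cases d
      · rw [hcl] at hc; exact Or.inl hc
      · rw [hcr] at hc; exact Or.inr ⟨rfl, hc⟩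
    · rw [hf k hkw] at hc; exact Or.inl hc
  have hsw : SRoot f' w := by
    intro p hp hc
    rw [hpar] at hp
    obtain ⟨d, hd⟩ := hc
    have hpK := h.parent_mem w hw p hp
    rcases hch p hpK d w hd with hd | ⟨rfl, hl⟩
    · exact hs p hp ⟨d, hd⟩
    · exact hlw hl
  have hsb : ∀ b, (f w).child true = some b → SRoot f' b := by
    intro b hb p hp hc
    have hbp := h.child_parent w hw _ b hb
    rw [hpar, hbp] at hp
    cases hp
    obtain ⟨d, hd⟩ := hc
    cases d
    · rw [hcl] at hd
      exact h.child_ne w hw _ b hd hb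
    · rw [hcr] at hd
      exact (hlast b hd).2.1 w hbp ⟨true, hb⟩
  refine ⟨⟨?_, ?_, ?_, ?_, ?_, ?_, ?_, ?_, ?_⟩, hsw, hsb⟩
  · intro k hk d c hc
    rcases hch k hk d c hc with hc | ⟨-, hc⟩
    · exact h.child_mem k hk d c hc
    · exact (hlast c hc).1
  · intro k hk d c hc
    rw [hpar]
    rcases hch k hk d c hc with hc | ⟨rfl, hc⟩
    · exact h.child_parent k hk d c hc
    · exact (hlast c hc).2.2
  · intro k hk d c hc hc'
    by_cases hkw : k = w
    · subst hkw
      have key : ∀ c, (f' k).child false = some c → (f' k).child true ≠ some c := by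
        intro c hc hc'
        rw [hcl] at hc
        rw [hcr] at hc'
        exact (hlast c hc').2.1 k (hlast c hc').2.2 ⟨false, hc⟩
      cases d
      · exact key c hc hc'
      · exact key c hc' hc
    · rw [hf k hkw] at hc hc'
      exact h.child_ne k hk d c hc hc'
  · intro k hk p hp
    rw [hpar] at hp
    exact h.parent_mem k hk p hp
  · intro k hk
    simp only [hpar]
    exact h.size k hk
  · intro k hk
    by_cases hkw : k = w
    · subst hkw
      rw [hcl, hcr, hsq _ (hnw k hk _), hsq _ hlw, Function.update_self, hfw]
      simp [orient, hrev]
    · rw [hf k hkw, hsq _ (hnw k hk _), hsq _ (hnw k hk _), Function.update_of_ne hkw]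
      exact h.seq_eq k hk
  · intro k hk
    by_cases hkw : k = w
    · subst hkw
      rw [Function.update_self, hfw]
      refine isOldest_pull (h.isOldest_child hk false) ?_
      rcases last with _ | l
      · exact isOldest_none
      · exact h.agg l (hlast l rfl).1
    · rw [hf k hkw, Function.update_of_ne hkw]
      exact h.agg k hk
  · intro k hk hsk
    have hpw := h.path w hw hs
    have hsw' := h.seq_eq w hw
    rw [hrev] at hsw'
    simp only [orient, Bool.false_eq_true, if_false] at hsw'
    rw [hsw', PathFrom.append] at hpw
    rw [hpar]
    by_cases hkw : k = w
    · subst hkw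
      rw [Function.update_self, PathFrom.append]
      refine ⟨hpw.1, ?_⟩
      rcases last with _ | l
      · trivial
      · have := h.path l (hlast l rfl).1 (hlast l rfl).2.1
        rwa [(hlast l rfl).2.2] at this
    · rw [Function.update_of_ne hkw]
      by_cases hb : (f w).child true = some k
      · rw [hb] at hpw
        rw [h.child_parent w hw _ k hb]
        exact hpw.2
      · refine h.path k hk fun p hp hc => ?_
        have hpK := h.parent_mem k hk p hp
        refine hsk p (by rw [hpar, hp]) ?_
        obtain ⟨d, hd⟩ := hc
        by_cases hpw : p = w
        · subst hpw
          cases d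
          · exact ⟨false, by rw [hcl, hd]⟩
          · exact absurd hd hb
        · exact ⟨d, by rw [hf p hpw, hd]⟩
  · intro k hk
    rw [← h.degree k hk]
    by_cases hkw : k = w
    · subst hkw; rw [hfw]
    · rw [hf k hkw]

/-- The part of a round of `climb` that changes the memory. -/
noncomputable def splice (w : Key V) (last : Option (Key V)) : Prog V Unit := do
  splay w
  modifyAt w fun r => { r with right := last }
  pull w

theorem exec_splice (h : Inv K par deg sz seq f) {n : ℕ} (hr : r ∈ K) (hs : SRoot f r)
    (hb : Below f w n r)
    (hlast : ∀ l, last = some l → l ∈ K ∧ SRoot f l ∧ (f l).parent = some w) :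
    ∃ f' sz' seq' A B, Exec (splice w last) K f () K f' (60 * (n / 2) + 126) ∧
      Inv K par deg sz' seq' f' ∧ seq r = A ++ w :: B ∧ seq' w = A ++ w :: seqOf seq last ∧
      SRoot f' w ∧ (f' w).parent = (f r).parent ∧ (f' w).child true = last ∧ sz' w = sz r ∧
      (∀ k ∈ K, k ∉ seq r → f' k = f k ∧ sz' k = sz k ∧ seq' k = seq k) ∧
      (B ≠ [] → ∃ b ∈ K, SRoot f' b ∧ seq' b = B ∧ (f' b).parent = some w) ∧
      potential K sz' + 2 * (n / 2 : ℕ) ≤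
        potential K sz + 3 * (Real.logb 2 (sz r) - Real.logb 2 (sz w)) := by
  have hw : w ∈ K := h.below_mem hr hb
  have hws : w ∈ seq r := h.mem_seq_of_below hr hb
  obtain ⟨f₁, sz₁, seq₁, hE₁, M, hrev, hpot⟩ := h.exec_splay n hr hs hb
  have hlr : ∀ l, last = some l → l ∉ seq r := by
    intro l hl hlr
    obtain ⟨hlK, hls, hlp⟩ := hlast l hl
    have e := h.root_unique hlK hr hls hs (h.self_mem_seq hlK) hlr
    subst e
    have := h.size_lt hlK hlp
    have := h.below_size_le hr hb
    omega
  have hlast₁ : ∀ l, last = some l → l ∈ K ∧ SRoot f₁ l ∧ (f₁ l).parent = some w := by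
    intro l hl
    obtain ⟨hlK, hls, hlp⟩ := hlast l hl
    refine ⟨hlK, M.sroot_of_notMem hlK hls (hlr l hl), ?_⟩
    rw [(M.frame l hlK (hlr l hl)).1, hlp]
  have hsl : seqOf seq₁ last = seqOf seq last := by
    rcases last with _ | l
    · rfl
    · exact (M.frame l (hlast l rfl).1 (hlr l rfl)).2.2
  have hseq := M.inv.seq_eq w hw
  rw [hrev, M.seq_eq] at hseq
  simp only [orient, Bool.false_eq_true, if_false] at hseq
  have hlne : last ≠ some w := fun hl => h.ne_parent hw (hlast w hl).2.2 rfl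
  have hcne : ∀ d, (f₁ w).child d ≠ some w := fun d hd =>
    M.inv.ne_parent hw (M.inv.child_parent w hw d w hd) rfl
  set g := Function.update f₁ w { f₁ w with right := last } with hg
  have hgw : g w = { f₁ w with right := last } := by simp [hg]
  have hpull : pulled g w = { f₁ w with
      right := last
      oldest := older w.ownEdge (older (oldestOf f₁ (f₁ w).left) (oldestOf f₁ last)) } := by
    unfold pulled
    rw [hgw]
    simp only
    rw [hg, oldestOf_update_pulled (k := (f₁ w).left) _ _ (hcne false),
      oldestOf_update_pulled _ _ hlne]
  obtain ⟨h', hsw, hsb⟩ := M.inv.setRight (f' := Function.update g w (pulled g w)) hw M.sroot hrev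
    hlast₁ (fun k hk => by rw [Function.update_of_ne hk, hg, Function.update_of_ne hk])
    (by rw [Function.update_self, hpull])
  have hfw : Function.update g w (pulled g w) w = { f₁ w with
      right := last
      oldest := older w.ownEdge (older (oldestOf f₁ (f₁ w).left) (oldestOf f₁ last)) } := by
    rw [Function.update_self, hpull]
  refine ⟨_, sz₁, _, _, _, ?_, h', hseq, by rw [Function.update_self, hsl], hsw, ?_, ?_,
    M.size_eq, ?_, ?_, hpot⟩
  · unfold splice
    refine Exec.bind_le hE₁ (M := 6) ?_ (by omega)
    refine Exec.bind_le (exec_modifyAt hw _) (M := 4) ?_ le_rfl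
    refine exec_pull hw ?_ ?_
    · intro y
      rw [← hg, hgw]
      exact M.inv.child_mem w hw false y
    · intro y
      rw [← hg, hgw]
      exact fun hy => (hlast y hy).1
  · rw [hfw]
    exact M.parent_eq
  · rw [hfw]
    rfl
  · intro k hk hkr
    have hkw : k ≠ w := fun e => hkr (e ▸ hws)
    obtain ⟨h1, h2, h3⟩ := M.frame k hk hkr
    refine ⟨?_, h2, ?_⟩
    · rw [Function.update_of_ne hkw, hg, Function.update_of_ne hkw, h1]
    · rw [Function.update_of_ne hkw, h3]
  · intro hB
    rcases hb : (f₁ w).child true with _ | b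
    · rw [hb] at hB
      exact absurd rfl hB
    · have hbw : b ≠ w := fun e => hcne true (e ▸ hb)
      refine ⟨b, M.inv.child_mem w hw _ b hb, hsb b hb, ?_, ?_⟩
      · rw [Function.update_of_ne hbw]; rfl
      · rw [Function.update_of_ne hbw, hg, Function.update_of_ne hbw]
        exact M.inv.child_parent w hw _ b hb

/-- The round of the loop of `climb`. -/
noncomputable def climbBody : Key V × Option (Key V) →
    Prog V ((Key V × Option (Key V)) ⊕ Key V) := fun s => do
  let w := s.1
  let last := s.2
  splay w
  modifyAt w fun r => { r with right := last }
  pull w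
  match (← readAt w).parent with
  | none => return .inr w
  | some w' => return .inl (w', some w)

theorem climb_eq (v : Key V) : climb v = loop climbBody (v, none) := rfl

theorem exec_climbBody {N : ℕ} (hw : w ∈ K) (hE : Exec (splice w last) K f () K f' N) :
    Exec (climbBody (w, last)) K f
      (match (f' w).parent with | none => .inr w | some w' => .inl (w', some w)) K f' (N + 1) := by
  have hE' : Exec (do
      splice w last
      match (← readAt w).parent with
      | none => return .inr w
      | some w' => return .inl (w', some w)) K f
      (match (f' w).parent with
        | none => .inr w
        | some w' => .inl (w', some w) : (Key V × Option (Key V)) ⊕ Key V) K f' (N + 1) := by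
    refine Exec.bind_le hE (M := 1) ?_ le_rfl
    refine Exec.bind_le (exec_readAt hw) (M := 0) ?_ le_rfl
    rcases (f' w).parent with _ | w' <;> exact Exec.pure _
  unfold climbBody
  simpa only [splice, bind_assoc] using hE'

/-- Climbing from `w` with the path `last` below it. The number `j + 1` of rounds shows in the depth
at which `v` ends up; `c` counts the double rotations, which the potential pays for. -/
theorem exec_climb (v : Key V) (m : ℕ) : ∀ {sz : Key V → ℕ} {seq : Key V → List (Key V)}
    {f : Key V → Record V} {w : Key V} {last : Option (Key V)} {D : ℕ},
    K.card - sz w = m → Inv K par deg sz seq f → w ∈ K →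
    (∀ l, last = some l → l ∈ K ∧ SRoot f l ∧ (f l).parent = some w) →
    (last = none ∧ w = v ∧ D = 0 ∨
      ∃ l D' T, last = some l ∧ Below f v D' l ∧ D = D' + 1 ∧ seq l = T ++ [v]) →
    ∃ w' f' sz' seq' j c r A B E,
      Exec (loop climbBody (w, last)) K f w' K f' (60 * c + 127 * (j + 1)) ∧
      Inv K par deg sz' seq' f' ∧ w' ∈ K ∧ (f' w').parent = none ∧ Below f' v (D + j) w' ∧
      potential K sz' + 2 * c ≤
        potential K sz + 3 * (Real.logb 2 (sz' w') - Real.logb 2 (sz w)) ∧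
      r ∈ K ∧ (f r).parent = none ∧ seq r = A ++ w' :: B ∧ seq' w' = A ++ w' :: E ∧
      (∀ k ∈ E, k ∉ seq r) ∧ (∃ T, seq' w' = T ++ [v]) ∧
      (∀ k ∈ K, ¬Conn par k w → f' k = f k) ∧
      (w ∈ seq r → B ≠ [] → ∃ b ∈ K, b ≠ w' ∧ SRoot f' b ∧ seq' b = B) := by
  induction m using Nat.strong_induction_on with
  | _ m ih =>
    intro sz seq f w last D hm h hw hlast hv
    obtain ⟨r, hr, hs, n, hb⟩ := h.exists_root hw
    have hws := h.mem_seq_of_below hr hb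
    obtain ⟨f₁, sz₁, seq₁, A, B, hE, h₁, hsr, hsw, hsw', hpw, hcw, hszw, hfr, hB, hpot⟩ :=
      h.exec_splice hr hs hb hlast
    have hbody := exec_climbBody hw hE
    have hlr : ∀ l, last = some l → ∀ k ∈ seq l, k ∉ seq r := by
      intro l hl k hkl hkr
      obtain ⟨hlK, hls, hlp⟩ := hlast l hl
      have e := h.root_unique hlK hr hls hs hkl hkr
      subst e
      have := h.size_lt hlK hlp
      have := h.below_size_le hr hb
      omega
    have hbv : Below f₁ v D w := by
      rcases hv with ⟨-, rfl, rfl⟩ | ⟨l, D', T, hl, hbl, rfl, -⟩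
      · exact .refl _
      · have hlK := (hlast l hl).1
        refine Below.trans_child (b := l) ?_ ⟨true, by rw [hcw, hl]⟩
        exact h.below_frame hlK hbl fun k hk =>
          (hfr k (h.mem_of_mem_seq hlK hk) (hlr l hl k hk)).1
    have hT : ∃ T, seq₁ w = T ++ [v] := by
      rcases hv with ⟨rfl, rfl, -⟩ | ⟨l, D', T, rfl, -, -, hT⟩
      · exact ⟨A, hsw⟩
      · exact ⟨A ++ w :: T, by rw [hsw]; simp [seqOf, hT]⟩
    rcases hp : (f r).parent with _ | w'
    · rw [hpw, hp] at hbody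
      refine ⟨w, f₁, sz₁, seq₁, 0, n / 2, r, A, B, seqOf seq last,
        (Exec.loop_done hbody).mono (by omega), h₁, hw, hpw.trans hp, hbv, ?_, hr, hp, hsr, hsw,
        ?_, hT, ?_, ?_⟩
      · rw [hszw]; exact hpot
      · intro k hk
        rcases hl : last with _ | l
        · rw [hl] at hk; simp [seqOf] at hk
        · rw [hl] at hk; exact hlr l hl k hk
      · intro k hk hkw
        exact (hfr k hk fun hkr => hkw (h.conn_root hr hs hkr hws)).1
      · intro _ hB0
        obtain ⟨b, hbK, hbs, hbq, hbp⟩ := hB hB0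
        refine ⟨b, hbK, ?_, hbs, hbq⟩
        rintro rfl
        rw [hpw, hp] at hbp
        cases hbp
    · rw [hpw, hp] at hbody
      have hw' := h.parent_mem r hr w' hp
      have hpw₁ : (f₁ w).parent = some w' := hpw.trans hp
      have hlt := h₁.size_lt hw hpw₁
      have hle := h₁.size_le_card hw'
      have hwr := h.below_size_le hr hb
      obtain ⟨T, hT⟩ := hT
      obtain ⟨w₂, f₂, sz₂, seq₂, j, c, r₂, A₂, B₂, E₂, hE₂, h₂, hw₂, hp₂, hb₂, hpot₂, hr₂, hpr₂,
          hsr₂, hsw₂, hE₂', hT₂, hfr₂, -⟩ := ih (K.card - sz₁ w') (by omega) rfl h₁ hw'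
        (last := some w) (D := D + 1)
        (fun l hl => by cases hl; exact ⟨hw, hsw', hpw₁⟩)
        (Or.inr ⟨w, D, T, rfl, hbv, rfl, hT⟩)
      have hroot₂ : SRoot f₁ r₂ := sroot_of_parent_none hpr₂
      have hr₂r : r₂ ∉ seq r := by
        intro hmem
        rw [hsr, List.mem_append, List.mem_cons] at hmem
        have hcase : r₂ ∈ seq₁ w ∨ r₂ ∈ B := by
          rw [hsw, List.mem_append, List.mem_cons]
          tauto
        rcases hcase with hmem | hmem
        · have e := h₁.root_unique hr₂ hw hroot₂ hsw' (h₁.self_mem_seq hr₂) hmem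
          subst e
          rw [hpr₂] at hpw₁
          cases hpw₁
        · obtain ⟨b, hbK, hbs, hbq, hbp⟩ := hB (List.ne_nil_of_mem hmem)
          have e := h₁.root_unique hr₂ hbK hroot₂ hbs (h₁.self_mem_seq hr₂) (hbq ▸ hmem)
          subst e
          rw [hpr₂] at hbp
          cases hbp
      obtain ⟨h4, -, h6⟩ := hfr r₂ hr₂ hr₂r
      rw [h4] at hpr₂
      rw [h6] at hsr₂ hE₂'
      refine ⟨w₂, f₂, sz₂, seq₂, j + 1, n / 2 + c, r₂, A₂, B₂, E₂,
        (Exec.loop_step hbody hE₂).mono (by omega), h₂, hw₂, hp₂, ?_, ?_, hr₂, hpr₂, hsr₂, hsw₂,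
        hE₂', hT₂, ?_, ?_⟩
      · rw [show D + (j + 1) = D + 1 + j by omega]; exact hb₂
      · have := logb_mono (h₁.size_pos hw) hlt.le
        rw [hszw] at this
        push_cast at hpot ⊢
        linarith
      · intro k hk hkw
        have hwc : Conn par w w' := h.conn_parent hr hs hws hp
        rw [hfr₂ k hk fun hc => hkw (hc.trans hwc.symm)]
        exact (hfr k hk fun hkr => hkw (h.conn_root hr hs hkr hws)).1
      · intro hwr₂
        have e := h.root_unique hr₂ hr (sroot_of_parent_none hpr₂) hs hwr₂ hws
        subst e
        rw [hp] at hpr₂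
        cases hpr₂

/-- The amortized cost of `access` is logarithmic, `157` units of time being paid for by a unit of
potential. The rounds of `climb` are paid for by the last splaying, since `v` is by then as deep as
there were rounds. The result `w` is the last common member of the path to `v` and the path that was
held by the root of the virtual tree before; if `v` was itself on that path, the part of the path
below `v` is split off as a splay tree of its own. -/
theorem exec_access (h : Inv K par deg sz seq f) (hv : v ∈ K) :
    ∃ w f' sz' seq' N r A B E T, Exec (access v) K f w K f' N ∧ Inv K par deg sz' seq' f' ∧
      N + 157 * potential K sz' ≤ 157 * potential K sz + 1000 * (Real.logb 2 K.card + 1) ∧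
      (f' v).parent = none ∧ (f' v).reversed = false ∧ (f' v).child true = none ∧
      seq' v = T ++ [v] ∧
      r ∈ K ∧ (f r).parent = none ∧ seq r = A ++ w :: B ∧ seq' v = A ++ w :: E ∧
      (∀ k ∈ E, k ∉ seq r) ∧ (∀ k ∈ K, ¬Conn par k v → f' k = f k) ∧
      (v ∈ seq r → B ≠ [] → ∃ b ∈ K, SRoot f' b ∧ seq' b = B) := by
  obtain ⟨w, f₁, sz₁, seq₁, j, c, r, A, B, E, hE₁, h₁, hw, hpw, hb, hpot₁, hr, hpr, hsr, hsw, hdis,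
    ⟨T, hT⟩, hfr, hB⟩ := h.exec_climb v _ (last := none) (D := 0) rfl hv (by simp)
      (Or.inl ⟨rfl, rfl, rfl⟩)
  rw [Nat.zero_add] at hb
  have hroot := sroot_of_parent_none hpw
  obtain ⟨f₂, sz₂, seq₂, hE₂, M, hrev, hpot₂⟩ := h₁.exec_splay j hw hroot hb
  have hvw := h₁.mem_seq_of_below hw hb
  refine ⟨w, f₂, sz₂, seq₂, 60 * c + 127 * (j + 1) + 60 * (j / 2 + 2), r, A, B, E, T, ?_, M.inv, ?_,
    M.parent_eq.trans hpw, hrev, ?_, M.seq_eq.trans hT, hr, hpr, hsr, M.seq_eq.trans hsw, hdis, ?_,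
    ?_⟩
  · unfold access
    rw [climb_eq]
    refine Exec.bind_le hE₁ (M := 60 * (j / 2 + 2)) ?_ le_rfl
    exact Exec.bind_le hE₂ (Exec.pure _) le_rfl
  -- the final splaying releases `2 * (j / 2)`, which has to pay for `127 * j + 60 * (j / 2)`
  · have hlog : ∀ {n : ℕ}, 0 < n → n ≤ K.card → Real.logb 2 n ≤ Real.logb 2 K.card :=
      fun hn hle => logb_mono hn hle
    have h1 := hlog (h₁.size_pos hw) (h₁.size_le_card hw)
    have h2 := logb_nonneg (sz v)
    have h3 := logb_nonneg (sz₁ v)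
    have h4 := logb_nonneg K.card
    have h5 : (j : ℝ) ≤ 2 * (j / 2 : ℕ) + 1 := by
      have : j ≤ 2 * (j / 2) + 1 := by omega
      exact_mod_cast this
    have h6 : (0 : ℝ) ≤ (c : ℝ) := Nat.cast_nonneg c
    have h7 : (0 : ℝ) ≤ ((j / 2 : ℕ) : ℝ) := Nat.cast_nonneg _
    push_cast
    generalize ((j / 2 : ℕ) : ℝ) = jj at *
    linarith
  · have hseq := M.inv.seq_eq v (M.inv.mem_of_mem_seq M.mem (by rw [M.seq_eq]; exact hvw))
    rw [hrev, M.seq_eq, hT] at hseq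
    simp only [orient, Bool.false_eq_true, if_false] at hseq
    rcases hc : (f₂ v).child true with _ | b
    · rfl
    · exfalso
      rw [hc] at hseq
      have hbK := M.inv.child_mem v M.mem _ b hc
      have hnd := (h₁.path w hw hroot)
      rw [hpw, hT, hseq] at hnd
      have hne : seq₂ b ≠ [] := List.ne_nil_of_mem (M.inv.self_mem_seq hbK)
      obtain ⟨S, z, hz⟩ := (List.eq_nil_or_concat (seq₂ b)).resolve_left hne
      have hsb : seqOf seq₂ (some b) = S ++ [z] := by rw [← List.concat_eq_append, ← hz]; rfl
      rw [hsb] at hseq hnd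
      rw [← List.cons_append, ← List.append_assoc] at hseq
      obtain ⟨-, hvz⟩ := List.append_inj' hseq rfl
      cases hvz
      exact (List.nodup_cons.1 (List.Nodup.of_append_right hnd.nodup)).1 (by simp)
  · intro k hk hkv
    have hwc : Conn par v w := h₁.conn_root hw hroot hvw (h₁.self_mem_seq hw)
    rw [(M.frame k hk fun hkw => hkv (h₁.conn_root hw hroot hkw hvw)).1]
    exact hfr k hk hkv
  · intro hvr hB0
    obtain ⟨b, hbK, hbw, hbs, hbq⟩ := hB hvr hB0
    have hbn : b ∉ seq₁ w := fun hm =>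
      hbw (h₁.root_unique hbK hw hbs hroot (h₁.self_mem_seq hbK) hm)
    exact ⟨b, hbK, M.sroot_of_notMem hbK hbs hbn, (M.frame b hbK hbn).2.2.trans hbq⟩

end Inv

/-! ### Changing the represented forest -/

/-- The parent function that makes `l` a descending path below `q`, and agrees with `par` elsewhere. -/
def setPath (par : Key V → Option (Key V)) : Option (Key V) → List (Key V) → Key V → Option (Key V)
  | _, [] => par
  | q, a :: l => Function.update (setPath par (some a) l) a q

theorem setPath_of_notMem {par : Key V → Option (Key V)} {q : Option (Key V)} {l : List (Key V)}
    {k : Key V} (hk : k ∉ l) : setPath par q l k = par k := by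
  induction l generalizing q with
  | nil => rfl
  | cons a l ih =>
    rw [List.mem_cons, not_or] at hk
    rw [setPath, Function.update_of_ne hk.1, ih hk.2]

theorem PathFrom.congr {par par' : Key V → Option (Key V)} {q : Option (Key V)}
    {l : List (Key V)} (h : PathFrom par q l) (he : ∀ k ∈ l, par' k = par k) :
    PathFrom par' q l := by
  induction l generalizing q with
  | nil => trivial
  | cons a l ih =>
    exact ⟨(he a (by simp)).trans h.1, ih h.2 fun k hk => he k (by simp [hk])⟩

theorem pathFrom_setPath (par : Key V → Option (Key V)) {q : Option (Key V)} {l : List (Key V)}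
    (hl : l.Nodup) : PathFrom (setPath par q l) q l := by
  induction l generalizing q with
  | nil => trivial
  | cons a l ih =>
    rw [List.nodup_cons] at hl
    refine ⟨by simp [setPath], (ih hl.2).congr fun k hk => ?_⟩
    rw [setPath, Function.update_of_ne]
    rintro rfl
    exact hl.1 hk

theorem PathFrom.eq_some_iff {par : Key V → Option (Key V)} {l : List (Key V)} {x y : Key V}
    (h : PathFrom par none l) (hx : x ∈ l) : par x = some y ↔ [y, x] <:+: l := by
  constructor
  · intro hp
    obtain ⟨s, t, rfl⟩ := List.append_of_mem hx
    rw [PathFrom.append] at h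
    rcases List.eq_nil_or_concat s with rfl | ⟨s, b, rfl⟩
    · rw [h.1.1] at hp; cases hp
    · have h1 := h.1
      rw [List.concat_eq_append, List.append_assoc, List.singleton_append, PathFrom.append] at h1
      rw [h1.2.1] at hp
      cases hp
      exact ⟨s, t, by simp⟩
  · rintro ⟨s, t, rfl⟩
    rw [List.append_assoc, List.cons_append, PathFrom.append] at h
    exact h.2.1

theorem parAdj_setPath_reverse {par : Key V → Option (Key V)} {l : List (Key V)}
    (h : PathFrom par none l) (a b : Key V) :
    ParAdj (setPath par none l.reverse) a b ↔ ParAdj par a b := by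
  have h' : PathFrom (setPath par none l.reverse) none l.reverse :=
    pathFrom_setPath par (List.nodup_reverse.2 h.nodup)
  have hin : ∀ {x y}, x ∈ l → (setPath par none l.reverse x = some y ↔ [x, y] <:+: l) := by
    intro x y hx
    rw [h'.eq_some_iff (List.mem_reverse.2 hx), ← List.reverse_infix, List.reverse_reverse]
    rfl
  have hout : ∀ {x}, x ∉ l → setPath par none l.reverse x = par x := fun hx =>
    setPath_of_notMem fun hm => hx (List.mem_reverse.1 hm)
  have hsub : ∀ {x y : Key V}, [x, y] <:+: l → x ∈ l ∧ y ∈ l := fun hi =>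
    ⟨hi.subset (by simp), hi.subset (by simp)⟩
  unfold ParAdj
  by_cases ha : a ∈ l <;> by_cases hb : b ∈ l
  · rw [hin ha, hin hb, h.eq_some_iff ha, h.eq_some_iff hb, or_comm]
  · rw [hin ha, hout hb, h.eq_some_iff ha]
    have h1 : ¬[a, b] <:+: l := fun hi => hb (hsub hi).2
    have h2 : ¬[b, a] <:+: l := fun hi => hb (hsub hi).1
    tauto
  · rw [hin hb, hout ha, h.eq_some_iff hb]
    have h1 : ¬[a, b] <:+: l := fun hi => ha (hsub hi).1
    have h2 : ¬[b, a] <:+: l := fun hi => ha (hsub hi).2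
    tauto
  · rw [hout ha, hout hb]

theorem PathFrom.ne_none {par : Key V → Option (Key V)} {l : List (Key V)} {p k : Key V}
    (h : PathFrom par (some p) l) (hk : k ∈ l) : par k ≠ none := by
  induction l generalizing p with
  | nil => simp at hk
  | cons a l ih =>
    rcases List.mem_cons.1 hk with rfl | hk
    · rw [h.1]; simp
    · exact ih h.2 hk

/-- `par'` is `par` with the root of the tree of `x` moved to `x`. -/
structure ReRooted (par par' : Key V → Option (Key V)) (x : Key V) : Prop where
  adj : ∀ a b, ParAdj par' a b ↔ ParAdj par a b
  root : par' x = none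
  root_or : ∀ k, par' k = none → k = x ∨ par k = none

theorem conn_congr {par par' : Key V → Option (Key V)}
    (h : ∀ a b, ParAdj par' a b ↔ ParAdj par a b) {x y : Key V} : Conn par' x y ↔ Conn par x y := by
  have : ParAdj par' = ParAdj par := by
    funext a b
    exact propext (h a b)
  rw [Conn, Conn, this]

theorem ReRooted.conn {par par' : Key V → Option (Key V)} {x y z : Key V}
    (h : ReRooted par par' x) : Conn par' y z ↔ Conn par y z := conn_congr h.adj

namespace Inv

variable {K : Finset (Key V)} {par : Key V → Option (Key V)} {deg sz : Key V → ℕ}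
  {seq : Key V → List (Key V)} {f f' : Key V → Record V} {v w x y r : Key V}

theorem notMem_seq_of_root (h : Inv K par deg sz seq f) (hx : x ∈ K) (hs : SRoot f x)
    {k : Key V} (hk : k ∈ K) (hks : SRoot f k) (hkx : k ≠ x) {z : Key V} (hz : z ∈ seq x) :
    z ∉ seq k := fun hz' => hkx (h.root_unique hk hx hks hs hz' hz)

/-- Reversing the path from the root to `x` moves the root of the represented tree to `x`. -/
theorem flipRoot (h : Inv K par deg sz seq f) (hx : x ∈ K) (hp : (f x).parent = none) :
    Inv K (setPath par none (seq x).reverse) deg sz (Function.update seq x (seq x).reverse)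
      (Function.update f x (flip (f x))) := by
  set F := Function.update f x (flip (f x)) with hF
  have hs : SRoot f x := sroot_of_parent_none hp
  have hpath := h.path x hx hs
  rw [hp] at hpath
  have hch : ∀ k d, (F k).child d = (f k).child d := by
    intro k d
    by_cases hk : k = x
    · subst hk; rw [hF, Function.update_self]; cases d <;> rfl
    · rw [hF, Function.update_of_ne hk]
  have hpar : ∀ k, (F k).parent = (f k).parent := by
    intro k
    by_cases hk : k = x
    · subst hk; rw [hF, Function.update_self]; rfl
    · rw [hF, Function.update_of_ne hk]
  have hold : ∀ k, (F k).oldest = (f k).oldest := by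
    intro k
    by_cases hk : k = x
    · subst hk; rw [hF, Function.update_self]; rfl
    · rw [hF, Function.update_of_ne hk]
  have hdeg : ∀ k, (F k).degree = (f k).degree := by
    intro k
    by_cases hk : k = x
    · subst hk; rw [hF, Function.update_self]; rfl
    · rw [hF, Function.update_of_ne hk]
  have hsr : ∀ k, SRoot F k ↔ SRoot f k := by
    intro k
    simp only [SRoot, IsChild, hpar, hch]
  have hsq : ∀ k ∈ K, ∀ d t, seqOf (Function.update seq x t) ((f k).child d) =
      seqOf seq ((f k).child d) := by
    intro k hk d t
    rcases hc : (f k).child d with _ | c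
    · rfl
    · refine Function.update_of_ne ?_ _ _
      rintro rfl
      exact (h.sroot_iff hx).1 hs k hk ⟨d, hc⟩
  refine ⟨?_, ?_, ?_, ?_, ?_, ?_, ?_, ?_, ?_⟩
  · simp only [hch]; exact h.child_mem
  · simp only [hch, hpar]; exact h.child_parent
  · simp only [hch]; exact h.child_ne
  · simp only [hpar]; exact h.parent_mem
  · simp only [hpar]; exact h.size
  · intro k hk
    rw [hch, hch, hsq k hk, hsq k hk]
    by_cases hkx : k = x
    · subst hkx
      rw [Function.update_self, h.seq_eq k hk, hF, Function.update_self]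
      unfold orient flip
      cases (f k).reversed <;> simp
    · rw [Function.update_of_ne hkx, hF, Function.update_of_ne hkx]
      exact h.seq_eq k hk
  · intro k hk
    rw [hold]
    by_cases hkx : k = x
    · subst hkx
      rw [Function.update_self]
      exact (h.agg k hk).of_mem_iff fun _ => List.mem_reverse
    · rw [Function.update_of_ne hkx]
      exact h.agg k hk
  · intro k hk hks
    rw [hsr] at hks
    rw [hpar]
    by_cases hkx : k = x
    · subst hkx
      rw [Function.update_self, hp]
      exact pathFrom_setPath par (List.nodup_reverse.2 hpath.nodup)
    · rw [Function.update_of_ne hkx]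
      refine (h.path k hk hks).congr fun z hz => setPath_of_notMem fun hm => ?_
      exact h.notMem_seq_of_root hx hs hk hks hkx (List.mem_reverse.1 hm) hz
  · simp only [hdeg]; exact h.degree

theorem exec_reRoot (h : Inv K par deg sz seq f) (hx : x ∈ K) :
    ∃ par' f' sz' seq' N, Exec (reRoot x) K f () K f' N ∧ Inv K par' deg sz' seq' f' ∧
      ReRooted par par' x ∧
      N + 157 * potential K sz' ≤ 157 * potential K sz + 1010 * (Real.logb 2 K.card + 1) ∧
      (f' x).parent = none ∧ (f' x).reversed = false ∧ (f' x).child false = none ∧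
      (∀ k ∈ K, ¬Conn par k x → f' k = f k) := by
  obtain ⟨w, f₁, sz₁, seq₁, N, -, -, -, -, T, hE₁, h₁, hN, hp, hrev, hr, hT, -, -, -, -, -, hfr, -⟩ :=
    h.exec_access hx
  have h₂ := h₁.flipRoot hx hp
  set f₂ := Function.update f₁ x (flip (f₁ x)) with hf₂
  have hs₁ : SRoot f₁ x := sroot_of_parent_none hp
  have hpath := h₁.path x hx hs₁
  rw [hp] at hpath
  obtain ⟨f₃, seq₃, hE₃, h₃, P, -⟩ := h₂.exec_push hx
  have hpath' : PathFrom (setPath par none (seq₁ x).reverse) none (seq₁ x).reverse :=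
    pathFrom_setPath par (List.nodup_reverse.2 hpath.nodup)
  have hrv : (seq₁ x).reverse = x :: T.reverse := by rw [hT]; simp
  have hf₂x : f₂ x = flip (f₁ x) := by simp [hf₂]
  refine ⟨_, f₃, sz₁, seq₃, N + 8, ?_, h₃, ⟨parAdj_setPath_reverse hpath, ?_, ?_⟩, ?_, ?_,
    P.reversed_self, ?_, ?_⟩
  · unfold reRoot
    refine Exec.bind_le hE₁ (M := 8) ?_ le_rfl
    exact Exec.bind_le (exec_modifyAt hx _) hE₃ le_rfl
  · rw [hrv] at hpath' ⊢
    exact hpath'.1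
  · intro k hk
    by_cases hks : k ∈ (seq₁ x).reverse
    · rw [hrv] at hpath' hks hk
      rcases List.mem_cons.1 hks with rfl | hks
      · exact Or.inl rfl
      · exact absurd hk (hpath'.2.ne_none hks)
    · rw [setPath_of_notMem hks] at hk
      exact Or.inr hk
  · have := logb_nonneg K.card
    push_cast
    linarith
  · rw [P.parent, hf₂x]
    exact hp
  · rw [P.child_self, hf₂x]
    simpa [flip, hrev, Record.child] using hr
  · intro k hk hkx
    have hkx' : k ≠ x := by rintro rfl; exact hkx .refl
    rw [P.frame k hkx', hf₂, Function.update_of_ne hkx', hfr k hk hkx]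
    intro d hd
    rw [hf₂x] at hd
    have hd' : (f₁ x).child d = some k := by cases d <;> exact hd
    have hkm := h₁.child_mem_seq hx (h₁.self_mem_seq hx) ⟨d, hd'⟩
    exact hkx (h₁.conn_root hx hs₁ hkm (h₁.self_mem_seq hx))

/-- Hanging the tree with root `x` below `y`, where `y` is the root of another virtual tree. -/
theorem setParent (h : Inv K par deg sz seq f) (hx : x ∈ K) (hy : y ∈ K) (hxy : x ≠ y)
    (hpx : (f x).parent = none) (hpy : (f y).parent = none) {l : List (Key V)}
    (hl : seq x = x :: l) :
    Inv K (Function.update par x (some y)) deg (Function.update sz y (sz y + sz x)) seq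
      (Function.update f x { f x with parent := some y }) := by
  set F := Function.update f x { f x with parent := some y } with hF
  have hs : SRoot f x := sroot_of_parent_none hpx
  have hpath := h.path x hx hs
  rw [hpx, hl] at hpath
  have hnd := (List.nodup_cons.1 hpath.nodup).1
  have hch : ∀ k d, (F k).child d = (f k).child d := by
    intro k d
    by_cases hk : k = x
    · subst hk; rw [hF, Function.update_self]; cases d <;> rfl
    · rw [hF, Function.update_of_ne hk]
  have hparx : (F x).parent = some y := by rw [hF, Function.update_self]
  have hpar : ∀ k, k ≠ x → (F k).parent = (f k).parent := by
    intro k hk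
    rw [hF, Function.update_of_ne hk]
  refine ⟨?_, ?_, ?_, ?_, ?_, ?_, ?_, ?_, ?_⟩
  · simp only [hch]; exact h.child_mem
  · intro k hk d c hc
    rw [hch] at hc
    have := h.child_parent k hk d c hc
    rw [hpar c (by rintro rfl; rw [hpx] at this; cases this), this]
  · simp only [hch]; exact h.child_ne
  · intro k hk p hp
    by_cases hkx : k = x
    · subst hkx
      rw [hparx] at hp
      cases hp
      exact hy
    · rw [hpar k hkx] at hp
      exact h.parent_mem k hk p hp
  · intro k hk
    have h0 := h.size k hk
    have hsum := sum_sub_sum_of_eq_off (K := K) (D := {x, y})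
      (F := fun z => if (f z).parent = some k then (sz z : ℤ) else 0)
      (F' := fun z => if (F z).parent = some k then
        ((Function.update sz y (sz y + sz x) z : ℕ) : ℤ) else 0)
      (by intro z; simp only [Finset.mem_insert, Finset.mem_singleton]
          rintro (rfl | rfl) <;> assumption)
      (by intro z _ hz
          simp only [Finset.mem_insert, Finset.mem_singleton, not_or] at hz
          rw [hpar z hz.1, Function.update_of_ne hz.2])
    rw [Finset.sum_pair hxy, hparx, hpar y hxy.symm, hpx, hpy, Function.update_of_ne hxy] at hsum
    zify at h0 ⊢
    by_cases hky : y = k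
    · subst hky
      rw [Function.update_self]
      simp only [if_true, reduceCtorEq, if_false] at hsum
      push_cast
      linarith
    · rw [Function.update_of_ne (Ne.symm hky)]
      simp only [Option.some.injEq, hky, reduceCtorEq, if_false] at hsum
      linarith
  · intro k hk
    rw [hch, hch]
    have : (F k).reversed = (f k).reversed := by
      by_cases hk : k = x
      · subst hk; rw [hF, Function.update_self]
      · rw [hF, Function.update_of_ne hk]
    rw [this]
    exact h.seq_eq k hk
  · intro k hk
    have : (F k).oldest = (f k).oldest := by
      by_cases hk : k = x
      · subst hk; rw [hF, Function.update_self]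
      · rw [hF, Function.update_of_ne hk]
    rw [this]
    exact h.agg k hk
  · intro k hk hks
    by_cases hkx : k = x
    · subst hkx
      rw [hl, hparx]
      refine ⟨Function.update_self _ _ _, hpath.2.congr fun z hz => Function.update_of_ne ?_ _ _⟩
      rintro rfl
      exact hnd hz
    · have hks' : SRoot f k := by
        intro p hp ⟨d, hd⟩
        exact hks p (by rw [hpar k hkx, hp]) ⟨d, by rw [hch, hd]⟩
      rw [hpar k hkx]
      refine (h.path k hk hks').congr fun z hz => Function.update_of_ne ?_ _ _
      rintro rfl
      exact h.notMem_seq_of_root hx hs hk hks' hkx (h.self_mem_seq hx) hz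
  · intro k hk
    rw [← h.degree k hk]
    by_cases hk : k = x
    · subst hk; rw [hF, Function.update_self]
    · rw [hF, Function.update_of_ne hk]

/-- As `x` and `y` are in different trees, `access y` does not touch `x`, and `x` is still the root of
its virtual tree when it is linked to `y`. -/
theorem exec_link (h : Inv K par deg sz seq f) (hx : x ∈ K) (hy : y ∈ K) (hxy : ¬Conn par x y) :
    ∃ par' f' sz' seq' N, Exec (link x y) K f () K f' N ∧ ReRooted par par' x ∧
      Inv K (Function.update par' x (some y)) deg sz' seq' f' ∧
      N + 157 * potential K sz' ≤ 157 * potential K sz + 2200 * (Real.logb 2 K.card + 1) := by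
  obtain ⟨par₁, f₁, sz₁, seq₁, N₁, hE₁, h₁, hR, hN₁, hp₁, hrev₁, hl₁, -⟩ := h.exec_reRoot hx
  have hxy₁ : ¬Conn par₁ x y := fun hc => hxy (hR.conn.1 hc)
  obtain ⟨w, f₂, sz₂, seq₂, N₂, -, -, -, -, T, hE₂, h₂, hN₂, hp₂, -, -, -, -, -, -, -, -, hfr, -⟩ :=
    h₁.exec_access hy
  have hfx := hfr x hx hxy₁
  have hne : x ≠ y := by rintro rfl; exact hxy .refl
  have hseq := h₂.seq_eq x hx
  rw [hfx, hl₁, hrev₁] at hseq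
  have h₃ := h₂.setParent hx hy hne (by rw [hfx, hp₁]) hp₂ hseq
  refine ⟨par₁, _, _, _, N₁ + (N₂ + 2), ?_, hR, h₃, ?_⟩
  · unfold link
    refine Exec.bind_le hE₁ (M := N₂ + 2) ?_ le_rfl
    exact Exec.bind_le hE₂ (exec_modifyAt hx _) le_rfl
  · have hle := h₃.size_le_card hy
    rw [Function.update_self] at hle
    have hpot : potential K (Function.update sz₂ y (sz₂ y + sz₂ x)) ≤
        potential K sz₂ + Real.logb 2 K.card := by
      have hsum := sum_sub_sum_of_eq_off (K := K) (D := {y})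
        (F := fun z => Real.logb 2 (sz₂ z))
        (F' := fun z => Real.logb 2 (Function.update sz₂ y (sz₂ y + sz₂ x) z))
        (by simpa using hy)
        (by intro z _ hz
            rw [Finset.mem_singleton] at hz
            rw [Function.update_of_ne hz])
      rw [Finset.sum_singleton, Function.update_self] at hsum
      have h5 := logb_mono (by have := h₂.size_pos hy; omega) hle
      have h6 := logb_nonneg (sz₂ y)
      unfold potential
      linarith
    have := logb_nonneg K.card
    push_cast
    linarith

/-- Separating `x`, the root of a virtual tree and the last member of its path, from the path above
it. -/
theorem cutLeft (h : Inv K par deg sz seq f) (hx : x ∈ K) (hpx : (f x).parent = none)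
    (hrev : (f x).reversed = false) (hright : (f x).child true = none)
    (hf : ∀ k, k ≠ x → f' k = if (f x).child false = some k then { f k with parent := none } else f k)
    (hfx : f' x = { f x with left := none, oldest := older x.ownEdge (older none none) }) :
    Inv K (Function.update par x none) deg
      (Function.update sz x (sz x - sizeOf? sz ((f x).child false)))
      (Function.update seq x [x]) f' := by
  have hs : SRoot f x := sroot_of_parent_none hpx
  have hseq := h.seq_eq x hx
  rw [hrev, hright] at hseq
  simp only [orient, Bool.false_eq_true, if_false] at hseq
  have hpath := h.path x hx hs
  have hnd : (seq x).Nodup := by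
    rw [hpx] at hpath
    exact hpath.nodup
  rw [hpx, hseq] at hpath
  rw [hseq] at hnd
  have hlx : (f x).child false ≠ some x := fun hc =>
    h.ne_parent hx (h.child_parent x hx _ x hc) rfl
  have hchx : ∀ d, (f' x).child d = none := by
    intro d
    rw [hfx]
    cases d
    · rfl
    · exact hright
  have hch : ∀ k, k ≠ x → ∀ d, (f' k).child d = (f k).child d := by
    intro k hk d
    rw [hf k hk]
    split_ifs <;> cases d <;> rfl
  have hparx : (f' x).parent = none := by rw [hfx, hpx]
  have hparl : ∀ l, (f x).child false = some l → (f' l).parent = none := by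
    intro l hl
    rw [hf l (by rintro rfl; exact hlx hl), if_pos hl]
  have hpar : ∀ k, (f x).child false ≠ some k → (f' k).parent = (f k).parent := by
    intro k hkl
    by_cases hk : k = x
    · subst hk; rw [hparx, hpx]
    · rw [hf k hk, if_neg hkl]
  have hnx : ∀ k ∈ K, ∀ d, (f k).child d ≠ some x := fun k hk d hc =>
    (h.sroot_iff hx).1 hs k hk ⟨d, hc⟩
  refine ⟨?_, ?_, ?_, ?_, ?_, ?_, ?_, ?_, ?_⟩
  · intro k hk d c hc
    by_cases hkx : k = x
    · subst hkx; rw [hchx] at hc; cases hc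
    · rw [hch k hkx] at hc
      exact h.child_mem k hk d c hc
  · intro k hk d c hc
    by_cases hkx : k = x
    · subst hkx; rw [hchx] at hc; cases hc
    · rw [hch k hkx] at hc
      have hcp := h.child_parent k hk d c hc
      rw [hpar c fun hl => ?_, hcp]
      have := h.child_parent x hx _ c hl
      rw [hcp] at this
      exact hkx (Option.some_injective _ this)
  · intro k hk d c hc
    by_cases hkx : k = x
    · subst hkx; rw [hchx] at hc; cases hc
    · rw [hch k hkx] at hc ⊢
      exact h.child_ne k hk d c hc
  · intro k hk p hp
    by_cases hl : (f x).child false = some k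
    · rw [hparl k hl] at hp; cases hp
    · rw [hpar k hl] at hp
      exact h.parent_mem k hk p hp
  · intro k hk
    have h0 := h.size k hk
    rcases hl : (f x).child false with _ | l
    · have hpar' : ∀ k, (f' k).parent = (f k).parent := fun k => hpar k (by rw [hl]; simp)
      simp only [hpar', sizeOf?, Nat.sub_zero, Function.update_eq_self]
      exact h0
    · have hlK := h.child_mem x hx _ l hl
      have hlp := h.child_parent x hx _ l hl
      have hlne := h.ne_parent hlK hlp
      have hlt := h.size_lt hlK hlp
      have hsum := sum_sub_sum_of_eq_off (K := K) (D := {x, l})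
        (F := fun z => if (f z).parent = some k then (sz z : ℤ) else 0)
        (F' := fun z => if (f' z).parent = some k then
          ((Function.update sz x (sz x - sizeOf? sz (some l)) z : ℕ) : ℤ) else 0)
        (by intro z; simp only [Finset.mem_insert, Finset.mem_singleton]
            rintro (rfl | rfl) <;> assumption)
        (by intro z _ hz
            simp only [Finset.mem_insert, Finset.mem_singleton, not_or] at hz
            rw [hpar z (by rw [hl]; simpa using Ne.symm hz.2), Function.update_of_ne hz.1])
      rw [Finset.sum_pair hlne.symm, hparx, hparl l hl, hpx, hlp] at hsum
      zify at h0 ⊢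
      by_cases hkx : x = k
      · subst hkx
        rw [Function.update_self]
        simp only [if_true, reduceCtorEq, if_false] at hsum
        simp only [sizeOf?] at hsum ⊢
        push_cast [hlt.le]
        linarith
      · rw [Function.update_of_ne (Ne.symm hkx)]
        simp only [Option.some.injEq, hkx, reduceCtorEq, if_false] at hsum
        linarith
  · intro k hk
    by_cases hkx : k = x
    · subst hkx
      rw [hchx, hchx, hfx]
      simp [seqOf, orient, hrev]
    · have hsq : ∀ d, seqOf (Function.update seq x [x]) ((f k).child d) =
          seqOf seq ((f k).child d) := by
        intro d
        rcases hc : (f k).child d with _ | c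
        · rfl
        · refine Function.update_of_ne ?_ _ _
          rintro rfl
          exact hnx k hk d hc
      have hr : (f' k).reversed = (f k).reversed := by
        rw [hf k hkx]
        split_ifs <;> rfl
      rw [hch k hkx, hch k hkx, hsq, hsq, hr, Function.update_of_ne hkx]
      exact h.seq_eq k hk
  · intro k hk
    by_cases hkx : k = x
    · subst hkx
      rw [hfx, Function.update_self]
      exact isOldest_pull isOldest_none isOldest_none
    · have ho : (f' k).oldest = (f k).oldest := by
        rw [hf k hkx]
        split_ifs <;> rfl
      rw [ho, Function.update_of_ne hkx]
      exact h.agg k hk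
  · intro k hk hks
    by_cases hkx : k = x
    · subst hkx
      rw [hparx, Function.update_self]
      exact ⟨Function.update_self _ _ _, trivial⟩
    · rw [Function.update_of_ne hkx]
      by_cases hl : (f x).child false = some k
      · rw [hparl k hl]
        rw [hl] at hpath hnd
        have hpl : PathFrom par none (seq k) := by
          have := hpath
          simp only [seqOf] at this
          rcases hq : List.eq_nil_or_concat (seq k) with h0 | ⟨s, b, h0⟩
          · rw [h0]; trivial
          · rw [h0, List.concat_eq_append, List.append_assoc, List.singleton_append,
              PathFrom.append] at this
            rw [h0, List.concat_eq_append]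
            exact this.1
        refine hpl.congr fun z hz => Function.update_of_ne ?_ _ _
        rintro rfl
        exact (List.disjoint_of_nodup_append hnd) hz (by simp)
      · have hks' : SRoot f k := by
          intro p hp ⟨d, hd⟩
          refine hks p (by rw [hpar k hl, hp]) ⟨d, ?_⟩
          by_cases hpx : p = x
          · subst hpx
            cases d
            · exact absurd hd hl
            · rw [hright] at hd; cases hd
          · rw [hch p hpx, hd]
        rw [hpar k hl]
        refine (h.path k hk hks').congr fun z hz => Function.update_of_ne ?_ _ _
        rintro rfl
        exact h.notMem_seq_of_root hx hs hk hks' hkx (h.self_mem_seq hx) hz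
  · intro k hk
    rw [← h.degree k hk]
    by_cases hkx : k = x
    · subst hkx; rw [hfx]
    · rw [hf k hkx]
      split_ifs <;> rfl

theorem exec_cut (h : Inv K par deg sz seq f) (hx : x ∈ K) :
    ∃ f' sz' seq' N, Exec (cut x) K f () K f' N ∧
      Inv K (Function.update par x none) deg sz' seq' f' ∧
      N + 157 * potential K sz' ≤ 157 * potential K sz + 1010 * (Real.logb 2 K.card + 1) := by
  obtain ⟨w, f₁, sz₁, seq₁, N, -, -, -, -, T, hE₁, h₁, hN, hp, hrev, hr, -⟩ := h.exec_access hx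
  set f₂ := updateAt? f₁ (f₁ x).left fun c => { c with parent := none } with hf₂
  have hlx : (f₁ x).left ≠ some x := fun hc =>
    h₁.ne_parent hx (h₁.child_parent x hx false x hc) rfl
  have hf₂x : f₂ x = f₁ x := by rw [hf₂, updateAt?_apply, if_neg hlx]
  set f₃ := Function.update f₂ x { f₂ x with left := none } with hf₃
  have hf₃x : f₃ x = { f₁ x with left := none } := by rw [hf₃, Function.update_self, hf₂x]
  have hr' : (f₁ x).right = none := hr
  have hpull : pulled f₃ x =
      { f₁ x with left := none, oldest := older x.ownEdge (older none none) } := by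
    unfold pulled
    rw [hf₃x]
    simp only [hr']
    rfl
  have h₄ := h₁.cutLeft (f' := Function.update f₃ x (pulled f₃ x)) hx hp hrev hr
    (fun k hk => by
      rw [Function.update_of_ne hk, hf₃, Function.update_of_ne hk, hf₂, updateAt?_apply]
      rfl)
    (by rw [Function.update_self, hpull])
  refine ⟨_, _, _, N + 9, ?_, h₄, ?_⟩
  · unfold cut
    refine Exec.bind_le hE₁ (M := 9) ?_ le_rfl
    refine Exec.bind_le (exec_readAt hx) (M := 8) ?_ le_rfl
    refine Exec.bind_le (exec_modifyAt? (fun c hc => h₁.child_mem x hx false c hc) _) (M := 6) ?_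
      le_rfl
    refine Exec.bind_le (exec_modifyAt hx _) (M := 4) ?_ le_rfl
    refine exec_pull hx ?_ ?_
    · intro y hy
      change (f₃ x).left = some y at hy
      rw [hf₃x] at hy
      cases hy
    · intro y hy
      change (f₃ x).right = some y at hy
      rw [hf₃x] at hy
      exact h₁.child_mem x hx true y hy
  · have hpot : potential K (Function.update sz₁ x (sz₁ x - sizeOf? sz₁ ((f₁ x).child false))) ≤
        potential K sz₁ := by
      refine Finset.sum_le_sum fun k hk => ?_
      refine logb_mono (h₄.size_pos hk) ?_
      by_cases hkx : k = x
      · subst hkx; rw [Function.update_self]; omega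
      · rw [Function.update_of_ne hkx]
    have := logb_nonneg K.card
    push_cast
    linarith

end Inv

/-! ### Adding and removing records -/

namespace Inv

variable {K : Finset (Key V)} {par : Key V → Option (Key V)} {deg sz : Key V → ℕ}
  {seq : Key V → List (Key V)} {f : Key V → Record V} {x : Key V}

/-- Storing a new record without links. -/
theorem addKey (h : Inv K par deg sz seq f) (hx : x ∉ K) (hpar : par x = none) {r : Record V}
    (hl : r.left = none) (hr : r.right = none) (hp : r.parent = none) (hrev : r.reversed = false)
    (ho : r.oldest = x.ownEdge) (hdeg : r.degree = deg x) :
    Inv (Insert.insert x K) par deg (Function.update sz x 1) (Function.update seq x [x])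
      (Function.update f x r) := by
  set F := Function.update f x r with hF
  have hFx : F x = r := by rw [hF, Function.update_self]
  have hne : ∀ k ∈ K, k ≠ x := fun k hk e => hx (e ▸ hk)
  have hFk : ∀ k ∈ K, F k = f k := fun k hk => by rw [hF, Function.update_of_ne (hne k hk)]
  have hchx : ∀ d, (F x).child d = none := by
    intro d; rw [hFx]; cases d
    · exact hl
    · exact hr
  have hsum : ∀ k, ∑ y ∈ K, (if (F y).parent = some k then Function.update sz x 1 y else 0) =
      ∑ y ∈ K, (if (f y).parent = some k then sz y else 0) := fun k =>
    Finset.sum_congr rfl fun y hy => by rw [hFk y hy, Function.update_of_ne (hne y hy)]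
  refine ⟨?_, ?_, ?_, ?_, ?_, ?_, ?_, ?_, ?_⟩
  · intro k hk d c hc
    rcases Finset.mem_insert.1 hk with rfl | hk
    · rw [hchx] at hc; cases hc
    · rw [hFk k hk] at hc
      exact Finset.mem_insert_of_mem (h.child_mem k hk d c hc)
  · intro k hk d c hc
    rcases Finset.mem_insert.1 hk with rfl | hk
    · rw [hchx] at hc; cases hc
    · rw [hFk k hk] at hc
      rw [hFk c (h.child_mem k hk d c hc)]
      exact h.child_parent k hk d c hc
  · intro k hk d c hc
    rcases Finset.mem_insert.1 hk with rfl | hk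
    · rw [hchx] at hc; cases hc
    · rw [hFk k hk] at hc ⊢
      exact h.child_ne k hk d c hc
  · intro k hk p hp'
    rcases Finset.mem_insert.1 hk with rfl | hk
    · rw [hFx, hp] at hp'; cases hp'
    · rw [hFk k hk] at hp'
      exact Finset.mem_insert_of_mem (h.parent_mem k hk p hp')
  · intro k hk
    rw [Finset.sum_insert hx, hsum, hFx, hp]
    simp only [reduceCtorEq, if_false, zero_add]
    rcases Finset.mem_insert.1 hk with rfl | hk
    · rw [Function.update_self, Finset.sum_eq_zero fun y hy =>
        if_neg fun hy' => hx (h.parent_mem y hy _ hy'), add_zero]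
    · rw [Function.update_of_ne (hne k hk)]
      exact h.size k hk
  · intro k hk
    rcases Finset.mem_insert.1 hk with rfl | hk
    · rw [hchx, hchx, hFx, hrev]
      simp [seqOf, orient]
    · have hsq : ∀ d, seqOf (Function.update seq x [x]) ((f k).child d) =
          seqOf seq ((f k).child d) := by
        intro d
        rcases hc : (f k).child d with _ | c
        · rfl
        · exact Function.update_of_ne (hne c (h.child_mem k hk d c hc)) _ _
      rw [hFk k hk, hsq, hsq, Function.update_of_ne (hne k hk)]
      exact h.seq_eq k hk
  · intro k hk
    rcases Finset.mem_insert.1 hk with rfl | hk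
    · rw [hFx, ho, Function.update_self]
      have := isOldest_pull (x := k) (isOldest_none (V := V)) isOldest_none
      cases k <;> exact this
    · rw [hFk k hk, Function.update_of_ne (hne k hk)]
      exact h.agg k hk
  · intro k hk hks
    rcases Finset.mem_insert.1 hk with rfl | hk
    · rw [Function.update_self, hFx, hp]
      exact ⟨hpar, trivial⟩
    · rw [Function.update_of_ne (hne k hk), hFk k hk]
      refine h.path k hk fun p hp' ⟨d, hd⟩ => ?_
      have hpK := h.parent_mem k hk p hp'
      exact hks p (by rw [hFk k hk, hp']) ⟨d, by rw [hFk p hpK, hd]⟩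
  · intro k hk
    rcases Finset.mem_insert.1 hk with rfl | hk
    · rw [hFx, hdeg]
    · rw [hFk k hk]
      exact h.degree k hk

theorem potential_addKey (hx : x ∉ K) (sz : Key V → ℕ) :
    potential (Insert.insert x K) (Function.update sz x 1) = potential K sz := by
  unfold potential
  rw [Finset.sum_insert hx, Function.update_self]
  simp only [Nat.cast_one, Real.logb_one, zero_add]
  refine Finset.sum_congr rfl fun y hy => ?_
  have hne : y ≠ x := by rintro rfl; exact hx hy
  rw [Function.update_of_ne hne]

/-- A record that is isolated in the represented forest is isolated in the virtual trees, too. -/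
theorem isolated (h : Inv K par deg sz seq f) (hx : x ∈ K) (hpar : par x = none)
    (hchild : ∀ y, par y ≠ some x) :
    (f x).parent = none ∧ ∀ y ∈ K, (f y).parent ≠ some x := by
  obtain ⟨r, hr, hs, n, hb⟩ := h.exists_root hx
  have hpath := h.path r hr hs
  have hxr := h.mem_seq_of_below hr hb
  have hseq : seq r = [x] ∧ (f r).parent = none := by
    obtain ⟨s, t, hst⟩ := List.append_of_mem hxr
    rw [hst, PathFrom.append] at hpath
    have ht : t = [] := by
      rcases t with _ | ⟨b, t⟩
      · rfl
      · exact absurd hpath.2.1 (hchild b)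
    rcases List.eq_nil_or_concat s with rfl | ⟨s, b, rfl⟩
    · exact ⟨by rw [hst, ht]; rfl, hpath.1.1.symm.trans hpar⟩
    · have h1 := hpath.1
      rw [List.concat_eq_append, List.append_assoc, List.singleton_append, PathFrom.append] at h1
      rw [h1.2.1] at hpar
      cases hpar
  have hrx : r = x := by
    have := h.self_mem_seq hr
    rw [hseq.1, List.mem_singleton] at this
    exact this
  subst hrx
  refine ⟨hseq.2, fun y hy hyp => ?_⟩
  by_cases hys : SRoot f y
  · have hpy := h.path y hy hys
    rw [hyp] at hpy
    obtain ⟨a, l, hal⟩ := List.exists_cons_of_ne_nil (List.ne_nil_of_mem (h.self_mem_seq hy))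
    rw [hal] at hpy
    exact hchild a hpy.1
  · have hc : IsChild f y r := by
      by_contra hc
      exact hys fun p hp => by rw [hyp] at hp; cases hp; exact hc
    have := h.child_mem_seq hr (h.self_mem_seq hr) hc
    rw [hseq.1, List.mem_singleton] at this
    exact h.ne_parent hy hyp this

theorem removeKey (h : Inv K par deg sz seq f) (hx : x ∈ K) (hpar : par x = none)
    (hchild : ∀ y, par y ≠ some x) :
    Inv (K.erase x) par deg sz seq f ∧ potential (K.erase x) sz = potential K sz := by
  obtain ⟨hp, hnp⟩ := h.isolated hx hpar hchild
  have hsum : ∀ k, ∑ y ∈ K.erase x, (if (f y).parent = some k then sz y else 0) =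
      ∑ y ∈ K, (if (f y).parent = some k then sz y else 0) := by
    intro k
    rw [← Finset.sum_erase_add K _ hx, hp]
    simp
  have hmem : ∀ k ∈ K.erase x, k ∈ K := fun k hk => Finset.mem_of_mem_erase hk
  refine ⟨⟨?_, ?_, ?_, ?_, ?_, ?_, ?_, ?_, ?_⟩, ?_⟩
  · intro k hk d c hc
    refine Finset.mem_erase.2 ⟨?_, h.child_mem k (hmem k hk) d c hc⟩
    rintro rfl
    have := h.child_parent k (hmem k hk) d c hc
    rw [hp] at this
    cases this
  · exact fun k hk => h.child_parent k (hmem k hk)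
  · exact fun k hk => h.child_ne k (hmem k hk)
  · intro k hk p hkp
    refine Finset.mem_erase.2 ⟨?_, h.parent_mem k (hmem k hk) p hkp⟩
    rintro rfl
    exact hnp k (hmem k hk) hkp
  · intro k hk
    rw [hsum]
    exact h.size k (hmem k hk)
  · exact fun k hk => h.seq_eq k (hmem k hk)
  · exact fun k hk => h.agg k (hmem k hk)
  · exact fun k hk => h.path k (hmem k hk)
  · exact fun k hk => h.degree k (hmem k hk)
  · have hsx : sz x = 1 := by
      rw [h.size x hx, Finset.sum_eq_zero fun y hy => if_neg (hnp y hy), add_zero]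
    unfold potential
    rw [← Finset.sum_erase_add K _ hx, hsx]
    simp

theorem setDegree (h : Inv K par deg sz seq f) (n : ℕ) :
    Inv K par (Function.update deg x n) sz seq
      (Function.update f x { f x with degree := n }) := by
  set F := Function.update f x { f x with degree := n } with hF
  have hF' : ∀ k, F k = { f k with degree := (F k).degree } := by
    intro k
    by_cases hk : k = x
    · subst hk; rw [hF, Function.update_self]
    · rw [hF, Function.update_of_ne hk]
  have hch : ∀ k d, (F k).child d = (f k).child d := fun k d => by rw [hF']; cases d <;> rfl
  have hpar : ∀ k, (F k).parent = (f k).parent := fun k => by rw [hF']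
  have hold : ∀ k, (F k).oldest = (f k).oldest := fun k => by rw [hF']
  have hrev : ∀ k, (F k).reversed = (f k).reversed := fun k => by rw [hF']
  refine ⟨?_, ?_, ?_, ?_, ?_, ?_, ?_, ?_, ?_⟩
  · simp only [hch]; exact h.child_mem
  · simp only [hch, hpar]; exact h.child_parent
  · simp only [hch]; exact h.child_ne
  · simp only [hpar]; exact h.parent_mem
  · simp only [hpar]; exact h.size
  · simp only [hch, hrev]; exact h.seq_eq
  · simp only [hold]; exact h.agg
  · simp only [SRoot, IsChild, hpar, hch]; exact h.path
  · intro k hk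
    by_cases hkx : k = x
    · subst hkx; rw [hF, Function.update_self, Function.update_self]
    · rw [hF, Function.update_of_ne hkx, Function.update_of_ne hkx]
      exact h.degree k hk

end Inv

/-! ### Forests of streaming edges -/

/-- The vertices `x` and `y` are connected by edges in `S`. -/
def Linked (S : Set (StreamEdge V)) : V → V → Prop :=
  Relation.ReflTransGen fun a b => ∃ e ∈ S, e.u = a ∧ e.v = b ∨ e.u = b ∧ e.v = a

theorem Linked.symm {S : Set (StreamEdge V)} {x y : V} (h : Linked S x y) : Linked S y x := by
  induction h with
  | refl => exact .refl
  | tail _ h' ih =>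
    obtain ⟨e, he, h'⟩ := h'
    exact .head ⟨e, he, Or.symm h'⟩ ih

theorem linked_edge {S : Set (StreamEdge V)} {e : StreamEdge V} (he : e ∈ S) :
    Linked S e.u e.v := .single ⟨e, he, Or.inl ⟨rfl, rfl⟩⟩

/-- Edges may be replaced by connections between their end points. -/
theorem Linked.of_forall {S S' : Set (StreamEdge V)} {x y : V} (h : Linked S x y)
    (hS : ∀ e ∈ S, Linked S' e.u e.v) : Linked S' x y := by
  induction h with
  | refl => exact .refl
  | tail _ h' ih =>
    obtain ⟨e, he, ⟨rfl, rfl⟩ | ⟨rfl, rfl⟩⟩ := h'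
    · exact ih.trans (hS e he)
    · exact ih.trans (hS e he).symm

theorem Linked.mono {S S' : Set (StreamEdge V)} {x y : V} (h : Linked S x y) (hS : S ⊆ S') :
    Linked S' x y := h.of_forall fun _ he => linked_edge (hS he)

/-- Adjacency in the graph that arises from `S` by subdividing each edge, the new vertex being the
record of the edge. -/
def KAdj (S : Set (StreamEdge V)) (x y : Key V) : Prop :=
  ∃ e ∈ S, x = .edge e ∧ (y = .vertex e.u ∨ y = .vertex e.v) ∨
    y = .edge e ∧ (x = .vertex e.u ∨ x = .vertex e.v)

theorem kAdj_edge_iff {S : Set (StreamEdge V)} {e : StreamEdge V} {y : Key V} :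
    KAdj S (.edge e) y ↔ e ∈ S ∧ (y = .vertex e.u ∨ y = .vertex e.v) := by
  constructor
  · rintro ⟨e', he, ⟨h, h'⟩ | ⟨-, h | h⟩⟩
    · cases h; exact ⟨he, h'⟩
    · cases h
    · cases h
  · rintro ⟨he, h⟩
    exact ⟨e, he, Or.inl ⟨rfl, h⟩⟩

theorem KAdj.symm {S : Set (StreamEdge V)} {x y : Key V} (h : KAdj S x y) : KAdj S y x := by
  obtain ⟨e, he, h⟩ := h
  exact ⟨e, he, Or.symm h⟩

theorem kAdj_vertex_iff {S : Set (StreamEdge V)} {x : V} {y : Key V} :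
    KAdj S (.vertex x) y ↔ ∃ e ∈ S, y = .edge e ∧ (e.u = x ∨ e.v = x) := by
  constructor
  · rintro ⟨e, he, ⟨h, -⟩ | ⟨h, h'⟩⟩
    · cases h
    · refine ⟨e, he, h, ?_⟩
      rcases h' with h' | h' <;> cases h'
      · exact Or.inl rfl
      · exact Or.inr rfl
  · rintro ⟨e, he, rfl, rfl | rfl⟩
    · exact ⟨e, he, Or.inr ⟨rfl, Or.inl rfl⟩⟩
    · exact ⟨e, he, Or.inr ⟨rfl, Or.inr rfl⟩⟩

theorem linked_of_kAdj {S : Set (StreamEdge V)} {x y : V}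
    (h : Relation.ReflTransGen (KAdj S) (.vertex x) (.vertex y)) : Linked S x y := by
  have key : ∀ k, Relation.ReflTransGen (KAdj S) (.vertex x) k →
      (∀ z, k = .vertex z → Linked S x z) ∧
        ∀ e, k = .edge e → Linked S x e.u ∧ Linked S x e.v := by
    intro k hk
    induction hk with
    | refl =>
      refine ⟨fun z hz => ?_, fun e he => by cases he⟩
      cases hz
      exact .refl
    | @tail a b _ hab ih =>
      obtain ⟨e, he, ⟨rfl, h⟩ | ⟨rfl, h⟩⟩ := hab
      · refine ⟨fun z hz => ?_, fun e' he' => ?_⟩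
        · subst hz
          rcases h with h | h <;> cases h
          · exact (ih.2 e rfl).1
          · exact (ih.2 e rfl).2
        · subst he'
          rcases h with h | h <;> exact nomatch h
      · refine ⟨fun z hz => (nomatch hz), fun e' he' => ?_⟩
        cases he'
        rcases h with rfl | rfl
        · have := ih.1 _ rfl
          exact ⟨this, this.trans (linked_edge he)⟩
        · have := ih.1 _ rfl
          exact ⟨this.trans (linked_edge he).symm, this⟩
  exact (key _ h).1 y rfl

theorem kAdj_of_linked {S : Set (StreamEdge V)} {x y : V} (h : Linked S x y) :
    Relation.ReflTransGen (KAdj S) (.vertex x) (.vertex y) := by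
  induction h with
  | refl => exact .refl
  | tail _ h' ih =>
    obtain ⟨e, he, ⟨rfl, rfl⟩ | ⟨rfl, rfl⟩⟩ := h'
    · exact (ih.tail (kAdj_vertex_iff.2 ⟨e, he, rfl, Or.inl rfl⟩)).tail
        (kAdj_edge_iff.2 ⟨he, Or.inr rfl⟩)
    · exact (ih.tail (kAdj_vertex_iff.2 ⟨e, he, rfl, Or.inr rfl⟩)).tail
        (kAdj_edge_iff.2 ⟨he, Or.inl rfl⟩)

/-- The forest with parent function `par` is the graph of the edges in `S`, with the records of the
edges as additional vertices, and `K` consists of its records that are not isolated. As no root is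
the record of an edge, each edge has a child, which is one of its end points. -/
structure Stored (S : Finset (StreamEdge V)) (K : Finset (Key V))
    (par : Key V → Option (Key V)) (deg : Key V → ℕ) : Prop where
  adj : ∀ x y, ParAdj par x y ↔ KAdj (↑S) x y
  noloop : ∀ e ∈ S, e.u ≠ e.v
  mem_edge : ∀ e, Key.edge e ∈ K ↔ e ∈ S
  mem_vertex : ∀ x, Key.vertex x ∈ K ↔ 0 < deg (.vertex x)
  degree : ∀ x, deg (.vertex x) = (S.filter fun e => e.u = x ∨ e.v = x).card
  root : ∀ e ∈ S, par (.edge e) ≠ none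

namespace Stored

variable {S : Finset (StreamEdge V)} {K : Finset (Key V)} {par : Key V → Option (Key V)}
  {deg sz : Key V → ℕ} {seq : Key V → List (Key V)} {f : Key V → Record V}

theorem conn_iff (hS : Stored S K par deg) {u v : V} :
    Conn par (.vertex u) (.vertex v) ↔ Linked (↑S) u v := by
  have : ParAdj par = KAdj (↑S : Set (StreamEdge V)) := by
    funext a b
    exact propext (hS.adj a b)
  rw [Conn, this]
  exact ⟨linked_of_kAdj, kAdj_of_linked⟩

theorem vertex_mem_iff (hS : Stored S K par deg) {x : V} :
    Key.vertex x ∈ K ↔ ∃ e ∈ S, e.u = x ∨ e.v = x := by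
  rw [hS.mem_vertex, hS.degree, Finset.card_pos]
  simp [Finset.Nonempty]

theorem mem_of_linked (hS : Stored S K par deg) {u v : V} (h : Linked (↑S) u v) (huv : u ≠ v) :
    Key.vertex u ∈ K ∧ Key.vertex v ∈ K := by
  have key : ∀ {u v : V}, Linked (↑S) u v → u ≠ v → Key.vertex u ∈ K := by
    intro u v h huv
    rcases Relation.ReflTransGen.cases_head h with rfl | ⟨w, ⟨e, he, h'⟩, -⟩
    · exact absurd rfl huv
    · refine hS.vertex_mem_iff.2 ⟨e, he, ?_⟩
      tauto
  exact ⟨key h huv, key h.symm huv.symm⟩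

/-- A record that is not stored is isolated. -/
theorem par_ne (hS : Stored S K par deg) {x : Key V} (hx : x ∉ K) :
    par x = none ∧ ∀ y, par y ≠ some x := by
  have key : ∀ y, ¬ParAdj par x y := by
    intro y hy
    rw [hS.adj] at hy
    cases x with
    | vertex x =>
      obtain ⟨e, he, -, h⟩ := kAdj_vertex_iff.1 hy
      exact hx (hS.vertex_mem_iff.2 ⟨e, he, h⟩)
    | edge e => exact hx ((hS.mem_edge e).2 (kAdj_edge_iff.1 hy).1)
  refine ⟨?_, fun y hy => key y (Or.inr hy)⟩
  rcases hp : par x with _ | y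
  · rfl
  · exact absurd (Or.inl hp) (key y)

/-- Each edge record has a child, which is an end point of the edge. Hence there are no more edges
than vertices. -/
theorem card_le (hS : Stored S K par deg) {W : Finset V}
    (hW : ∀ e ∈ S, e.u ∈ W ∧ e.v ∈ W) : K.card ≤ 2 * W.card := by
  classical
  let φ : Key V → V × Bool
    | .vertex x => (x, false)
    | .edge e => (if par (.vertex e.u) = some (.edge e) then e.u else e.v, true)
  have hchild : ∀ e ∈ S, par (.vertex (φ (.edge e)).1) = some (.edge e) := by
    intro e he
    have hu := (hS.adj (.edge e) (.vertex e.u)).2 (kAdj_edge_iff.2 ⟨he, Or.inl rfl⟩)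
    have hv := (hS.adj (.edge e) (.vertex e.v)).2 (kAdj_edge_iff.2 ⟨he, Or.inr rfl⟩)
    simp only [φ]
    split_ifs with hc
    · exact hc
    · rcases hv with hv | hv
      · rcases hu with hu | hu
        · rw [hu] at hv
          simp only [Option.some.injEq, Key.vertex.injEq] at hv
          exact absurd hv (hS.noloop e he)
        · exact absurd hu hc
      · exact hv
  have hcard : K.card ≤ (W ×ˢ (Finset.univ : Finset Bool)).card := by
    refine Finset.card_le_card_of_injOn φ (fun k hk => ?_) (fun k hk k' hk' hkk => ?_)
    · rw [Finset.mem_coe, Finset.mem_product]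
      refine ⟨?_, Finset.mem_univ _⟩
      cases k with
      | vertex x =>
        obtain ⟨e, he, rfl | rfl⟩ := hS.vertex_mem_iff.1 hk
        · exact (hW e he).1
        · exact (hW e he).2
      | edge e =>
        have he := (hS.mem_edge e).1 hk
        simp only [φ]
        split_ifs
        · exact (hW e he).1
        · exact (hW e he).2
    · cases k with
      | vertex x =>
        cases k' with
        | vertex y => simp only [φ, Prod.mk.injEq] at hkk; rw [hkk.1]
        | edge e => simp [φ] at hkk
      | edge e =>
        cases k' with
        | vertex y => simp [φ] at hkk
        | edge e' =>
          have h1 := hchild e ((hS.mem_edge e).1 hk)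
          have h2 := hchild e' ((hS.mem_edge e').1 hk')
          rw [hkk, h2] at h1
          exact (Option.some_injective _ h1).symm
  rwa [Finset.card_product, Finset.card_univ, Fintype.card_bool, mul_comm] at hcard

end Stored

namespace Inv

variable {K : Finset (Key V)} {par : Key V → Option (Key V)} {deg sz : Key V → ℕ}
  {seq : Key V → List (Key V)} {f f' : Key V → Record V} {x y : Key V}

/-- A virtual tree has one root. -/
theorem eq_of_conn (h : Inv K par deg sz seq f) (hx : x ∈ K) (hy : y ∈ K)
    (hpx : (f x).parent = none) (hpy : (f y).parent = none) (hc : Conn par x y) : x = y := by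
  have hsx : SRoot f x := sroot_of_parent_none hpx
  have hsy : SRoot f y := sroot_of_parent_none hpy
  have h1 := h.path x hx hsx
  have h2 := h.path y hy hsy
  have hxs := h.self_mem_seq hx
  have hys := h.self_mem_seq hy
  obtain ⟨a, l, hal⟩ := List.exists_cons_of_ne_nil (List.ne_nil_of_mem hxs)
  obtain ⟨b, l', hbl⟩ := List.exists_cons_of_ne_nil (List.ne_nil_of_mem hys)
  rw [hpx, hal] at h1
  rw [hpy, hbl] at h2
  have hab := hc.root_eq h1 (hal ▸ hxs) h2 (hbl ▸ hys)
  subst hab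
  exact h.root_unique hx hy hsx hsy (y := a) (by rw [hal]; simp) (by rw [hbl]; simp)

end Inv

/-! ### Queries -/

namespace Stored

variable {S : Finset (StreamEdge V)} {K : Finset (Key V)} {par : Key V → Option (Key V)}
  {deg sz : Key V → ℕ} {seq : Key V → List (Key V)} {f : Key V → Record V}

open Classical in
/-- After `access u` the parent pointer of `u` is null. It stays so if `v` is in another tree, and it
does not if `v` is in the same tree, since `v` becomes the root of the virtual tree. -/
theorem exec_query (hS : Stored S K par deg) (h : Inv K par deg sz seq f) (u v : V) :
    ∃ f' sz' seq' N, Exec (query u v) K f (decide (Linked (↑S) u v)) K f' N ∧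
      Inv K par deg sz' seq' f' ∧
      N + 157 * potential K sz' ≤ 157 * potential K sz + 2010 * (Real.logb 2 K.card + 1) := by
  have hlog := logb_nonneg K.card
  by_cases huv : u = v
  · refine ⟨f, sz, seq, 1, ?_, h, by push_cast; linarith⟩
    unfold query
    refine Exec.bind_le exec_tick (M := 0) ?_ le_rfl
    rw [if_pos huv, decide_eq_true (by rw [huv]; exact .refl)]
    exact Exec.pure _
  by_cases hK : Key.vertex u ∈ K ∧ Key.vertex v ∈ K
  · obtain ⟨hu, hv⟩ := hK
    obtain ⟨w₁, f₁, sz₁, seq₁, N₁, -, -, -, -, -, hE₁, h₁, hN₁, hp₁, -⟩ := h.exec_access hu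
    obtain ⟨w₂, f₂, sz₂, seq₂, N₂, -, -, -, -, -, hE₂, h₂, hN₂, hp₂, -, -, -, -, -, -, -, -, hfr, -⟩ :=
      h₁.exec_access hv
    have hans : decide (Linked (↑S) u v) = (f₂ (.vertex u)).parent.isSome := by
      rcases hp : (f₂ (.vertex u)).parent with _ | p
      · refine decide_eq_false fun hl => huv ?_
        have := h₂.eq_of_conn hu hv hp hp₂ (hS.conn_iff.2 hl)
        cases this
        rfl
      · refine decide_eq_true ?_
        by_contra hl
        rw [hfr _ hu fun hc => hl (hS.conn_iff.1 hc), hp₁] at hp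
        cases hp
    refine ⟨f₂, sz₂, seq₂, 3 + (N₁ + (N₂ + 1)), ?_, h₂, by push_cast; linarith⟩
    unfold query
    refine Exec.bind_le exec_tick (M := 2 + (N₁ + (N₂ + 1))) ?_ (by omega)
    rw [if_neg huv]
    refine Exec.bind_le (exec_isStored _) (M := 1 + (N₁ + (N₂ + 1))) ?_ (by omega)
    refine Exec.bind_le (exec_isStored _) (M := N₁ + (N₂ + 1)) ?_ (by omega)
    rw [if_pos (by simp [hu, hv])]
    refine Exec.bind_le hE₁ (M := N₂ + 1) ?_ le_rfl
    refine Exec.bind_le hE₂ (M := 1) ?_ le_rfl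
    rw [hans]
    exact Exec.bind_le (exec_readAt hu) (Exec.pure _) le_rfl
  · refine ⟨f, sz, seq, 3, ?_, h, by push_cast; linarith⟩
    unfold query
    refine Exec.bind_le exec_tick (M := 2) ?_ (by omega)
    rw [if_neg huv]
    refine Exec.bind_le (exec_isStored _) (M := 1) ?_ (by omega)
    refine Exec.bind_le (exec_isStored _) (M := 0) ?_ (by omega)
    rw [if_neg (by simpa using hK), decide_eq_false fun hl => hK (hS.mem_of_linked hl huv)]
    exact Exec.pure _

end Stored

/-! ### The minimum on a cycle -/

namespace Inv

variable {K : Finset (Key V)} {par : Key V → Option (Key V)} {deg sz : Key V → ℕ}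
  {seq : Key V → List (Key V)} {f f' : Key V → Record V} {x a : Key V} {A B T : List (Key V)}

/-- When the path to the ancestor `a` of `x` is made preferred, the rest `B` of the path to `x` is left
in a splay tree of its own, and its aggregate is the result. -/
theorem exec_minToAncestor (h : Inv K par deg sz seq f) (hx : x ∈ K)
    (hpath : PathFrom par none (A ++ a :: B)) (hT : A ++ a :: B = T ++ [x]) :
    ∃ o f' sz' seq' N, Exec (minToAncestor x a) K f o K f' N ∧ Inv K par deg sz' seq' f' ∧
      IsOldest o B ∧
      N + 157 * potential K sz' ≤ 157 * potential K sz + 2600 * (Real.logb 2 K.card + 1) := by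
  have hlog := logb_nonneg K.card
  by_cases hxa : x = a
  · subst hxa
    have hB : B = [] := by
      rcases List.eq_nil_or_concat B with rfl | ⟨B', b, rfl⟩
      · rfl
      · rw [List.concat_eq_append, ← List.cons_append, ← List.append_assoc] at hT
        obtain ⟨-, hb⟩ := List.append_inj' hT rfl
        cases hb
        have := hpath.nodup
        rw [List.concat_eq_append] at this
        exact absurd (List.nodup_cons.1 (List.Nodup.of_append_right this)).1 (by simp)
    subst hB
    refine ⟨none, f, sz, seq, 0, ?_, h, isOldest_none, by push_cast; linarith⟩
    unfold minToAncestor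
    rw [if_pos rfl]
    exact Exec.pure _
  · obtain ⟨w₁, f₁, sz₁, seq₁, N₁, -, -, -, -, T₁, hE₁, h₁, hN₁, hp₁, -, -, hT₁, -⟩ :=
      h.exec_access hx
    have hs₁ : SRoot f₁ x := sroot_of_parent_none hp₁
    have hpx := h₁.path x hx hs₁
    have hseq : seq₁ x = A ++ a :: B := by
      rw [hp₁, hT₁] at hpx
      rw [hT] at hpath ⊢
      rw [hT₁, hpx.unique hpath]
    have hax : a ∈ seq₁ x := by rw [hseq]; simp
    have ha : a ∈ K := h₁.mem_of_mem_seq hx hax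
    obtain ⟨w, f₂, sz₂, seq₂, N₂, r, A', B', E, T₂, hE₂, h₂, hN₂, hp₂, -, -, hT₂, hr, hpr, hsr, hsa,
      hdis, -, hB⟩ := h₁.exec_access ha
    have hs₂ : SRoot f₂ a := sroot_of_parent_none hp₂
    -- the virtual tree of `a` has the root `x`
    have hrx : r = x := by
      refine h₁.eq_of_conn hr hx hpr hp₁ ?_
      have c1 : Conn par r w := h₁.conn_root hr (sroot_of_parent_none hpr) (h₁.self_mem_seq hr)
        (by rw [hsr]; simp)
      have c2 : Conn par w a := h₂.conn_root ha hs₂ (by rw [hsa]; simp) (h₂.self_mem_seq ha)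
      exact (c1.trans c2).trans (h₁.conn_root hx hs₁ hax (h₁.self_mem_seq hx))
    subst hrx
    have hpa : seq₂ a = A ++ [a] := by
      have h1 := h₂.path a ha hs₂
      rw [hp₂, hT₂] at h1
      rw [hT₂, h1.unique (PathFrom.append.1 hpath).1]
    have hE : E = [] := by
      rcases E with _ | ⟨z, E⟩
      · rfl
      · refine absurd ?_ (hdis z (by simp))
        have hz : z ∈ seq₂ a := by rw [hsa]; simp
        rw [hpa] at hz
        rw [hseq]
        simp only [List.mem_append, List.mem_cons, List.not_mem_nil, or_false] at hz ⊢
        tauto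
    subst hE
    rw [hpa] at hsa
    obtain ⟨hA, hw⟩ := List.append_inj' hsa rfl
    cases hw
    subst hA
    rw [hseq] at hsr
    have hBB : B = B' := by simpa using hsr
    subst hBB
    have hxB : r ∈ B := by
      rcases List.eq_nil_or_concat B with rfl | ⟨B', b, rfl⟩
      · obtain ⟨-, hb⟩ := List.append_inj' hT rfl
        cases hb
        exact absurd rfl hxa
      · rw [List.concat_eq_append, ← List.cons_append, ← List.append_assoc] at hT
        obtain ⟨-, hb⟩ := List.append_inj' hT rfl
        cases hb
        simp
    obtain ⟨b, hbK, hbs, hbq⟩ := hB hax (List.ne_nil_of_mem hxB)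
    obtain ⟨n, hn⟩ := h₂.below_of_mem_seq hbK (hbq ▸ hxB)
    obtain ⟨f₃, sz₃, seq₃, hE₃, M, -, hpot⟩ := h₂.exec_splay n hbK hbs hn
    refine ⟨(f₃ r).oldest, f₃, sz₃, seq₃, N₁ + (N₂ + (60 * (n / 2 + 2) + 1)), ?_, M.inv, ?_, ?_⟩
    · unfold minToAncestor
      rw [if_neg hxa]
      refine Exec.bind_le hE₁ (M := N₂ + (60 * (n / 2 + 2) + 1)) ?_ le_rfl
      refine Exec.bind_le hE₂ (M := 60 * (n / 2 + 2) + 1) ?_ le_rfl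
      refine Exec.bind_le hE₃ (M := 1) ?_ le_rfl
      exact Exec.bind_le (exec_readAt hx) (Exec.pure _) le_rfl
    · have := M.inv.agg r hx
      rwa [M.seq_eq, hbq] at this
    · have h1 := logb_mono (h₂.size_pos hbK) (h₂.size_le_card hbK)
      have h2 := logb_nonneg (sz₂ r)
      have h3 : (0 : ℝ) ≤ ((n / 2 : ℕ) : ℝ) := Nat.cast_nonneg _
      push_cast
      generalize ((n / 2 : ℕ) : ℝ) = c at *
      linarith

end Inv

/-- The paths to `x` and to `y` from their root, which part at `a`. -/
structure Fork (par : Key V → Option (Key V)) (A : List (Key V)) (a : Key V) (B E : List (Key V))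
    (x y : Key V) : Prop where
  left : PathFrom par none (A ++ a :: B)
  right : PathFrom par none (A ++ a :: E)
  left_end : ∃ T, A ++ a :: B = T ++ [x]
  right_end : ∃ T, A ++ a :: E = T ++ [y]
  disjoint : ∀ k ∈ E, k ∉ A ++ a :: B

namespace Inv

variable {K : Finset (Key V)} {par : Key V → Option (Key V)} {deg sz : Key V → ℕ}
  {seq : Key V → List (Key V)} {f f' : Key V → Record V}

theorem exec_findMinInCycle (h : Inv K par deg sz seq f) {e : StreamEdge V}
    (hu : .vertex e.u ∈ K) (hv : .vertex e.v ∈ K) (hc : Conn par (.vertex e.u) (.vertex e.v)) :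
    ∃ o f' sz' seq' N A a B E, Exec (findMinInCycle e) K f o K f' N ∧ Inv K par deg sz' seq' f' ∧
      Fork par A a B E (.vertex e.u) (.vertex e.v) ∧ IsOldest o (B ++ E) ∧
      N + 157 * potential K sz' ≤ 157 * potential K sz + 7200 * (Real.logb 2 K.card + 1) := by
  obtain ⟨w₁, f₁, sz₁, seq₁, N₁, -, -, -, -, T₁, hE₁, h₁, hN₁, hp₁, -, -, hT₁, -⟩ :=
    h.exec_access hu
  obtain ⟨a, f₂, sz₂, seq₂, N₂, r, A, B, E, T₂, hE₂, h₂, hN₂, hp₂, -, -, hT₂, hr, hpr, hsr, hsv,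
    hdis, -, -⟩ := h₁.exec_access hv
  have hs₁ : SRoot f₁ (.vertex e.u) := sroot_of_parent_none hp₁
  have hs₂ : SRoot f₂ (.vertex e.v) := sroot_of_parent_none hp₂
  have hru : r = .vertex e.u := by
    refine h₁.eq_of_conn hr hu hpr hp₁ ?_
    have c1 : Conn par r a := h₁.conn_root hr (sroot_of_parent_none hpr) (h₁.self_mem_seq hr)
      (by rw [hsr]; simp)
    have c2 : Conn par a (.vertex e.v) :=
      h₂.conn_root hv hs₂ (by rw [hsv]; simp) (h₂.self_mem_seq hv)
    exact (c1.trans c2).trans hc.symm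
  subst hru
  have hF : Fork par A a B E (.vertex e.u) (.vertex e.v) := by
    have p1 := h₁.path _ hu hs₁
    have p2 := h₂.path _ hv hs₂
    rw [hp₁, hsr] at p1
    rw [hp₂, hsv] at p2
    exact ⟨p1, p2, ⟨T₁, hsr.symm.trans hT₁⟩, ⟨T₂, hsv.symm.trans hT₂⟩, by rwa [hsr] at hdis⟩
  obtain ⟨Tu, hTu⟩ := hF.left_end
  obtain ⟨Tv, hTv⟩ := hF.right_end
  obtain ⟨o₃, f₃, sz₃, seq₃, N₃, hE₃, h₃, ho₃, hN₃⟩ := h₂.exec_minToAncestor hu hF.left hTu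
  obtain ⟨o₄, f₄, sz₄, seq₄, N₄, hE₄, h₄, ho₄, hN₄⟩ := h₃.exec_minToAncestor hv hF.right hTv
  refine ⟨older o₃ o₄, f₄, sz₄, seq₄, N₁ + (N₂ + (N₃ + N₄)), A, a, B, E, ?_, h₄, hF,
    ho₃.older ho₄, by push_cast; linarith⟩
  unfold findMinInCycle
  refine Exec.bind_le hE₁ (M := N₂ + (N₃ + N₄)) ?_ le_rfl
  refine Exec.bind_le hE₂ (M := N₃ + N₄) ?_ le_rfl
  refine Exec.bind_le hE₃ (M := N₄) ?_ le_rfl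
  exact Exec.bind_le hE₄ (Exec.pure _) le_rfl

end Inv

theorem PathFrom.not_two_cycle {par : Key V → Option (Key V)} {l : List (Key V)} {x y : Key V}
    (h : PathFrom par none l) (hx : x ∈ l) (hxy : par x = some y) (hyx : par y = some x) :
    False := by
  obtain ⟨s, t, rfl⟩ := List.append_of_mem hx
  have h1 := (PathFrom.append.1 h).1
  rcases List.eq_nil_or_concat s with rfl | ⟨s, b, rfl⟩
  · rw [h1.1] at hxy; cases hxy
  · have h2 := h1
    rw [List.concat_eq_append, List.append_assoc, List.singleton_append, PathFrom.append] at h2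
    rw [h2.2.1] at hxy
    cases hxy
    rcases List.eq_nil_or_concat s with rfl | ⟨s, c, rfl⟩
    · rw [h2.1.1] at hyx; cases hyx
    · have h3 := h2.1
      rw [List.concat_eq_append, List.append_assoc, List.singleton_append, PathFrom.append] at h3
      rw [h3.2.1] at hyx
      cases hyx
      simpa using congrArg List.length (h3.1.unique h1)

namespace Stored

variable {S : Finset (StreamEdge V)} {K : Finset (Key V)} {par : Key V → Option (Key V)}
  {deg : Key V → ℕ} {A B E : List (Key V)} {a : Key V} {u v : V}

/-- The paths to two vertices do not part at the record of an edge, since that has one child. -/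
theorem fork_vertex (hS : Stored S K par deg) (hF : Fork par A a B E (.vertex u) (.vertex v)) :
    ∃ z, a = .vertex z := by
  cases a with
  | vertex z => exact ⟨z, rfl⟩
  | edge e =>
    exfalso
    have hne : ∀ {B : List (Key V)} {x : V}, (∃ T, A ++ .edge e :: B = T ++ [.vertex x]) →
        PathFrom par none (A ++ .edge e :: B) → ∃ b ∈ B, par b = some (.edge e) := by
      rintro B x ⟨T, hT⟩ hp
      rcases B with _ | ⟨b, B⟩
      · obtain ⟨-, hb⟩ := List.append_inj' hT rfl
        cases hb
      · exact ⟨b, by simp, (PathFrom.append.1 hp).2.1⟩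
    obtain ⟨b, hb, hpb⟩ := hne hF.left_end hF.left
    obtain ⟨d, hd, hpd⟩ := hne hF.right_end hF.right
    have hbd : b ≠ d := by
      rintro rfl
      exact hF.disjoint b hd (by simp [hb])
    obtain ⟨he, hb'⟩ := kAdj_edge_iff.1 ((hS.adj (.edge e) b).1 (Or.inr hpb))
    obtain ⟨-, hd'⟩ := kAdj_edge_iff.1 ((hS.adj (.edge e) d).1 (Or.inr hpd))
    rcases hp : par (.edge e) with _ | p
    · exact hS.root e he hp
    · obtain ⟨-, hp'⟩ := kAdj_edge_iff.1 ((hS.adj (.edge e) p).1 (Or.inl hp))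
      have hcase : p = b ∨ p = d := by
        rcases hb' with rfl | rfl <;> rcases hd' with rfl | rfl <;> tauto
      rcases hcase with rfl | rfl
      · exact hF.left.not_two_cycle (by simp) hp hpb
      · exact hF.right.not_two_cycle (by simp) hp hpd

/-- A path connects its members by its own edges. -/
theorem path_kAdj (hS : Stored S K par deg) {l : List (Key V)} {p : Key V}
    {T : Set (StreamEdge V)} (hl : PathFrom par (some p) l)
    (hp : ∀ e ∈ S, p = .edge e → e ∈ T) (hT : ∀ e ∈ S, .edge e ∈ l → e ∈ T) {z : Key V}
    (hz : z ∈ p :: l) : Relation.ReflTransGen (KAdj T) p z := by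
  induction l generalizing p with
  | nil =>
    rw [List.mem_singleton] at hz
    subst hz
    exact .refl
  | cons b l ih =>
    rcases List.mem_cons.1 hz with rfl | hz
    · exact .refl
    · obtain ⟨e, he, h⟩ := (hS.adj p b).1 (Or.inr hl.1)
      have heT : e ∈ T := by
        rcases h with ⟨h, -⟩ | ⟨h, -⟩
        · exact hp e he h
        · exact hT e he (by rw [h]; simp)
      exact .head ⟨e, heT, h⟩ (ih hl.2 (fun e he h => hT e he (by rw [h]; simp))
        (fun e he h => hT e he (by simp [h])) hz)

theorem mem_of_end {A B T : List (Key V)} {a x : Key V} (h : A ++ a :: B = T ++ [x]) :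
    x ∈ a :: B := by
  rcases List.eq_nil_or_concat B with rfl | ⟨B', b, rfl⟩
  · obtain ⟨-, hb⟩ := List.append_inj' h rfl
    cases hb
    simp
  · rw [List.concat_eq_append, ← List.cons_append, ← List.append_assoc] at h
    obtain ⟨-, hb⟩ := List.append_inj' h rfl
    cases hb
    simp

theorem linked_of_path (hS : Stored S K par deg) {z x : V} {T : Set (StreamEdge V)}
    (hp : PathFrom par none (A ++ .vertex z :: B)) (he : ∃ T, A ++ .vertex z :: B = T ++ [.vertex x])
    (hT : ∀ e ∈ S, .edge e ∈ B → e ∈ T) : Linked T z x := by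
  obtain ⟨T', hT'⟩ := he
  exact linked_of_kAdj (hS.path_kAdj (PathFrom.append.1 hp).2 (fun e _ h => by cases h) hT
    (mem_of_end hT'))

/-- An edge `m` on the path from `z` down to `x` splits it into a path from `z` to one end point of
`m` and a path from the other end point to `x`. -/
theorem linked_split (hS : Stored S K par deg) {z x : V} {m : StreamEdge V}
    {T : Set (StreamEdge V)} (hp : PathFrom par none (A ++ .vertex z :: B))
    (he : ∃ T, A ++ .vertex z :: B = T ++ [.vertex x]) (hm : .edge m ∈ B)
    (hT : ∀ e ∈ S, .edge e ∈ B → e ≠ m → e ∈ T) :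
    Linked T z m.u ∧ Linked T m.v x ∨ Linked T z m.v ∧ Linked T m.u x := by
  obtain ⟨X, Y, rfl⟩ := List.append_of_mem hm
  obtain ⟨T', hT'⟩ := he
  have hnd : (X ++ Key.edge m :: Y).Nodup :=
    (List.nodup_cons.1 (List.Nodup.of_append_right hp.nodup)).2
  have hXY : Key.edge m ∉ X ∧ Key.edge m ∉ Y := by
    rw [List.nodup_append] at hnd
    exact ⟨fun h => hnd.2.2 _ h _ (by simp) rfl, (List.nodup_cons.1 hnd.2.1).1⟩
  have hpB := (PathFrom.append.1 hp).2
  have hpX := PathFrom.append.1 hpB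
  -- the predecessor of `m`
  obtain ⟨p, hpm, hpz⟩ : ∃ p, par (.edge m) = some p ∧
      Relation.ReflTransGen (KAdj T) (.vertex z) p := by
    rcases List.eq_nil_or_concat X with rfl | ⟨X', b, rfl⟩
    · exact ⟨_, hpX.1.1, .refl⟩
    · have h1 := hpX.1
      rw [List.concat_eq_append, List.append_assoc, List.singleton_append, PathFrom.append] at h1
      refine ⟨b, h1.2.1, hS.path_kAdj h1.1 (fun e _ h => by cases h) (fun e heS h => ?_) (by simp)⟩
      rw [List.concat_eq_append] at hXY hT
      refine hT e heS (List.mem_append_left _ h) ?_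
      rintro rfl
      exact hXY.1 h
  -- the successor of `m`
  obtain ⟨q, hqm, hqx⟩ : ∃ q, par q = some (.edge m) ∧
      ((∃ w, q = .vertex w) → Relation.ReflTransGen (KAdj T) q (.vertex x)) := by
    rcases Y with _ | ⟨q, Y⟩
    · have : A ++ Key.vertex z :: (X ++ [Key.edge m]) =
          (A ++ Key.vertex z :: X) ++ [Key.edge m] := by simp
      rw [this] at hT'
      obtain ⟨-, hb⟩ := List.append_inj' hT' rfl
      cases hb
    · refine ⟨q, hpX.2.1, ?_⟩
      rintro ⟨w, rfl⟩
      have : A ++ Key.vertex z :: (X ++ Key.edge m :: Key.vertex w :: Y) =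
          (A ++ Key.vertex z :: (X ++ [Key.edge m])) ++ Key.vertex w :: Y := by simp
      rw [this] at hT'
      refine hS.path_kAdj hpX.2.2 (fun e _ h => by cases h) (fun e heS h => ?_) (mem_of_end hT')
      refine hT e heS (by simp [h]) ?_
      rintro rfl
      exact hXY.2 (by simp [h])
  obtain ⟨-, hpv⟩ := kAdj_edge_iff.1 ((hS.adj (.edge m) p).1 (Or.inl hpm))
  obtain ⟨-, hqv⟩ := kAdj_edge_iff.1 ((hS.adj (.edge m) q).1 (Or.inr hqm))
  have hpq : p ≠ q := by
    rintro rfl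
    exact hp.not_two_cycle (by simp) hpm hqm
  rcases hpv with rfl | rfl <;> rcases hqv with rfl | rfl
  · exact absurd rfl hpq
  · exact Or.inl ⟨linked_of_kAdj hpz, linked_of_kAdj (hqx ⟨_, rfl⟩)⟩
  · exact Or.inr ⟨linked_of_kAdj hpz, linked_of_kAdj (hqx ⟨_, rfl⟩)⟩
  · exact absurd rfl hpq

/-- Without an edge `m` of the cycle that is closed by `e`, its end points remain connected. -/
theorem linked_exchange (hS : Stored S K par deg) {e m : StreamEdge V}
    {T : Set (StreamEdge V)} (hF : Fork par A a B E (.vertex e.u) (.vertex e.v))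
    (hm : .edge m ∈ B ++ E) (he : e ∈ T) (hT : ∀ e ∈ S, .edge e ∈ B ++ E → e ≠ m → e ∈ T) :
    Linked T m.u m.v := by
  obtain ⟨z, rfl⟩ := hS.fork_vertex hF
  have hTB : ∀ e ∈ S, .edge e ∈ B → e ≠ m → e ∈ T := fun e he h => hT e he (by simp [h])
  have hTE : ∀ e ∈ S, .edge e ∈ E → e ≠ m → e ∈ T := fun e he h => hT e he (by simp [h])
  have hdis : Key.edge m ∈ B → Key.edge m ∉ E := fun h h' => hF.disjoint _ h' (by simp [h])
  have hev := linked_edge he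
  rcases List.mem_append.1 hm with hm | hm
  · have h1 := hS.linked_of_path hF.right hF.right_end
      (fun e he h => hTE e he h (by rintro rfl; exact hdis hm h))
    have h2 : Linked T z e.u := h1.trans hev.symm
    rcases hS.linked_split hF.left hF.left_end hm hTB with ⟨h3, h4⟩ | ⟨h3, h4⟩
    · exact (h3.symm.trans h2).trans h4.symm
    · exact (h4.trans h2.symm).trans h3
  · have h1 := hS.linked_of_path hF.left hF.left_end
      (fun e he h => hTB e he h (by rintro rfl; exact hdis h hm))
    have h2 : Linked T z e.v := h1.trans hev
    rcases hS.linked_split hF.right hF.right_end hm hTE with ⟨h3, h4⟩ | ⟨h3, h4⟩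
    · exact (h3.symm.trans h2).trans h4.symm
    · exact (h4.trans h2.symm).trans h3

end Stored

/-! ### Insertion and deletion of tree edges -/

theorem parAdj_update_some {par : Key V → Option (Key V)} {x y a b : Key V} (hx : par x = none) :
    ParAdj (Function.update par x (some y)) a b ↔
      ParAdj par a b ∨ a = x ∧ b = y ∨ b = x ∧ a = y := by
  have key : ∀ a b : Key V, Function.update par x (some y) a = some b ↔
      par a = some b ∨ a = x ∧ b = y := by
    intro a b
    by_cases h : a = x
    · subst h; simp [hx, eq_comm]
    · simp [h]
  rw [ParAdj, key, key, ParAdj]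
  tauto

theorem kAdj_insert {S : Finset (StreamEdge V)} {e : StreamEdge V} {a b : Key V} :
    KAdj (↑(Insert.insert e S) : Set (StreamEdge V)) a b ↔ KAdj (↑S) a b ∨
      a = .edge e ∧ (b = .vertex e.u ∨ b = .vertex e.v) ∨
      b = .edge e ∧ (a = .vertex e.u ∨ a = .vertex e.v) := by
  unfold KAdj
  simp only [Finset.coe_insert, Set.mem_insert_iff]
  constructor
  · rintro ⟨e', rfl | he, h⟩
    · exact Or.inr h
    · exact Or.inl ⟨e', he, h⟩
  · rintro (⟨e', he, h⟩ | h)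
    · exact ⟨e', Or.inr he, h⟩
    · exact ⟨e, Or.inl rfl, h⟩

/-- A vertex without edges is isolated. -/
theorem isolated_of_kAdj {S : Finset (StreamEdge V)} {par : Key V → Option (Key V)}
    (hadj : ∀ a b, ParAdj par a b ↔ KAdj (↑S) a b) {x : V}
    (hx : (S.filter fun e => e.u = x ∨ e.v = x).card = 0) :
    par (.vertex x) = none ∧ ∀ y, par y ≠ some (.vertex x) := by
  have key : ∀ y, ¬ParAdj par (.vertex x) y := by
    intro y hy
    obtain ⟨e, he, -, h⟩ := kAdj_vertex_iff.1 ((hadj _ _).1 hy)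
    rw [Finset.card_eq_zero, Finset.filter_eq_empty_iff] at hx
    exact hx he h
  refine ⟨?_, fun y hy => key y (Or.inr hy)⟩
  rcases hp : par (.vertex x) with _ | y
  · rfl
  · exact absurd (Or.inl hp) (key y)

namespace Inv

variable {K : Finset (Key V)} {par : Key V → Option (Key V)} {deg sz : Key V → ℕ}
  {seq : Key V → List (Key V)} {f : Key V → Record V}

theorem congr_degree (h : Inv K par deg sz seq f) {deg' : Key V → ℕ}
    (hd : ∀ k ∈ K, deg' k = deg k) : Inv K par deg' sz seq f :=
  { h with degree := fun k hk => (h.degree k hk).trans (hd k hk).symm }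

theorem exec_acquire (h : Inv K par deg sz seq f) {x : V}
    (hx : .vertex x ∉ K → par (.vertex x) = none ∧ deg (.vertex x) = 0) :
    ∃ f' sz' seq', Exec (acquire x) K f () (Insert.insert (.vertex x) K) f' 3 ∧
      Inv (Insert.insert (.vertex x) K) par
        (Function.update deg (.vertex x) (deg (.vertex x) + 1)) sz' seq' f' ∧
      potential (Insert.insert (.vertex x) K) sz' = potential K sz := by
  by_cases hK : Key.vertex x ∈ K
  · rw [Finset.insert_eq_self.2 hK]
    refine ⟨_, sz, seq, ?_, h.setDegree (x := .vertex x) (deg (.vertex x) + 1), rfl⟩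
    unfold acquire
    refine Exec.bind_le (exec_isStored _) (M := 2) ?_ le_rfl
    rw [if_pos (by simpa using hK), ← h.degree _ hK]
    exact exec_modifyAt hK _
  · obtain ⟨hp, hd⟩ := hx hK
    rw [hd]
    have h' := (h.congr_degree (deg' := Function.update deg (.vertex x) (0 + 1)) fun k hk => by
      rw [Function.update_of_ne]
      rintro rfl
      exact hK hk).addKey hK hp (r := { degree := 1 }) rfl rfl rfl rfl rfl (by simp)
    refine ⟨_, _, _, ?_, h', potential_addKey hK sz⟩
    unfold acquire
    refine Exec.bind_le (exec_isStored _) (M := 2) ?_ le_rfl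
    rw [if_neg (by simpa using hK)]
    exact (exec_writeAt _ _).mono (by omega)

theorem exec_release (h : Inv K par deg sz seq f) {x : V} (hx : .vertex x ∈ K)
    (hiso : deg (.vertex x) ≤ 1 →
      par (.vertex x) = none ∧ ∀ y, par y ≠ some (.vertex x)) :
    ∃ K' f', Exec (release x) K f () K' f' 2 ∧
      (∀ k, k ∈ K' ↔ k ∈ K ∧ (k = .vertex x → 1 < deg (.vertex x))) ∧
      Inv K' par (Function.update deg (.vertex x) (deg (.vertex x) - 1)) sz seq f' ∧
      potential K' sz = potential K sz := by
  by_cases hd : deg (.vertex x) ≤ 1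
  · obtain ⟨hp, hc⟩ := hiso hd
    obtain ⟨h', hpot⟩ := h.removeKey hx hp hc
    refine ⟨K.erase (.vertex x), f, ?_, fun k => ?_, h'.congr_degree fun k hk => ?_, hpot⟩
    · unfold release
      refine Exec.bind_le (exec_readAt hx) (M := 1) ?_ le_rfl
      rw [if_pos (by rwa [h.degree _ hx])]
      exact exec_freeAt _
    · rw [Finset.mem_erase]
      constructor
      · rintro ⟨h1, h2⟩
        exact ⟨h2, fun h3 => absurd h3 h1⟩
      · rintro ⟨h1, h2⟩
        refine ⟨fun h3 => ?_, h1⟩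
        have := h2 h3
        omega
    · rw [Function.update_of_ne (Finset.ne_of_mem_erase hk)]
  · refine ⟨K, _, ?_, fun k => ?_, h.setDegree (x := .vertex x) (deg (.vertex x) - 1), rfl⟩
    · unfold release
      refine Exec.bind_le (exec_readAt hx) (M := 1) ?_ le_rfl
      rw [if_neg (by rwa [h.degree _ hx]), ← h.degree _ hx]
      exact exec_writeAt_of_mem hx _
    · exact ⟨fun h => ⟨h, fun _ => by omega⟩, And.left⟩

end Inv

namespace Stored

variable {S : Finset (StreamEdge V)} {K : Finset (Key V)} {par : Key V → Option (Key V)}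
  {deg sz : Key V → ℕ} {seq : Key V → List (Key V)} {f : Key V → Record V} {e : StreamEdge V}

theorem exec_deleteTreeEdge (hS : Stored S K par deg) (h : Inv K par deg sz seq f) (he : e ∈ S) :
    ∃ K' par' deg' f' sz' seq' N, Exec (deleteTreeEdge e) K f () K' f' N ∧ K' ⊆ K ∧
      Stored (S.erase e) K' par' deg' ∧ Inv K' par' deg' sz' seq' f' ∧
      N + 157 * potential K' sz' ≤ 157 * potential K sz + 3040 * (Real.logb 2 K.card + 1) := by
  have hlog := logb_nonneg K.card
  have huv := hS.noloop e he
  have hkK := (hS.mem_edge e).2 he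
  have huK : Key.vertex e.u ∈ K := hS.vertex_mem_iff.2 ⟨e, he, Or.inl rfl⟩
  have hvK : Key.vertex e.v ∈ K := hS.vertex_mem_iff.2 ⟨e, he, Or.inr rfl⟩
  obtain ⟨par₁, f₁, sz₁, seq₁, N₁, hE₁, h₁, hR, hN₁, -⟩ := h.exec_reRoot hkK
  obtain ⟨f₂, sz₂, seq₂, N₂, hE₂, h₂, hN₂⟩ := h₁.exec_cut huK
  obtain ⟨f₃, sz₃, seq₃, N₃, hE₃, h₃, hN₃⟩ := h₂.exec_cut hvK
  set p : Key V → Option (Key V) :=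
    Function.update (Function.update par₁ (.vertex e.u) none) (.vertex e.v) none with hp
  have hpar : ∀ a b, p a = some b ↔ par₁ a = some b ∧ a ≠ .vertex e.u ∧ a ≠ .vertex e.v := by
    intro a b
    rw [hp]
    by_cases hv : a = .vertex e.v
    · subst hv; simp
    · by_cases hu : a = .vertex e.u
      · subst hu; simp [hv]
      · simp [hu, hv]
  have hadj₁ : ∀ a b, ParAdj par₁ a b ↔ KAdj (↑S) a b := fun a b => (hR.adj a b).trans (hS.adj a b)
  -- the record of `e` is the root, so that the edges to be cut are those from its end points
  have hadj : ∀ a b, ParAdj p a b ↔ KAdj (↑(S.erase e)) a b := by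
    have half : ∀ a b, p a = some b → KAdj (↑(S.erase e)) a b := by
      intro a b hab
      obtain ⟨h1, h2, h3⟩ := (hpar a b).1 hab
      obtain ⟨d, hd, h4⟩ := (hadj₁ a b).1 (Or.inl h1)
      refine ⟨d, ?_, h4⟩
      rw [Finset.coe_erase]
      refine ⟨hd, ?_⟩
      rintro rfl
      rcases h4 with ⟨rfl, -⟩ | ⟨rfl, h4 | h4⟩
      · rw [hR.root] at h1; cases h1
      · exact h2 h4
      · exact h3 h4
    have half' : ∀ a b, KAdj (↑(S.erase e)) a b → par₁ a = some b → p a = some b := by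
      intro a b hab h1
      refine (hpar a b).2 ⟨h1, ?_⟩
      have hb : b ≠ .edge e := by
        rintro rfl
        have := (kAdj_edge_iff.1 hab.symm).1
        simp at this
      have hk : ∀ w, (w = e.u ∨ w = e.v) → a ≠ .vertex w := by
        rintro w hw rfl
        have h2 : ParAdj par₁ (.edge e) (.vertex w) :=
          (hadj₁ _ _).2 (kAdj_edge_iff.2 ⟨he, by rcases hw with rfl | rfl <;> simp⟩)
        rcases h2 with h2 | h2
        · rw [hR.root] at h2; cases h2
        · rw [h1] at h2
          exact hb (Option.some_injective _ h2)
      exact ⟨hk _ (Or.inl rfl), hk _ (Or.inr rfl)⟩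
    intro a b
    constructor
    · rintro (h1 | h1)
      · exact half a b h1
      · exact (half b a h1).symm
    · intro hab
      have hS' : KAdj (↑S) a b := by
        obtain ⟨d, hd, h4⟩ := hab
        exact ⟨d, Finset.erase_subset _ _ hd, h4⟩
      rcases (hadj₁ a b).2 hS' with h1 | h1
      · exact Or.inl (half' a b hab h1)
      · exact Or.inr (half' b a hab.symm h1)
  have hfilter : ∀ x, ((S.erase e).filter fun d => d.u = x ∨ d.v = x).card =
      if e.u = x ∨ e.v = x then (S.filter fun d => d.u = x ∨ d.v = x).card - 1
      else (S.filter fun d => d.u = x ∨ d.v = x).card := by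
    intro x
    rw [Finset.filter_erase]
    split_ifs with hx
    · exact Finset.card_erase_of_mem (Finset.mem_filter.2 ⟨he, hx⟩)
    · exact congrArg _ (Finset.erase_eq_of_notMem fun hm => hx (Finset.mem_filter.1 hm).2)
  have hk : p (.edge e) = none ∧ ∀ y, p y ≠ some (.edge e) := by
    have key : ∀ y, ¬ParAdj p (.edge e) y := by
      intro y hy
      have := (kAdj_edge_iff.1 ((hadj _ _).1 hy)).1
      simp at this
    refine ⟨?_, fun y hy => key y (Or.inr hy)⟩
    rcases hq : p (.edge e) with _ | y
    · rfl
    · exact absurd (Or.inl hq) (key y)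
  obtain ⟨h₄, hpot₄⟩ := h₃.removeKey hkK hk.1 hk.2
  have hiso : ∀ x, (e.u = x ∨ e.v = x) → deg (.vertex x) ≤ 1 →
      p (.vertex x) = none ∧ ∀ y, p y ≠ some (.vertex x) := by
    intro x hx hd
    refine isolated_of_kAdj hadj ?_
    rw [hfilter, if_pos hx, ← hS.degree]
    omega
  obtain ⟨K₅, f₅, hE₅, hK₅, h₅, hpot₅⟩ := h₄.exec_release (x := e.u) (by simp [huK])
    (hiso _ (Or.inl rfl))
  have hdv : Function.update deg (Key.vertex e.u) (deg (.vertex e.u) - 1) (.vertex e.v) =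
      deg (.vertex e.v) := by
    rw [Function.update_of_ne]
    simpa using huv.symm
  obtain ⟨K₆, f₆, hE₆, hK₆, h₆, hpot₆⟩ := h₅.exec_release (x := e.v)
    ((hK₅ _).2 ⟨by simp [hvK], fun hc => absurd hc (by simpa using huv.symm)⟩)
    (by rw [hdv]; exact hiso _ (Or.inr rfl))
  rw [hdv] at hK₆ h₆
  refine ⟨K₆, p, _, f₆, sz₃, seq₃, N₁ + (N₂ + (N₃ + (1 + (2 + 2)))), ?_, fun k hk => ?_, ?_, h₆,
    ?_⟩
  · unfold deleteTreeEdge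
    refine Exec.bind_le hE₁ (M := N₂ + (N₃ + (1 + (2 + 2)))) ?_ le_rfl
    refine Exec.bind_le hE₂ (M := N₃ + (1 + (2 + 2))) ?_ le_rfl
    refine Exec.bind_le hE₃ (M := 1 + (2 + 2)) ?_ le_rfl
    refine Exec.bind_le (exec_freeAt _) (M := 2 + 2) ?_ le_rfl
    exact Exec.bind_le hE₅ hE₆ le_rfl
  · exact Finset.mem_of_mem_erase ((hK₅ k).1 ((hK₆ k).1 hk).1).1
  · refine ⟨hadj, fun d hd => hS.noloop d (Finset.mem_of_mem_erase hd), fun d => ?_, fun x => ?_,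
      fun x => ?_, fun d hd hn => ?_⟩
    · rw [hK₆, hK₅, Finset.mem_erase, Finset.mem_erase, hS.mem_edge]
      simp
    · rw [hK₆, hK₅, Finset.mem_erase, hS.mem_vertex]
      by_cases hxv : x = e.v
      · subst hxv
        simp only [Function.update_self, ne_eq, reduceCtorEq, not_false_eq_true, true_and,
          Key.vertex.injEq, huv.symm, false_imp_iff, and_true, true_imp_iff]
        omega
      · by_cases hxu : x = e.u
        · subst hxu
          simp only [ne_eq, reduceCtorEq, not_false_eq_true, true_and, Key.vertex.injEq, huv,
            false_imp_iff, and_true, true_imp_iff, Function.update_of_ne, Function.update_self]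
          omega
        · simp [hxu, hxv]
    · rw [hfilter, ← hS.degree]
      by_cases hxv : x = e.v
      · subst hxv; simp
      · by_cases hxu : x = e.u
        · subst hxu; simp [huv]
        · simp [hxu, hxv, Ne.symm hxu, Ne.symm hxv]
    · have hd' := Finset.mem_erase.1 hd
      simp only [hp, ne_eq, reduceCtorEq, not_false_eq_true, Function.update_of_ne] at hn
      rcases hR.root_or _ hn with hc | hc
      · cases hc; exact hd'.1 rfl
      · exact hS.root d hd'.2 hc
  · push_cast
    linarith

theorem exec_insertTreeEdge (hS : Stored S K par deg) (h : Inv K par deg sz seq f)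
    (huv : e.u ≠ e.v) (hl : ¬Linked (↑S) e.u e.v) :
    ∃ K' par' deg' f' sz' seq' N, Exec (insertTreeEdge e) K f () K' f' N ∧
      Stored (Insert.insert e S) K' par' deg' ∧ Inv K' par' deg' sz' seq' f' ∧
      N + 157 * potential K' sz' ≤
        157 * potential K sz + 4410 * (Real.logb 2 (K.card + 3 : ℕ) + 1) := by
  have he : e ∉ S := fun he => hl (linked_edge he)
  have hk := hS.par_ne (x := .edge e) (fun hc => he ((hS.mem_edge e).1 hc))
  have hvu : e.v ≠ e.u := huv.symm
  have hdeg : ∀ x, Key.vertex x ∉ K → par (.vertex x) = none ∧ deg (.vertex x) = 0 := fun x hx =>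
    ⟨(hS.par_ne hx).1, by rw [hS.mem_vertex] at hx; omega⟩
  obtain ⟨f₁, sz₁, seq₁, hE₁, h₁, hpot₁⟩ := h.exec_acquire (x := e.u) (hdeg _)
  have hdv : Function.update deg (Key.vertex e.u) (deg (.vertex e.u) + 1) (.vertex e.v) =
      deg (.vertex e.v) := by
    rw [Function.update_of_ne]
    simpa using hvu
  obtain ⟨f₂, sz₂, seq₂, hE₂, h₂, hpot₂⟩ := h₁.exec_acquire (x := e.v) (fun hc => by
    rw [hdv]
    exact hdeg _ fun hc' => hc (Finset.mem_insert_of_mem hc'))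
  rw [hdv] at h₂
  set K₂ : Finset (Key V) := Insert.insert (.vertex e.v) (Insert.insert (.vertex e.u) K) with hK₂
  have hkK₂ : Key.edge e ∉ K₂ := by
    simpa [hK₂] using fun hc => he ((hS.mem_edge e).1 hc)
  set D : Key V → ℕ := Function.update (Function.update (Function.update deg (.vertex e.u)
    (deg (.vertex e.u) + 1)) (.vertex e.v) (deg (.vertex e.v) + 1)) (.edge e) 0 with hD
  have h₃ := (h₂.congr_degree (deg' := D) fun k hk => by
    rw [hD, Function.update_of_ne]
    rintro rfl
    exact hkK₂ hk).addKey hkK₂ hk.1 (r := { oldest := some e }) rfl rfl rfl rfl rfl (by simp [hD])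
  have hpot₃ := Inv.potential_addKey hkK₂ sz₂
  set K₃ : Finset (Key V) := Insert.insert (.edge e) K₂ with hK₃
  have huK : Key.vertex e.u ∈ K₃ := by simp [hK₃, hK₂]
  have hvK : Key.vertex e.v ∈ K₃ := by simp [hK₃, hK₂]
  have hkK : Key.edge e ∈ K₃ := by simp [hK₃]
  have hcard : K₃.card ≤ K.card + 3 :=
    (Finset.card_insert_le _ _).trans (Nat.succ_le_succ ((Finset.card_insert_le _ _).trans
      (Nat.succ_le_succ (Finset.card_insert_le _ _))))
  have hkS : ∀ b, ¬KAdj (↑S) (.edge e) b := fun b hb => he (kAdj_edge_iff.1 hb).1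
  have hc₁ : ¬Conn par (.vertex e.u) (.edge e) := by
    intro hc
    rcases Relation.ReflTransGen.cases_head hc.symm with hc | ⟨b, hb, -⟩
    · cases hc
    · exact hkS b ((hS.adj _ _).1 hb)
  obtain ⟨par₄, f₄, sz₄, seq₄, N₄, hE₄, hR₄, h₄, hN₄⟩ := h₃.exec_link huK hkK hc₁
  set q : Key V → Option (Key V) := Function.update par₄ (.vertex e.u) (some (.edge e)) with hq
  have hadjq : ∀ a b, ParAdj q a b ↔ KAdj (↑S) a b ∨ a = .vertex e.u ∧ b = .edge e ∨
      b = .vertex e.u ∧ a = .edge e := fun a b => by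
    rw [hq, parAdj_update_some hR₄.root, hR₄.adj, hS.adj]
  have hc₂ : ¬Conn q (.edge e) (.vertex e.v) := by
    intro hc
    have key : ∀ z, Conn q (.edge e) z → z = .edge e ∨ Conn par (.vertex e.u) z := by
      intro z hz
      induction hz with
      | refl => exact Or.inl rfl
      | @tail y z _ hyz ih =>
        rcases (hadjq y z).1 hyz with h1 | ⟨-, h1⟩ | ⟨rfl, -⟩
        · rcases ih with rfl | ih
          · exact absurd h1 (hkS z)
          · exact Or.inr (ih.tail ((hS.adj _ _).2 h1))
        · exact Or.inl h1
        · exact Or.inr .refl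
    rcases key _ hc with h1 | h1
    · cases h1
    · exact hl (hS.conn_iff.1 h1)
  obtain ⟨par₅, f₅, sz₅, seq₅, N₅, hE₅, hR₅, h₅, hN₅⟩ := h₄.exec_link hkK hvK hc₂
  refine ⟨K₃, _, D, f₅, sz₅, seq₅, 3 + (3 + (1 + (N₄ + N₅))), ?_, ⟨fun a b => ?_, ?_, fun d => ?_,
    fun x => ?_, fun x => ?_, fun d hd hn => ?_⟩, h₅, ?_⟩
  · unfold insertTreeEdge
    refine Exec.bind_le hE₁ (M := 3 + (1 + (N₄ + N₅))) ?_ le_rfl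
    refine Exec.bind_le hE₂ (M := 1 + (N₄ + N₅)) ?_ le_rfl
    refine Exec.bind_le (exec_writeAt _ _) (M := N₄ + N₅) ?_ le_rfl
    exact Exec.bind_le hE₄ hE₅ le_rfl
  · rw [parAdj_update_some hR₅.root, hR₅.adj, hadjq, kAdj_insert]
    tauto
  · intro d hd
    rcases Finset.mem_insert.1 hd with rfl | hd
    · exact huv
    · exact hS.noloop d hd
  · rw [hK₃, hK₂, Finset.mem_insert, Finset.mem_insert, Finset.mem_insert, Finset.mem_insert,
      hS.mem_edge]
    simp
  · rw [hK₃, hK₂, Finset.mem_insert, Finset.mem_insert, Finset.mem_insert, hS.mem_vertex]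
    by_cases hxv : x = e.v
    · subst hxv; simp [hD]
    · by_cases hxu : x = e.u
      · subst hxu; simp [hD, hxv]
      · simp [hD, hxu, hxv]
  · have hef : e ∉ S.filter fun d => d.u = x ∨ d.v = x := fun hm => he (Finset.mem_filter.1 hm).1
    rw [Finset.filter_insert]
    by_cases hxv : x = e.v
    · subst hxv
      rw [if_pos (Or.inr rfl), Finset.card_insert_of_notMem hef, ← hS.degree]
      simp [hD]
    · by_cases hxu : x = e.u
      · subst hxu
        rw [if_pos (Or.inl rfl), Finset.card_insert_of_notMem hef, ← hS.degree]
        simp [hD, hxv]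
      · rw [if_neg (by rintro (rfl | rfl) <;> contradiction), ← hS.degree]
        simp [hD, hxu, hxv]
  · by_cases hde : d = e
    · subst hde
      simp at hn
    · rw [Function.update_of_ne (by simpa using hde)] at hn
      rcases hR₅.root_or _ hn with hc | hc
      · cases hc; exact hde rfl
      · rw [hq, Function.update_of_ne (by simp)] at hc
        rcases hR₄.root_or _ hc with hc | hc
        · cases hc
        · exact hS.root d ((Finset.mem_insert.1 hd).resolve_left hde) hc
  · have hmono := logb_mono (Finset.card_pos.2 ⟨_, hkK⟩) hcard
    have hlog := logb_nonneg (K.card + 3)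
    push_cast at *
    linarith

end Stored

/-! ### Maximum spanning forests -/

/-- Each edge in `A` closes a cycle with edges in `S` that are not older: `S` contains a maximum
spanning forest of `A ∪ S`. Hence the removal of the oldest edges of `S` keeps the edges in `A`
that are younger connected. -/
def Covers (S A : Set (StreamEdge V)) : Prop :=
  ∀ a ∈ A, Linked {d | d ∈ S ∧ a.t ≤ d.t} a.u a.v

theorem Covers.linked_iff {S A G : Set (StreamEdge V)} (h : Covers S A) (hS : S ⊆ G) (hA : G ⊆ A)
    {x y : V} : Linked S x y ↔ Linked G x y :=
  ⟨fun hl => hl.mono hS,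
    fun hl => hl.of_forall fun a ha => (h a (hA ha)).mono fun _ hd => hd.1⟩

theorem Covers.erase {S A : Set (StreamEdge V)} (h : Covers S A) (e : StreamEdge V) :
    Covers (S \ {e}) {a | a ∈ A ∧ e.t < a.t} := fun a ha =>
  (h a ha.1).mono fun d hd => ⟨⟨hd.1, fun hde => absurd hd.2 (by
    rw [Set.mem_singleton_iff] at hde
    rw [hde]
    exact not_le.2 ha.2)⟩, hd.2⟩

theorem Covers.insert {S A S' : Set (StreamEdge V)} {e : StreamEdge V} (h : Covers S A)
    (hS : ∀ a ∈ A, ∀ d ∈ S, a.t ≤ d.t → Linked {d | d ∈ S' ∧ a.t ≤ d.t} d.u d.v)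
    (he : Linked {d | d ∈ S' ∧ e.t ≤ d.t} e.u e.v) : Covers S' (Insert.insert e A) := by
  rintro a (rfl | ha)
  · exact he
  · exact (h a ha).of_forall fun d hd => hS a ha d hd.1 hd.2

theorem Covers.insert_of_subset {S A S' : Set (StreamEdge V)} {e : StreamEdge V} (h : Covers S A)
    (hS : S ⊆ S') (he : Linked {d | d ∈ S' ∧ e.t ≤ d.t} e.u e.v) :
    Covers S' (Insert.insert e A) :=
  h.insert (fun _ _ _ hd hda => linked_edge (S := {d | d ∈ S' ∧ _}) ⟨hS hd, hda⟩) he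

namespace Stored

variable {S : Finset (StreamEdge V)} {K : Finset (Key V)} {par : Key V → Option (Key V)}
  {deg sz : Key V → ℕ} {seq : Key V → List (Key V)} {f : Key V → Record V} {e m : StreamEdge V}
  {A B E : List (Key V)} {a : Key V} {u v : V}

theorem linked_of_fork (hS : Stored S K par deg) (hF : Fork par A a B E (.vertex u) (.vertex v))
    {T : Set (StreamEdge V)} (hT : ∀ e ∈ S, .edge e ∈ B ++ E → e ∈ T) : Linked T u v := by
  obtain ⟨z, rfl⟩ := hS.fork_vertex hF
  exact (hS.linked_of_path hF.left hF.left_end fun e he h => hT e he (by simp [h])).symm.trans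
    (hS.linked_of_path hF.right hF.right_end fun e he h => hT e he (by simp [h]))

theorem mem_of_fork (hS : Stored S K par deg) (hF : Fork par A a B E (.vertex u) (.vertex v))
    (hm : .edge m ∈ B ++ E) : m ∈ S := by
  obtain ⟨z, rfl⟩ := hS.fork_vertex hF
  have key : ∀ {B}, PathFrom par none (A ++ .vertex z :: B) → .edge m ∈ B → m ∈ S := by
    intro B hp hmB
    have := hS.path_kAdj (T := ↑S) (PathFrom.append.1 hp).2 (fun e he _ => he) (fun e he _ => he)
      (List.mem_cons_of_mem _ hmB)
    rcases Relation.ReflTransGen.cases_tail this with h | ⟨b, -, hb⟩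
    · cases h
    · exact (kAdj_edge_iff.1 hb.symm).1
  rcases List.mem_append.1 hm with h | h
  · exact key hF.left h
  · exact key hF.right h

/-- Without an edge `m`, the descendants of `m` are separated from the other vertices. -/
theorem not_linked_erase (hS : Stored S K par deg) {T T' : List (Key V)}
    (hp : PathFrom par none (T ++ [.vertex u])) (hm : .edge m ∈ T)
    (hp' : PathFrom par none (T' ++ [.vertex v])) (hm' : .edge m ∉ T') :
    ¬Linked (↑(S.erase m)) u v := by
  intro hl
  have key : ∀ k, Relation.ReflTransGen (KAdj (↑(S.erase m))) (.vertex u) k →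
      ∃ T, PathFrom par none (T ++ [k]) ∧ .edge m ∈ T := by
    intro k hk
    induction hk with
    | refl => exact ⟨T, hp, hm⟩
    | @tail b c _ hbc ih =>
      obtain ⟨T, hT, hmT⟩ := ih
      have hc : c ≠ .edge m := by
        rintro rfl
        have := (kAdj_edge_iff.1 hbc.symm).1
        simp at this
      have hbc' : KAdj (↑S) b c := by
        obtain ⟨d, hd, h⟩ := hbc
        exact ⟨d, Finset.erase_subset _ _ hd, h⟩
      rcases (hS.adj b c).2 hbc' with h | h
      · rcases List.eq_nil_or_concat T with rfl | ⟨T, d, rfl⟩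
        · cases hmT
        · rw [List.concat_eq_append] at hT hmT
          rw [List.append_assoc, List.singleton_append, PathFrom.append] at hT
          rw [hT.2.1] at h
          cases h
          refine ⟨T, hT.1, ?_⟩
          rcases List.mem_append.1 hmT with h | h
          · exact h
          · exact absurd (List.mem_singleton.1 h).symm hc
      · refine ⟨T ++ [b], ?_, by simp [hmT]⟩
        rw [List.append_assoc, List.singleton_append, PathFrom.append]
        exact ⟨hT, h, trivial⟩
  obtain ⟨T₁, h₁, hm₁⟩ := key _ (kAdj_of_linked hl)
  have := h₁.unique hp'
  rw [this] at hm₁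
  exact hm' hm₁

theorem not_linked_of_fork (hS : Stored S K par deg)
    (hF : Fork par A a B E (.vertex u) (.vertex v)) (hm : .edge m ∈ B ++ E) :
    ¬Linked (↑(S.erase m)) u v := by
  obtain ⟨T, hT⟩ := hF.left_end
  obtain ⟨T', hT'⟩ := hF.right_end
  have h1 := hF.left
  have h2 := hF.right
  have hl : ∀ {l T : List (Key V)} {x : V}, l = T ++ [.vertex x] → (.edge m ∈ l ↔ .edge m ∈ T) := by
    rintro l T x rfl
    simp
  rw [hT] at h1
  rw [hT'] at h2
  rcases List.mem_append.1 hm with hm | hm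
  · refine hS.not_linked_erase h1 ((hl hT).1 (by simp [hm])) h2 fun hmT => ?_
    have := (hl hT').2 hmT
    rw [← List.singleton_append, ← List.append_assoc, List.mem_append] at this
    rcases this with h | h
    · have hnd := hF.left.nodup
      rw [← List.singleton_append, ← List.append_assoc, List.nodup_append] at hnd
      exact hnd.2.2 _ h _ hm rfl
    · exact hF.disjoint _ h (by simp [hm])
  · exact fun hlk => hS.not_linked_erase h2 ((hl hT').1 (by simp [hm])) h1
      (fun hmT => hF.disjoint _ hm ((hl hT).2 hmT)) hlk.symm

end Stored

/-! ### The operations -/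

/-- The records `f` at the addresses `K` are link-cut trees of potential `Φ` that represent a
forest of edges in `W` which covers `A`. -/
def Represents (W A : Set (StreamEdge V)) (K : Finset (Key V)) (f : Key V → Record V) (Φ : ℝ) :
    Prop :=
  ∃ (S : Finset (StreamEdge V)) (par : Key V → Option (Key V)) (deg sz : Key V → ℕ)
    (seq : Key V → List (Key V)), ↑S ⊆ W ∧ Covers (↑S) A ∧ Stored S K par deg ∧ Inv K par deg sz seq f ∧
    potential K sz = Φ

namespace Represents

variable {W A : Set (StreamEdge V)} {K : Finset (Key V)} {f : Key V → Record V} {Φ : ℝ}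

theorem empty (f : Key V → Record V) : Represents (∅ : Set (StreamEdge V)) ∅ ∅ f 0 := by
  refine ⟨∅, fun _ => none, fun _ => 0, fun _ => 0, fun _ => [], by simp, by rintro a ⟨⟩,
    ⟨fun x y => ?_, by simp, by simp, by simp, by simp, by simp⟩,
    ⟨by simp, by simp, by simp, by simp, by simp, by simp, by simp, by simp, by simp⟩,
    by simp [potential]⟩
  simp [ParAdj, KAdj]

theorem potential_nonneg (h : Represents W A K f Φ) : 0 ≤ Φ := by
  obtain ⟨S, par, deg, sz, seq, -, -, -, -, rfl⟩ := h
  exact Finset.sum_nonneg fun k _ => logb_nonneg _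

theorem card_le (h : Represents W A K f Φ) {X : Finset V} (hX : ∀ e ∈ W, e.u ∈ X ∧ e.v ∈ X) :
    K.card ≤ 2 * X.card := by
  obtain ⟨S, par, deg, sz, seq, hSW, -, hS, -, -⟩ := h
  exact hS.card_le fun e he => hX e (hSW he)

theorem logb_card_le (n : ℕ) : Real.logb 2 n ≤ Real.logb 2 (n + 3 : ℕ) := by
  rcases Nat.eq_zero_or_pos n with rfl | hn
  · simpa using logb_nonneg 3
  · exact logb_mono hn (by omega)

open Classical in
theorem exec_query (h : Represents W A K f Φ) {G : Set (StreamEdge V)} (hW : W ⊆ G) (hA : G ⊆ A)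
    (u v : V) :
    ∃ f' Φ' N, Exec (query u v) K f (decide (Linked G u v)) K f' N ∧ Represents W A K f' Φ' ∧
      N + 157 * Φ' ≤ 157 * Φ + 16700 * (Real.logb 2 (K.card + 3 : ℕ) + 1) := by
  obtain ⟨S, par, deg, sz, seq, hSW, hC, hS, hI, rfl⟩ := h
  obtain ⟨f', sz', seq', N, hE, hI', hN⟩ := hS.exec_query hI u v
  have hlog := logb_card_le K.card
  have hlog' := logb_nonneg K.card
  simp only [hC.linked_iff (hSW.trans hW) hA] at hE
  exact ⟨f', _, N, hE, ⟨S, par, deg, sz', seq', hSW, hC, hS, hI', rfl⟩, by linarith⟩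

theorem exec_delete (h : Represents W A K f Φ) (e : StreamEdge V) :
    ∃ K' f' Φ' N, Exec (delete e) K f () K' f' N ∧
      Represents (W \ {e}) {a | a ∈ A ∧ e.t < a.t} K' f' Φ' ∧
      N + 157 * Φ' ≤ 157 * Φ + 16700 * (Real.logb 2 (K.card + 3 : ℕ) + 1) := by
  obtain ⟨S, par, deg, sz, seq, hSW, hA, hS, hI, rfl⟩ := h
  have hlog := logb_card_le K.card
  have hlog' := logb_nonneg K.card
  have hSW' : (↑(S.erase e) : Set (StreamEdge V)) ⊆ W \ {e} := by
    rw [Finset.coe_erase]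
    exact Set.sdiff_subset_sdiff_left hSW
  have hA' : Covers (↑(S.erase e)) {a | a ∈ A ∧ e.t < a.t} := by
    rw [Finset.coe_erase]
    exact hA.erase e
  by_cases he : e ∈ S
  · obtain ⟨K', par', deg', f', sz', seq', N, hE, -, hS', hI', hN⟩ := hS.exec_deleteTreeEdge hI he
    refine ⟨K', f', _, 1 + (1 + N), ?_, ⟨_, par', deg', sz', seq', hSW', hA', hS', hI', rfl⟩,
      by push_cast at *; linarith⟩
    unfold delete
    refine Exec.bind_le exec_tick (M := 1 + N) ?_ le_rfl
    refine Exec.bind_le (exec_isStored _) (M := N) ?_ le_rfl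
    rwa [if_pos (by simpa using (hS.mem_edge e).2 he)]
  · rw [Finset.erase_eq_of_notMem he] at hSW' hA'
    refine ⟨K, f, _, 1 + 1, ?_, ⟨S, par, deg, sz, seq, hSW', hA', hS, hI, rfl⟩,
      by push_cast at *; linarith⟩
    unfold delete
    refine Exec.bind_le exec_tick (M := 1) ?_ le_rfl
    refine Exec.bind_le (exec_isStored _) (M := 0) ?_ le_rfl
    rw [if_neg (by simpa using fun hc => he ((hS.mem_edge e).1 hc))]
    exact Exec.pure _

theorem exec_insert (h : Represents W A K f Φ) (e : StreamEdge V) :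
    ∃ K' f' Φ' N, Exec (insert e) K f () K' f' N ∧
      Represents (Insert.insert e W) (Insert.insert e A) K' f' Φ' ∧
      N + 157 * Φ' ≤ 157 * Φ + 16700 * (Real.logb 2 (K.card + 3 : ℕ) + 1) := by
  classical
  obtain ⟨S, par, deg, sz, seq, hSW, hA, hS, hI, rfl⟩ := h
  have hlog := logb_card_le K.card
  have hlog' := logb_nonneg K.card
  have hSW' : (↑S : Set (StreamEdge V)) ⊆ Insert.insert e W :=
    hSW.trans (Set.subset_insert _ _)
  by_cases huv : e.u = e.v
  · refine ⟨K, f, _, 1, ?_, ⟨S, par, deg, sz, seq, hSW', hA.insert_of_subset subset_rfl ?_, hS, hI,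
      rfl⟩, by push_cast at *; linarith⟩
    · unfold insert
      refine Exec.bind_le exec_tick (M := 0) ?_ le_rfl
      rw [if_pos huv]
      exact Exec.pure _
    · rw [huv]
      exact .refl
  obtain ⟨f₁, sz₁, seq₁, N₁, hE₁, hI₁, hN₁⟩ := hS.exec_query hI e.u e.v
  by_cases hl : Linked (↑S) e.u e.v
  swap
  · obtain ⟨K', par', deg', f', sz', seq', N, hE, hS', hI', hN⟩ :=
      hS.exec_insertTreeEdge hI₁ huv hl
    refine ⟨K', f', _, 1 + (N₁ + N), ?_, ⟨_, par', deg', sz', seq', ?_, hA.insert_of_subset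
      (S' := ↑(Insert.insert e S)) (by simp) (linked_edge (e := e) (by simp)), hS', hI', rfl⟩,
      by push_cast at *; linarith⟩
    · unfold insert
      refine Exec.bind_le exec_tick (M := N₁ + N) ?_ le_rfl
      rw [if_neg huv]
      refine Exec.bind_le hE₁ (M := N) ?_ le_rfl
      rwa [if_neg (by simpa using hl)]
    · rw [Finset.coe_insert]
      exact Set.insert_subset_insert hSW
  obtain ⟨hu, hv⟩ := hS.mem_of_linked hl huv
  obtain ⟨o, f₂, sz₂, seq₂, N₂, P, a, B, E, hE₂, hI₂, hF, ho, hN₂⟩ :=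
    hI₁.exec_findMinInCycle hu hv (hS.conn_iff.2 hl)
  by_cases hm : ∃ m, o = some m ∧ m.t < e.t
  · obtain ⟨m, rfl, hme⟩ := hm
    have hmP := ho.1 m rfl
    have hnl := hS.not_linked_of_fork hF hmP
    obtain ⟨K₃, par₃, deg₃, f₃, sz₃, seq₃, N₃, hE₃, hK₃, hS₃, hI₃, hN₃⟩ :=
      hS.exec_deleteTreeEdge hI₂ (hS.mem_of_fork hF hmP)
    obtain ⟨K₄, par₄, deg₄, f₄, sz₄, seq₄, N₄, hE₄, hS₄, hI₄, hN₄⟩ :=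
      hS₃.exec_insertTreeEdge hI₃ huv hnl
    have hlog₃ : Real.logb 2 (K₃.card + 3 : ℕ) ≤ Real.logb 2 (K.card + 3 : ℕ) :=
      logb_mono (by omega) (Nat.add_le_add_right (Finset.card_le_card hK₃) 3)
    refine ⟨K₄, f₄, _, 1 + (N₁ + (N₂ + (N₃ + N₄))), ?_, ⟨_, par₄, deg₄, sz₄, seq₄, ?_, ?_, hS₄, hI₄,
      rfl⟩, by push_cast at *; linarith⟩
    · unfold insert
      refine Exec.bind_le exec_tick (M := N₁ + (N₂ + (N₃ + N₄))) ?_ le_rfl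
      rw [if_neg huv]
      refine Exec.bind_le hE₁ (M := N₂ + (N₃ + N₄)) ?_ le_rfl
      rw [if_pos (by simpa using hl)]
      refine Exec.bind_le hE₂ (M := N₃ + N₄) ?_ le_rfl
      dsimp only
      rw [if_pos hme]
      exact Exec.bind_le hE₃ hE₄ le_rfl
    · rw [Finset.coe_insert, Finset.coe_erase]
      exact Set.insert_subset_insert (Set.sdiff_subset.trans hSW)
    · have hmem : ∀ d ∈ S, d ≠ m → d ∈ Insert.insert e (S.erase m) := fun d hd hdm =>
        Finset.mem_insert_of_mem (Finset.mem_erase.2 ⟨hdm, hd⟩)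
      refine hA.insert (fun b _ d hd hbd => ?_) (linked_edge (e := e) (by simp))
      by_cases hdm : d = m
      -- the cycle bypasses `m` by edges that are not older than `m`
      · subst hdm
        refine hS.linked_exchange hF hmP ⟨by simp, by linarith⟩ fun c hc hcP hcd =>
          ⟨hmem c hc hcd, ?_⟩
        obtain ⟨m', hm', hle⟩ := ho.2 c hcP
        cases hm'
        linarith
      · exact linked_edge (S := {d | d ∈ _ ∧ _}) ⟨hmem d hd hdm, hbd⟩
  · refine ⟨K, f₂, _, 1 + (N₁ + (N₂ + 0)), ?_, ⟨S, par, deg, sz₂, seq₂, hSW',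
      hA.insert_of_subset subset_rfl ?_, hS, hI₂, rfl⟩, by push_cast at *; linarith⟩
    · unfold insert
      refine Exec.bind_le exec_tick (M := N₁ + (N₂ + 0)) ?_ le_rfl
      rw [if_neg huv]
      refine Exec.bind_le hE₁ (M := N₂ + 0) ?_ le_rfl
      rw [if_pos (by simpa using hl)]
      refine Exec.bind_le hE₂ (M := 0) ?_ le_rfl
      rcases o with _ | m
      · exact Exec.pure _
      · dsimp only
        rw [if_neg fun hc => hm ⟨m, rfl, hc⟩]
        exact Exec.pure _
    · refine hS.linked_of_fork hF fun d hd hdP => ⟨hd, ?_⟩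
      obtain ⟨m, rfl, hle⟩ := ho.2 d hdP
      have : ¬m.t < e.t := fun hc => hm ⟨m, rfl, hc⟩
      linarith

end Represents

/-! ### Sliding windows -/

namespace Input

variable (I : Input V)

/-- The edges of the `i`-th snapshot. -/
def edges (i : ℕ) : Set (StreamEdge V) := I.stream '' I.window i

/-- The edges of the snapshot before the `i`-th one. -/
def edgesBefore : ℕ → Set (StreamEdge V)
  | 0 => ∅
  | i + 1 => I.edges i

variable {I}

theorem window_finite (hmono : Monotone fun j => (I.stream j).t)
    (hunbounded : ∀ τ : ℤ, ∃ j, τ < (I.stream j).t) (i : ℕ) : (I.window i).Finite := by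
  obtain ⟨J, hJ⟩ := hunbounded (I.te i)
  refine (Set.finite_lt_nat J).subset fun j hj => ?_
  by_contra hjJ
  exact absurd (hmono (not_lt.1 hjJ)) (not_le.2 (lt_of_le_of_lt hj.2 hJ))

theorem fresh_finite (hfin : ∀ i, (I.window i).Finite) (i : ℕ) : (I.fresh i).Finite := by
  cases i with
  | zero => exact hfin 0
  | succ i => exact (hfin (i + 1)).subset Set.sdiff_subset

theorem expired_finite (hfin : ∀ i, (I.window i).Finite) (i : ℕ) : (I.expired i).Finite := by
  cases i with
  | zero => exact Set.finite_empty
  | succ i => exact (hfin i).subset Set.sdiff_subset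

theorem fresh_subset (i : ℕ) : I.fresh i ⊆ I.window i := by
  cases i with
  | zero => exact subset_rfl
  | succ i => exact Set.sdiff_subset

theorem edgesBefore_subset_prev (i : ℕ) : I.edgesBefore i ⊆ I.edges (i - 1) := by
  cases i with
  | zero => exact Set.empty_subset _
  | succ i => exact subset_rfl

theorem edgesBefore_subset (i : ℕ) :
    I.edgesBefore i \ I.stream '' I.expired i ⊆ I.edges i := by
  cases i with
  | zero => exact Set.sdiff_subset.trans (Set.empty_subset _)
  | succ i =>
    rintro _ ⟨⟨j, hj, rfl⟩, hne⟩
    refine ⟨j, ?_, rfl⟩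
    by_contra hj'
    exact hne ⟨j, ⟨hj, hj'⟩, rfl⟩

/-- The edges that expire are older than those that remain. -/
theorem edges_subset (hslide : 0 < I.slide) (i : ℕ) :
    I.edges i ⊆ {a | a ∈ I.edgesBefore i ∧ ∀ j ∈ I.expired i, (I.stream j).t < a.t} ∪
      I.stream '' I.fresh i := by
  cases i with
  | zero => exact Set.subset_union_right
  | succ i =>
    rintro _ ⟨k, hk, rfl⟩
    by_cases hki : k ∈ I.window i
    · refine Or.inl ⟨⟨k, hki, rfl⟩, fun j hj => ?_⟩
      have h1 := hj.1.2
      have h2 := hk.1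
      have h3 : ¬(I.tb (i + 1) ≤ (I.stream j).t ∧ (I.stream j).t ≤ I.te (i + 1)) := hj.2
      have h4 : I.te i < I.te (i + 1) := by
        unfold te tb
        push_cast
        linarith
      by_contra h5
      exact h3 ⟨by linarith, by linarith⟩
    · exact Or.inr ⟨k, ⟨hk, hki⟩, rfl⟩

theorem reachable_iff (i : ℕ) (x y : V) :
    (I.graph i).Reachable x y ↔ Linked (I.edges i) x y := by
  rw [SimpleGraph.reachable_iff_reflTransGen]
  constructor
  · intro h
    refine Relation.ReflTransGen.mono (fun a b hab => ?_) x y h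
    rw [graph, SimpleGraph.fromRel_adj] at hab
    obtain ⟨-, ⟨j, hj, h1, h2⟩ | ⟨j, hj, h1, h2⟩⟩ := hab
    · exact ⟨_, ⟨j, hj, rfl⟩, Or.inl ⟨h1, h2⟩⟩
    · exact ⟨_, ⟨j, hj, rfl⟩, Or.inr ⟨h1, h2⟩⟩
  · intro h
    induction h with
    | refl => exact .refl
    | @tail a b _ hab ih =>
      by_cases hne : a = b
      · rwa [← hne]
      · refine ih.tail ?_
        rw [graph, SimpleGraph.fromRel_adj]
        obtain ⟨_, ⟨j, hj, rfl⟩, h⟩ := hab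
        exact ⟨hne, h.imp (fun h => ⟨j, hj, h⟩) (fun h => ⟨j, hj, h⟩)⟩

/-- The vertices of a finite snapshot as a finite set. -/
theorem exists_vertices {i : ℕ} (hfin : (I.window i).Finite) :
    ∃ X : Finset V, X.card = I.numVertices i ∧ ∀ e ∈ I.edges i, e.u ∈ X ∧ e.v ∈ X := by
  have hX : {x : V | ∃ j ∈ I.window i, x = (I.stream j).u ∨ x = (I.stream j).v}.Finite := by
    refine ((hfin.image fun j => (I.stream j).u).union
      (hfin.image fun j => (I.stream j).v)).subset ?_
    rintro x ⟨j, hj, rfl | rfl⟩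
    · exact Or.inl ⟨j, hj, rfl⟩
    · exact Or.inr ⟨j, hj, rfl⟩
  refine ⟨hX.toFinset, (Set.ncard_eq_toFinset_card _ hX).symm, ?_⟩
  rintro _ ⟨j, hj, rfl⟩
  exact ⟨hX.mem_toFinset.2 ⟨j, hj, Or.inl rfl⟩, hX.mem_toFinset.2 ⟨j, hj, Or.inr rfl⟩⟩

end Input

theorem mem_arrivalList {s : Set ℕ} (hs : s.Finite) {j : ℕ} : j ∈ arrivalList s ↔ j ∈ s := by
  rw [arrivalList, dif_pos hs, Finset.mem_sort, hs.mem_toFinset]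

/-- A sequence of operations, each with the number of its snapshot, is legal for stored edges in `W`
and covered edges `A` if the stored edges always belong to the snapshot, and if at a query all the
edges of the snapshot are covered. -/
def Legal (I : Input V) (W A : Set (StreamEdge V)) : List (Op V × ℕ) → Prop
  | [] => True
  | (.insert e, i) :: l =>
    Insert.insert e W ⊆ I.edges i ∧ Legal I (Insert.insert e W) (Insert.insert e A) l
  | (.delete e, i) :: l => W ⊆ I.edges i ∧ Legal I (W \ {e}) {a | a ∈ A ∧ e.t < a.t} l
  | (.query _ _, i) :: l => W ⊆ I.edges i ∧ I.edges i ⊆ A ∧ Legal I W A l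

namespace Legal

variable {I : Input V} {W W' A A' : Set (StreamEdge V)} {l l' : List (Op V × ℕ)}

theorem mono (h : Legal I W A l) (hW : W' ⊆ W) (hA : A ⊆ A') : Legal I W' A' l := by
  induction l generalizing W W' A A' with
  | nil => trivial
  | cons o l ih =>
    obtain ⟨o | o | ⟨u, v⟩, i⟩ := o
    · exact ⟨(Set.insert_subset_insert hW).trans h.1,
        ih h.2 (Set.insert_subset_insert hW) (Set.insert_subset_insert hA)⟩
    · exact ⟨hW.trans h.1, ih h.2 (Set.sdiff_subset_sdiff_left hW) fun a ha => ⟨hA ha.1, ha.2⟩⟩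
    · exact ⟨hW.trans h.1, h.2.1.trans hA, ih h.2.2 hW hA⟩

theorem of_append (h : Legal I W A (l ++ l')) : Legal I W A l := by
  induction l generalizing W A with
  | nil => trivial
  | cons o l ih =>
    obtain ⟨o | o | ⟨u, v⟩, i⟩ := o
    · exact ⟨h.1, ih h.2⟩
    · exact ⟨h.1, ih h.2⟩
    · exact ⟨h.1, h.2.1, ih h.2.2⟩

theorem deletions {i : ℕ} (hW : W ⊆ I.edges i) {s : List ℕ}
    (h : Legal I (W \ I.stream '' {j | j ∈ s}) {a | a ∈ A ∧ ∀ j ∈ s, (I.stream j).t < a.t} l) :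
    Legal I W A (s.map (fun j => (Op.delete (I.stream j), i)) ++ l) := by
  induction s generalizing W A with
  | nil => exact h.mono (fun a ha => ⟨ha, by simp⟩) fun a ha => ha.1
  | cons k s ih =>
    refine ⟨hW, ih (Set.sdiff_subset.trans hW) (h.mono ?_ ?_)⟩
    · rintro a ⟨⟨ha, hak⟩, has⟩
      refine ⟨ha, ?_⟩
      rintro ⟨j, hj, rfl⟩
      rcases List.mem_cons.1 hj with rfl | hj
      · exact hak rfl
      · exact has ⟨j, hj, rfl⟩
    · rintro a ⟨ha, has⟩
      exact ⟨⟨ha, has k (by simp)⟩, fun j hj => has j (by simp [hj])⟩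

theorem insertions {i : ℕ} (hW : W ⊆ I.edges i) {s : List ℕ} (hs : ∀ j ∈ s, j ∈ I.window i)
    (h : Legal I (W ∪ I.stream '' {j | j ∈ s}) (A ∪ I.stream '' {j | j ∈ s}) l) :
    Legal I W A (s.map (fun j => (Op.insert (I.stream j), i)) ++ l) := by
  induction s generalizing W A with
  | nil => exact h.mono Set.subset_union_left (by simp)
  | cons k s ih =>
    have hk : Insert.insert (I.stream k) W ⊆ I.edges i :=
      Set.insert_subset ⟨k, hs k (by simp), rfl⟩ hW
    have key : ∀ X : Set (StreamEdge V), Insert.insert (I.stream k) X ∪ I.stream '' {j | j ∈ s} =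
        X ∪ I.stream '' {j | j ∈ k :: s} := by
      intro X
      have : {j | j ∈ k :: s} = Insert.insert k {j | j ∈ s} := by ext j; simp
      rw [this, Set.image_insert_eq, Set.insert_union, Set.union_insert]
    exact ⟨hk, ih hk (fun j hj => hs j (by simp [hj])) (by rwa [key, key])⟩

theorem queries {i : ℕ} (hW : W ⊆ I.edges i) (hA : I.edges i ⊆ A) {s : List (V × V)}
    (h : Legal I W A l) : Legal I W A (s.map (fun q => (Op.query q.1 q.2, i)) ++ l) := by
  induction s with
  | nil => exact h
  | cons q s ih => exact ⟨hW, hA, ih⟩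

theorem schedule (hfin : ∀ i, (I.window i).Finite) (hslide : 0 < I.slide) {expiry : ℕ → List ℕ}
    (hexpiry : ∀ i, (expiry i).Perm (arrivalList (I.expired i))) (queries : ℕ → List (V × V))
    (N : ℕ) : Legal I ∅ ∅ (schedule I expiry queries N) := by
  have hmem : ∀ i j, j ∈ expiry i ↔ j ∈ I.expired i := fun i j => by
    rw [(hexpiry i).mem_iff, mem_arrivalList (Input.expired_finite hfin i)]
  have hfresh : ∀ i j, j ∈ arrivalList (I.fresh i) ↔ j ∈ I.fresh i := fun i j =>
    mem_arrivalList (Input.fresh_finite hfin i)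
  have key : ∀ n i, Legal I (I.edgesBefore i) (I.edgesBefore i)
      ((List.range' i n).flatMap fun i =>
        (expiry i).map (fun j => (Op.delete (I.stream j), i - 1)) ++
        (arrivalList (I.fresh i)).map (fun j => (Op.insert (I.stream j), i)) ++
        (queries i).map (fun q => (Op.query q.1 q.2, i))) := by
    intro n
    induction n with
    | zero => exact fun i => trivial
    | succ n ih =>
      intro i
      rw [List.range'_succ, List.flatMap_cons, List.append_assoc, List.append_assoc]
      have hW := Input.edgesBefore_subset (I := I) i
      have hA := Input.edges_subset hslide i
      have hF : I.stream '' I.fresh i ⊆ I.edges i := Set.image_mono (Input.fresh_subset i)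
      refine deletions (Input.edgesBefore_subset_prev i) ?_
      simp only [hmem, Set.ofPred_mem_eq]
      refine insertions hW (fun j hj => Input.fresh_subset i ((hfresh i j).1 hj)) ?_
      simp only [hfresh, Set.ofPred_mem_eq]
      exact Legal.queries (Set.union_subset hW hF) hA ((ih (i + 1)).mono (Set.union_subset hW hF) hA)
  rw [OMST.schedule, List.range_eq_range']
  exact key (N + 1) 0

end Legal

/-! ### Sequences of operations -/

theorem one_le_logBound (n : ℕ) : 1 ≤ logBound n := le_max_left _ _

theorem logb_le_logBound {k n : ℕ} (h : k ≤ 2 * n) :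
    Real.logb 2 (k + 3 : ℕ) + 1 ≤ 5 * logBound n := by
  have h8 : Real.logb 2 8 = 3 := by
    rw [show (8 : ℝ) = 2 ^ (3 : ℝ) by norm_num, Real.logb_rpow (by norm_num) (by norm_num)]
  have h1 := one_le_logBound n
  rcases Nat.eq_zero_or_pos n with rfl | hn
  · have := logb_mono (a := k + 3) (b := 8) (by omega) (by omega)
    push_cast at this ⊢
    linarith
  · have h2 := logb_mono (a := k + 3) (b := 8 * n) (by omega) (by omega)
    have h3 : Real.logb 2 n ≤ logBound n := le_max_right _ _
    rw [Nat.cast_mul, Real.logb_mul (by norm_num) (by exact_mod_cast hn.ne')] at h2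
    push_cast at h2 ⊢
    linarith

theorem space_toMem (K : Finset (Key V)) (f : Key V → Record V) (t : ℕ) :
    (toMem K f t).space = K.card := by
  have : {k | ((toMem K f t).record k).isSome} = (↑K : Set (Key V)) := by
    ext k
    by_cases h : k ∈ K <;> simp [toMem, h]
  rw [Memory.space, this, Set.encard_coe_eq_coe_finsetCard]

/-- A legal sequence of operations takes no longer than the sum of the amortized costs. If the
records stored at first are bounded by the size of the snapshot `i`, those that remain are bounded
by the size of the last snapshot. -/
theorem Represents.exec_run {I : Input V} (hfin : ∀ i, (I.window i).Finite)
    {l : List (Op V × ℕ)} {W A : Set (StreamEdge V)} {K : Finset (Key V)}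
    {f : Key V → Record V} {Φ : ℝ} (h : Represents W A K f Φ) (hl : Legal I W A l) {i : ℕ}
    (hi : K.card ≤ 2 * I.numVertices i) :
    ∃ K' f' Φ' N, Exec (run (l.map Prod.fst)) K f (correctAnswers I l) K' f' N ∧ 0 ≤ Φ' ∧
      N + 157 * Φ' ≤ 157 * Φ + 83500 * (l.map fun o => logBound (I.numVertices o.2)).sum ∧
      K'.card ≤ 2 * I.numVertices ((l.map Prod.snd).getLastD i) := by
  classical
  have hcard : ∀ {W A K f Φ i}, Represents W A K f Φ → W ⊆ I.edges i →
      K.card ≤ 2 * I.numVertices i := by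
    intro W A K f Φ i h hW
    obtain ⟨X, hX, hX'⟩ := Input.exists_vertices (hfin i)
    rw [← hX]
    exact h.card_le fun e he => hX' e (hW he)
  induction l generalizing W A K f Φ i with
  | nil => exact ⟨K, f, Φ, 0, Exec.pure _, h.potential_nonneg, by simp, hi⟩
  | cons o l ih =>
    simp only [List.map_cons, List.sum_cons, List.getLastD_cons]
    obtain ⟨e | e | ⟨u, v⟩, k⟩ := o
    · have hlog := logb_le_logBound (hcard h ((Set.subset_insert _ _).trans hl.1))
      obtain ⟨K₁, f₁, Φ₁, N₁, hE₁, h₁, hN₁⟩ := h.exec_insert e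
      obtain ⟨K₂, f₂, Φ₂, N₂, hE₂, hΦ, hN₂, hK⟩ := ih h₁ hl.2 (hcard h₁ hl.1)
      exact ⟨K₂, f₂, Φ₂, N₁ + N₂, hE₁.bind hE₂, hΦ, by push_cast at *; linarith, hK⟩
    · have hlog := logb_le_logBound (hcard h hl.1)
      obtain ⟨K₁, f₁, Φ₁, N₁, hE₁, h₁, hN₁⟩ := h.exec_delete e
      obtain ⟨K₂, f₂, Φ₂, N₂, hE₂, hΦ, hN₂, hK⟩ :=
        ih h₁ hl.2 (hcard h₁ (Set.sdiff_subset.trans hl.1))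
      exact ⟨K₂, f₂, Φ₂, N₁ + N₂, hE₁.bind hE₂, hΦ, by push_cast at *; linarith, hK⟩
    · have hlog := logb_le_logBound (hcard h hl.1)
      obtain ⟨f₁, Φ₁, N₁, hE₁, h₁, hN₁⟩ := h.exec_query hl.1 hl.2.1 u v
      obtain ⟨K₂, f₂, Φ₂, N₂, hE₂, hΦ, hN₂, hK⟩ := ih h₁ hl.2.2 (hcard h₁ hl.1)
      refine ⟨K₂, f₂, Φ₂, N₁ + (N₂ + 0), ?_, hΦ, by push_cast at *; linarith, hK⟩
      have hans : correctAnswers I ((.query u v, k) :: l) =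
          decide (Linked (I.edges k) u v) :: correctAnswers I l := by
        simp only [← Input.reachable_iff]
        rfl
      rw [hans]
      exact hE₁.bind (hE₂.bind (Exec.pure _))

end OMST

theorem mainTheorem4 :
    ∃ C : ℕ, ∀ (V : Type) [DecidableEq V] (I : OMST.Input V)
      (_hmono : Monotone fun j => (I.stream j).t)
      (_hunbounded : ∀ τ : ℤ, ∃ j, τ < (I.stream j).t)
      (_hslide : 0 < I.slide) (_hsize : I.slide < I.size)
      (expiry : ℕ → List ℕ)
      (_hexpiry : ∀ i, (expiry i).Perm (OMST.arrivalList (I.expired i)))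
      (queries : ℕ → List (V × V)) (N : ℕ) (l : List (OMST.Op V × ℕ))
      (_hl : l <+: OMST.schedule I expiry queries N),
      ∃ (answers : List Bool) (m : OMST.Memory V),
        (OMST.run (l.map Prod.fst)).run OMST.Memory.empty = some (answers, m) ∧
        answers = OMST.correctAnswers I l ∧
        (m.time : ℝ) ≤ C * (l.map fun o => OMST.logBound (I.numVertices o.2)).sum ∧
        ∀ o, l.getLast? = some o → m.space ≤ C * I.numVertices o.2 := by
  -- `83500 = 5 * 16700`, where `16700` bounds the cost of an insertion that exchanges edges, and `5`
  -- stems from `logb_le_logBound`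
  refine ⟨83500, fun V _ I hmono hunbounded hslide _ expiry hexpiry queries N l hl => ?_⟩
  have hfin := OMST.Input.window_finite hmono hunbounded
  obtain ⟨l', hl'⟩ := hl
  have hlegal : OMST.Legal I ∅ ∅ l := by
    refine OMST.Legal.of_append (l' := l') ?_
    rw [hl']
    exact OMST.Legal.schedule hfin hslide hexpiry queries N
  obtain ⟨K, f, Φ, n, hE, hΦ, hn, hK⟩ :=
    (OMST.Represents.empty fun _ => {}).exec_run hfin hlegal (i := 0) (by simp)
  obtain ⟨n', hn', hrun⟩ := hE 0
  have hempty : (OMST.Memory.empty : OMST.Memory V) = OMST.toMem ∅ (fun _ => {}) 0 := by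
    simp [OMST.Memory.empty, OMST.toMem]
  refine ⟨_, OMST.toMem K f (0 + n'), by rw [hempty]; exact hrun, rfl, ?_, fun o ho => ?_⟩
  · have : (n' : ℝ) ≤ n := by exact_mod_cast hn'
    simp only [OMST.toMem, Nat.zero_add]
    push_cast
    linarith
  · rw [OMST.space_toMem]
    rw [List.getLastD_eq_getLast?, List.getLast?_map, ho] at hK
    simp only [Option.map_some, Option.getD_some] at hK
    have : K.card ≤ 83500 * I.numVertices o.2 := by omega
    exact_mod_cast this
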